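/- Let $n\ge 2$. For $a\ge 0$ let a Clebsch–Gordan (CG) transform $C_a$ be a unitary change of basis on (spin $a/2$)$\,\otimes\,$(spin $1/2$) from the product basis to the basis of joint eigenvectors $|J,M\rangle$, $J\in\{(a+1)/2,(a-1)/2\}$ (only $J=1/2$ if $a=0$), of the composite total spin $\mathbf J^2$ and spin projection $J^z$, with relative phases within each multiplet fixed by the composite lowering operator ($J^-|J,M\rangle=\sqrt{J(J+1)-M(M-1)}\,|J,M-1\rangle$). Such transforms exist for every $a$; let $(C_a)_{a\ge0}$ be any choice of them. Then each row of $C_a$ has at most two nonzero entries. Consider a register made of $n-2$ qubits $\mathbf{seq}$, $\lceil\log_2(\lfloor n/2\rfloor+1)\rceil$ qubits $\mathbf{par}$ and $\lceil\log_2(n+1)\rceil$ qubits $\mathbf{stat}$, initially holding the $n$ computational qubits and ancillas in state $0$. After the $(k-1)$-st step a Schur basis for the first $k$ qubits is encoded as $|s\rangle\otimes|\mu_2\rangle\otimes|i\rangle$, where $s$ (the "column", a state of the $\mathbf{seq}$ qubits created so far) labels the copy of the irrep $\mathcal Q_\mu$ of $U(2)$, $\mu=(k-\mu_2,\mu_2)$,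 and $0\le i\le k-2\mu_2$ labels a state in it. For $k=1,\dots,n-1$, step $k$ acts, identically on all columns, on the new computational qubit together with $\mathbf{par}$ and $\mathbf{stat}$, and is the product of (a) the super-CG transform, i.e. the direct sum of the CG transforms $C_{k-2\mu_2}$ on $\mathcal Q_\mu\otimes\mathbb C^2$, $0\le\mu_2\le\lfloor k/2\rfloor$, and the identity on unused basis states, and (b) a reordering permutation matrix that moves the states of the resulting irreps $(k+1-\mu_2,\mu_2)$ and $(k-\mu_2,\mu_2+1)$ to the slots of these irreps; for $k\ge2$ the new qubit becomes a new $\mathbf{seq}$ qubit that distinguishes the two cases. A two-level unitary is a unitary matrix that acts as the identity on all but two basis states; here it acts on the qubits of step $k$ and is tensored with the identity on all other qubits. The reordering permutations can be chosen such that: 1. The product of the steps $k=1,\dots,n-1$ performs a Schur transform on $n$ qubits: on computational basis states it is a unitary change of basis, followed by the encoding in $\mathbf{seq},\mathbf{par},\mathbf{stat}$, to a basis in which $$(\mathbb C^2)^{\otimes n}=\bigoplus_{\lambda=(n-l,\,l),\ 0\le l\le\lfloor n/2\rfloor}\mathcal P_\lambda\otimes\mathcal Q_\lambda$$ holds as an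 equality of modules of $S_n\times U(2)$ (permutation of tensor factors, and $U^{\otimes n}$), where the $\mathcal P_\lambda$ are pairwise inequivalent irreps of $S_n$ and the $\mathcal Q_\lambda$ are pairwise inequivalent irreps of $U(2)$ with highest weights $\lambda$ and bases of weight vectors in order of decreasing spin projection. 2. For each $k$ the super-CG transform is a product of at most $4\sum_{\mu_2=0}^{\lfloor k/2\rfloor}(k-2\mu_2+1)$ two-level unitaries, and the reordering permutation matrix is a product of at most $2\sum_{\mu_2=0}^{\lfloor k/2\rfloor}(k-2\mu_2+1)$ two-level unitaries. Consequently the whole product is a product of at most $6\sum_{k=1}^{n-1}\sum_{\mu_2=0}^{\lfloor k/2\rfloor}(k-2\mu_2+1)$ two-level unitaries. 3. This number satisfies $$6\sum_{k=1}^{n-1}\sum_{\mu_2=0}^{\lfloor k/2\rfloor}(k-2\mu_2+1)\;\le\;\tfrac12 n^3+\tfrac94 n^2+\tfrac{13}4 n-6\;<\;2n^3 .$$ -/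

import Mathlib

open scoped Matrix Kronecker

namespace QSchur

noncomputable section

/-! ### Spin operators and Clebsch–Gordan transforms (units with `ℏ = 1`) -/

/-- Spin projection `J^z` on the irrep of dimension `d`, i.e. of spin `j = (d - 1) / 2`.  The basis
state with index `i` is `|j, m⟩` with `m = j - i`. -/
def spinZ (d : ℕ) : Matrix (Fin d) (Fin d) ℂ :=
  Matrix.diagonal fun i => ((d : ℂ) - 1) / 2 - (i : ℕ)

/-- Lowering operator `J^-` on the irrep of dimension `d`:
`J^- |j, m⟩ = √(j (j + 1) - m (m - 1)) |j, m - 1⟩`, and `j (j + 1) - m (m - 1) = (i + 1) (d - 1 - i)`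
for `m = j - i`. -/
def spinLower (d : ℕ) : Matrix (Fin d) (Fin d) ℂ :=
  Matrix.of fun r c =>
    if (r : ℕ) = (c : ℕ) + 1 then
      ((Real.sqrt (((c : ℕ) + 1 : ℝ) * ((d : ℝ) - 1 - (c : ℕ))) : ℝ) : ℂ)
    else 0

/-- The eigenvalue `j (j + 1)` of `J²` on the irrep of dimension `d = 2 j + 1`. -/
def spinSqValue (d : ℕ) : ℂ := (((d : ℂ) - 1) / 2) * (((d : ℂ) - 1) / 2 + 1)

/-- Composite `J^z = J^z ⊗ 1 + 1 ⊗ J^z` on (spin `a / 2`) ⊗ (spin `1 / 2`). -/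
def compZ (a : ℕ) : Matrix (Fin (a + 1) × Fin 2) (Fin (a + 1) × Fin 2) ℂ :=
  spinZ (a + 1) ⊗ₖ 1 + 1 ⊗ₖ spinZ 2

/-- Composite `J^-` on (spin `a / 2`) ⊗ (spin `1 / 2`). -/
def compLower (a : ℕ) : Matrix (Fin (a + 1) × Fin 2) (Fin (a + 1) × Fin 2) ℂ :=
  spinLower (a + 1) ⊗ₖ 1 + 1 ⊗ₖ spinLower 2

/-- Composite `J² = J^- J^+ + (J^z)² + J^z`, where `J^+ = (J^-)†`. -/
def compSq (a : ℕ) : Matrix (Fin (a + 1) × Fin 2) (Fin (a + 1) × Fin 2) ℂ :=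
  compLower a * (compLower a)ᴴ + compZ a * compZ a + compZ a

/-- `C` is a Clebsch–Gordan transform adding a spin `1 / 2` to a spin `a / 2`: the unitary change of
basis from the product basis to the basis of joint eigenvectors `|J, M⟩` of the composite `J²` and
`J^z`, with `J = (a + 1) / 2` (rows `Sum.inl i`, `M = J - i`) and `J = (a - 1) / 2` (rows `Sum.inr i`,
none if `a = 0`), the relative phases within a multiplet being those produced by the
composite lowering operator. -/
structure IsClebschGordan (a : ℕ)
    (C : Matrix (Fin (a + 2) ⊕ Fin a) (Fin (a + 1) × Fin 2) ℂ) : Prop where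
  mul_conjTranspose : C * Cᴴ = 1
  conjTranspose_mul : Cᴴ * C = 1
  totalSpin : C * compSq a =
    Matrix.fromBlocks (spinSqValue (a + 2) • (1 : Matrix (Fin (a + 2)) (Fin (a + 2)) ℂ)) 0 0
      (spinSqValue a • (1 : Matrix (Fin a) (Fin a) ℂ)) * C
  projection : C * compZ a = Matrix.fromBlocks (spinZ (a + 2)) 0 0 (spinZ a) * C
  lowering : C * compLower a = Matrix.fromBlocks (spinLower (a + 2)) 0 0 (spinLower a) * C

/-! ### Two-level unitaries -/

/-- A two-level unitary: a unitary that acts as the identity on all but two of the basis states. -/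
def IsTwoLevel {ι : Type*} [Fintype ι] [DecidableEq ι] (V : Matrix ι ι ℂ) : Prop :=
  V * Vᴴ = 1 ∧ ∃ i j : ι, i ≠ j ∧
    ∀ x y : ι, ¬ ((x = i ∨ x = j) ∧ (y = i ∨ y = j)) → V x y = (1 : Matrix ι ι ℂ) x y

/-- The operator of a circuit given as a list of gates, the head of the list being applied first. -/
def circuit {ι : Type*} [Fintype ι] [DecidableEq ι] (L : List (Matrix ι ι ℂ)) : Matrix ι ι ℂ :=
  L.reverse.prod

/-! ### The register

The register consists of `n - 2` **seq** qubits, the **par** qubits, which hold `μ₂` for the partition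
`μ = (μ₁, μ₂)`, and the **stat** qubits, which hold the index of a state within an irrep.  Basis states
of **par** and **stat** are written as numbers.  In step `k` (which lifts `k` to `k + 1` qubits) the new
computational qubit sits, for `k ≥ 2`, on the **seq** wire `k - 2`, and becomes the new **seq** qubit.
For `k = 1` there is no such wire: the new qubit sits on the lowest **par** qubit. -/

/-- Number of **par** qubits for `n` computational qubits. -/
def parQubits (n : ℕ) : ℕ := Nat.clog 2 (n / 2 + 1)

/-- Number of **stat** qubits for `n` computational qubits. -/
def statQubits (n : ℕ) : ℕ := Nat.clog 2 (n + 1)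

/-- Basis states of the **par** register. -/
abbrev Par (n : ℕ) : Type := Fin (2 ^ parQubits n)

/-- Basis states of the **stat** register. -/
abbrev Stat (n : ℕ) : Type := Fin (2 ^ statQubits n)

/-- Basis states of the **seq** register, which label the columns. -/
abbrev Seq (n : ℕ) : Type := Fin (n - 2) → Fin 2

/-- Basis states of the whole register. -/
abbrev Reg (n : ℕ) : Type := Seq n × Par n × Stat n

/-- The wire of the new computational qubit in step `k` (none if `k = 1`). -/
abbrev NewWire (n k : ℕ) : Type := {w : Fin (n - 2) // (w : ℕ) + 2 = k}

/-- Basis states of the qubits on which step `k` acts: the new qubit, **par** and **stat**. -/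
abbrev Work (n k : ℕ) : Type := (NewWire n k → Fin 2) × Par n × Stat n

/-- The basis states of the qubits on which step `k` acts that belong to a given state of the
register. -/
def toWork (n k : ℕ) (x : Reg n) : Work n k := (fun w => x.1 w.1, x.2)

/-- The operator `V` of step `k`, tensored with the identity on all other qubits, that is, copied over
all the columns. -/
def lift (n k : ℕ) (V : Matrix (Work n k) (Work n k) ℂ) : Matrix (Reg n) (Reg n) ℂ :=
  Matrix.of fun x y =>
    if ∀ w : Fin (n - 2), (w : ℕ) + 2 ≠ k → x.1 w = y.1 w then V (toWork n k x) (toWork n k y) else 0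

/-- The computational basis state `x` of `n` qubits, placed into the register with all ancillas `0`. -/
def initial (n : ℕ) (hn : 2 ≤ n) (x : Fin n → Fin 2) : Reg n :=
  (fun w => x ⟨(w : ℕ) + 2, by omega⟩, Fin.ofNat _ (x ⟨1, by omega⟩ : ℕ),
    Fin.ofNat _ (x ⟨0, by omega⟩ : ℕ))

/-! ### The iteration step -/

/-- The used basis states at the beginning of step `k`, over all slots: the slot of
`μ = (k - l, l)` holds `Q_μ ⊗ (new qubit)`. -/
abbrev SlotState (k : ℕ) : Type := Σ l : Fin (k / 2 + 1), Fin (k - 2 * (l : ℕ) + 1) × Fin 2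

/-- Position of a used basis state.  (No reduction modulo the register size occurs for
`1 ≤ k ≤ n - 1`.) -/
def slotPos (n k : ℕ) (e : SlotState k) : Work n k :=
  (fun _ => e.2.2, Fin.ofNat _ ((e.1 : ℕ) + if k = 1 then (e.2.2 : ℕ) else 0),
    Fin.ofNat _ (e.2.1 : ℕ))

/-- The order of the output of a Clebsch–Gordan transform within its slot: the entries of the slot are
numbered by `2 i + b`; first come the states of spin `(a + 1) / 2`, then those of spin
`(a - 1) / 2`. -/
def outIndex (a : ℕ) : Fin (a + 2) ⊕ Fin a ≃ Fin (a + 1) × Fin 2 :=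
  (finSumFinEquiv.trans (finCongr (by omega : a + 2 + a = (a + 1) * 2))).trans finProdFinEquiv.symm

/-- A family of candidate Clebsch–Gordan matrices, one for each spin `a / 2`. -/
abbrev CGFamily : Type := ∀ a : ℕ, Matrix (Fin (a + 2) ⊕ Fin a) (Fin (a + 1) × Fin 2) ℂ

/-- The direct sum of the Clebsch–Gordan transforms over all slots of step `k`. -/
def superBlocks (C : CGFamily) (k : ℕ) : Matrix (SlotState k) (SlotState k) ℂ :=
  Matrix.blockDiagonal' fun l : Fin (k / 2 + 1) =>
    (C (k - 2 * (l : ℕ))).submatrix (outIndex (k - 2 * (l : ℕ))).symm id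

/-- The matrix that places the used basis states of step `k` at their positions. -/
def slotEmbed (n k : ℕ) : Matrix (Work n k) (SlotState k) ℂ :=
  Matrix.of fun x e => if x = slotPos n k e then 1 else 0

/-- The super-Clebsch–Gordan transform of step `k`: the direct sum of the Clebsch–Gordan transforms on
the used basis states, the identity on the unused (ghost) ones. -/
def superCG (n k : ℕ) (C : CGFamily) : Matrix (Work n k) (Work n k) ℂ :=
  slotEmbed n k * superBlocks C k * (slotEmbed n k)ᴴ + (1 - slotEmbed n k * (slotEmbed n k)ᴴ)

/-- The permutation `π` reorders the basis after the super-Clebsch–Gordan transform of step `k`: the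
`i`-th state of the new irrep `λ = (k + 1 - l, l)`, which arose by adding a box to the first row of
`μ = (k - l, l)`, goes to the slot of `λ` in the column whose new **seq** qubit is `0`; that of
`λ = (k - l, l + 1)`, which arose by adding a box to the second row, goes to the slot of `λ` in the
column whose new **seq** qubit is `1`.  For `k = 1` there is no new **seq** qubit. -/
def IsReordering (n k : ℕ) (π : Equiv.Perm (Work n k)) : Prop :=
  ∀ l : Fin (k / 2 + 1),
    (∀ i : Fin (k - 2 * (l : ℕ) + 2),
      π (slotPos n k ⟨l, outIndex _ (Sum.inl i)⟩) =
        (fun _ => 0, Fin.ofNat _ (l : ℕ), Fin.ofNat _ (i : ℕ))) ∧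
    (∀ i : Fin (k - 2 * (l : ℕ)),
      π (slotPos n k ⟨l, outIndex _ (Sum.inr i)⟩) =
        (fun _ => 1, Fin.ofNat _ ((l : ℕ) + 1), Fin.ofNat _ (i : ℕ)))

/-- The permutation matrix that sends the basis state `x` to the basis state `π x`. -/
def permGate {ι : Type*} [DecidableEq ι] (π : Equiv.Perm ι) : Matrix ι ι ℂ :=
  Matrix.of fun y x => if y = π x then 1 else 0

/-- The product of the first `m` iteration steps (steps `1, …, m`) on the register. -/
def recursion (n : ℕ) (C : CGFamily) (π : ∀ k, Equiv.Perm (Work n k)) :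
    ℕ → Matrix (Reg n) (Reg n) ℂ
  | 0 => 1
  | m + 1 => lift n (m + 1) (permGate (π (m + 1))) * lift n (m + 1) (superCG n (m + 1) C) *
      recursion n C π m

/-! ### The Schur transform -/

/-- `Q(U) = U ⊗ ⋯ ⊗ U` in the computational basis. -/
def tensorPower (n : ℕ) (U : Matrix.unitaryGroup (Fin 2) ℂ) :
    Matrix (Fin n → Fin 2) (Fin n → Fin 2) ℂ :=
  Matrix.of fun x y => ∏ t, (U : Matrix (Fin 2) (Fin 2) ℂ) (x t) (y t)

/-- `P(s) |y₁ … yₙ⟩ = |y_{s⁻¹(1)} … y_{s⁻¹(n)}⟩` in the computational basis. -/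
def permQubits (n : ℕ) (s : Equiv.Perm (Fin n)) :
    Matrix (Fin n → Fin 2) (Fin n → Fin 2) ℂ :=
  Matrix.of fun x y => if x = fun t => y (s⁻¹ t) then 1 else 0

/-- Labels of a Schur basis: an irrep `λ = (n - l, l)`, a multiplicity label, and a state of
`Q_λ`. -/
abbrev SchurLabel (n : ℕ) (Mult : Fin (n / 2 + 1) → Type) : Type :=
  Σ l : Fin (n / 2 + 1), Mult l × Fin (n - 2 * (l : ℕ) + 1)

/-- `S` is a Schur transform on `n` qubits: a unitary change of basis after which `(ℂ²)^{⊗ n}` is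
literally `⨁_λ P_λ ⊗ Q_λ` as a module of `S_n × U(2)`, with pairwise inequivalent irreps `P_λ` of `S_n`
and pairwise inequivalent irreps `Q_λ` of `U(2)`.  The basis of `Q_λ` consists of weight vectors
(eigenvectors of the spin projection), in order of decreasing projection, which also says that `Q_λ`
has highest weight `λ = (n - l, l)`. -/
structure IsSchurTransform (n : ℕ) (Mult : Fin (n / 2 + 1) → Type)
    [∀ l, Fintype (Mult l)] [∀ l, DecidableEq (Mult l)]
    (S : Matrix (SchurLabel n Mult) (Fin n → Fin 2) ℂ) : Prop where
  mul_conjTranspose : S * Sᴴ = 1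
  conjTranspose_mul : Sᴴ * S = 1
  decomposition :
    ∃ (q : ∀ l : Fin (n / 2 + 1),
          Representation ℂ (Matrix.unitaryGroup (Fin 2) ℂ) (Fin (n - 2 * (l : ℕ) + 1) → ℂ))
      (p : ∀ l : Fin (n / 2 + 1), Representation ℂ (Equiv.Perm (Fin n)) (Mult l → ℂ)),
      (∀ l, (q l).IsIrreducible) ∧
      (∀ l l', l ≠ l' → IsEmpty ((q l).Equiv (q l'))) ∧
      (∀ l, (p l).IsIrreducible) ∧
      (∀ l l', l ≠ l' → IsEmpty ((p l).Equiv (p l'))) ∧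
      (∀ l (U : Matrix.unitaryGroup (Fin 2) ℂ) (z w : ℂ),
        (U : Matrix (Fin 2) (Fin 2) ℂ) = Matrix.diagonal ![z, w] →
          LinearMap.toMatrix' (q l U) =
            Matrix.diagonal fun i : Fin (n - 2 * (l : ℕ) + 1) =>
              z ^ (n - (l : ℕ) - (i : ℕ)) * w ^ ((l : ℕ) + (i : ℕ))) ∧
      (∀ U : Matrix.unitaryGroup (Fin 2) ℂ, S * tensorPower n U =
        Matrix.blockDiagonal' (fun l =>
          (1 : Matrix (Mult l) (Mult l) ℂ) ⊗ₖ LinearMap.toMatrix' (q l U)) * S) ∧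
      (∀ s : Equiv.Perm (Fin n), S * permQubits n s =
        Matrix.blockDiagonal' (fun l => LinearMap.toMatrix' (p l s) ⊗ₖ
          (1 : Matrix (Fin (n - 2 * (l : ℕ) + 1)) (Fin (n - 2 * (l : ℕ) + 1)) ℂ)) * S)

/-- The encoding of a Schur basis in the register: state `i` of the copy of `Q_λ`, `λ = (n - l, l)`, in
column `s` is `|s⟩ ⊗ |l⟩ ⊗ |i⟩`.  Here `M l` is the set of columns that hold a copy of `Q_λ`. -/
def encode (n : ℕ) (M : Fin (n / 2 + 1) → Finset (Seq n)) :
    Matrix (Reg n) (SchurLabel n fun l => {s // s ∈ M l}) ℂ :=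
  Matrix.of fun r e =>
    if r = (e.2.1.1, Fin.ofNat _ (e.1 : ℕ), Fin.ofNat _ (e.2.2 : ℕ)) then 1 else 0

/-- The operator `T` on the register performs the Schur transform on `n` qubits: on computational basis
states (with ancillas `0`) it equals a Schur transform followed by the encoding of the Schur basis in
**seq**, **par** and **stat**. -/
def PerformsSchurTransform (n : ℕ) (hn : 2 ≤ n) (T : Matrix (Reg n) (Reg n) ℂ) : Prop :=
  ∃ (M : Fin (n / 2 + 1) → Finset (Seq n))
    (S : Matrix (SchurLabel n fun l => {s // s ∈ M l}) (Fin n → Fin 2) ℂ),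
    IsSchurTransform n (fun l => {s // s ∈ M l}) S ∧
      T.submatrix id (initial n hn) = encode n M * S

/-- The sum `∑_{μ₂ = 0}^{⌊k/2⌋} (k - 2 μ₂ + 1)` of the dimensions of the inequivalent irreps for `k`
qubits. -/
def irrepDimSum (k : ℕ) : ℕ := ∑ l ∈ Finset.range (k / 2 + 1), (k - 2 * l + 1)

/-- The gate count `6 ∑_{k = 1}^{n - 1} ∑_{μ₂ = 0}^{⌊k/2⌋} (k - 2 μ₂ + 1)`. -/
def gateBound (n : ℕ) : ℕ := 6 * ∑ k ∈ Finset.Icc 1 (n - 1), irrepDimSum k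

end

end QSchur

open QSchur

/-! Everything rests on the conservation of spin projection. An entry of a Clebsch–Gordan matrix
vanishes unless row and column carry the same `M`, and each `M` occurs at most twice on either side.
This bounds the nonzero entries per row (`IsClebschGordan.card_row_le`). It also shows that, after a
permutation of its rows, the direct sum of the transforms is block diagonal with blocks of size at
most two. One two-level factor per block and one transposition per basis state to undo the
permutation give twice the dimension `2 * irrepDimSum k` (`exists_circuit_of_labels`). The
reordering only prescribes where the used states go, so it can be completed to a permutation with
one transposition per used state (`exists_perm_circuit`). The sums are bounded by `4 * irrepDimSum k
≤ (k + 2) ^ 2`.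

For the Schur transform, the amplitudes of the register after each step are described by a recursion
`amp` free of register details (`recursion_initial`). Induction along it shows that the resulting
matrix `S` respects weights and carries the collective lowering operator to its standard form
(`amp_weight`, `amp_lowering`). Unitarity of the steps gives `Sᴴ * S = 1`. Counting the states held
by the columns, `2 ^ n` in all, makes `S` square, hence unitary.

It remains to see that a basis adapted to the ladder operators in this way automatically realises
Schur–Weyl duality (`IsSpinBasis.isSchurTransform`). Permutations commute with the spin operators,
so they act on multiplicity labels only. On strings of weight `w` the commutant of `S_n` is spanned
by `w + 1` orbital matrices, because a pair of strings of weight `w` is determined up to permutation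
by its overlap. For `w ≤ n / 2` the projections onto the `w + 1` copies of `P_λ` in that weight
space are already independent and lie in the commutant, so they span it
(`IsSpinBasis.exists_intertwiner_eq_sum`). This yields both cases of Schur's lemma for the `P_λ`.
Consequently `U^{⊗ n}` acts on the `Q_λ` factors only. Irreducibility of `Q_λ` follows from phase
gates, which separate the weights, and from rotations, whose derivative connects neighbouring
weights. -/

namespace QSchur

/-! ### Circuits and two-level unitaries -/

set_option linter.unusedSectionVars false

section Circuits

variable {ι : Type*} [Fintype ι] [DecidableEq ι]

theorem circuit_nil : circuit ([] : List (Matrix ι ι ℂ)) = 1 := by simp [circuit]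

theorem circuit_append (L L' : List (Matrix ι ι ℂ)) :
    circuit (L ++ L') = circuit L' * circuit L := by simp [circuit]

theorem circuit_singleton (V : Matrix ι ι ℂ) : circuit [V] = V := by simp [circuit]

theorem circuit_map {κ : Type*} [Fintype κ] [DecidableEq κ] (f : Matrix ι ι ℂ → Matrix κ κ ℂ)
    (h1 : f 1 = 1) (hmul : ∀ A B, f (A * B) = f A * f B) (L : List (Matrix ι ι ℂ)) :
    circuit (L.map f) = f (circuit L) := by
  induction L with
  | nil => simp [circuit_nil, h1]
  | cons V L ih =>
    rw [List.map_cons, ← List.singleton_append, circuit_append, ih, ← List.singleton_append (l := L),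
      circuit_append, hmul, circuit_singleton, circuit_singleton]

theorem permGate_one : permGate (1 : Equiv.Perm ι) = 1 := by
  ext x y
  simp only [permGate, Matrix.of_apply, Matrix.one_apply, Equiv.Perm.one_apply]
  congr

theorem permGate_mul (π ρ : Equiv.Perm ι) : permGate π * permGate ρ = permGate (π * ρ) := by
  ext x y
  simp only [permGate, Matrix.of_apply, Matrix.mul_apply, Equiv.Perm.mul_apply]
  rw [Finset.sum_eq_single (ρ y)] <;> simp +contextual
  congr

theorem permGate_conjTranspose (π : Equiv.Perm ι) : (permGate π)ᴴ = permGate π⁻¹ := by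
  ext x y
  simp only [permGate, Matrix.conjTranspose_apply, Matrix.of_apply, apply_ite (star : ℂ → ℂ),
    star_one, star_zero]
  refine if_congr ?_ rfl rfl
  rw [Equiv.Perm.eq_inv_iff_eq, eq_comm]

theorem permGate_mul_conjTranspose (π : Equiv.Perm ι) : permGate π * (permGate π)ᴴ = 1 := by
  rw [permGate_conjTranspose, permGate_mul, mul_inv_cancel, permGate_one]

theorem isTwoLevel_one [Nontrivial ι] : IsTwoLevel (1 : Matrix ι ι ℂ) := by
  obtain ⟨i, j, h⟩ := exists_pair_ne ι
  exact ⟨by simp, i, j, h, fun _ _ _ => rfl⟩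

theorem isTwoLevel_swap [Nontrivial ι] (i j : ι) : IsTwoLevel (permGate (Equiv.swap i j)) := by
  rcases eq_or_ne i j with rfl | h
  · rw [Equiv.swap_self, ← Equiv.Perm.one_def, permGate_one]
    exact isTwoLevel_one
  refine ⟨permGate_mul_conjTranspose _, i, j, h, fun x y hxy => ?_⟩
  simp only [permGate, Matrix.of_apply, Matrix.one_apply]
  congr 1
  by_cases hy : y = i ∨ y = j
  · have hx : x ≠ i ∧ x ≠ j := by tauto
    rcases hy with rfl | rfl
    · simp [hx]
    · simp [hx]
  · push Not at hy
    rw [Equiv.swap_apply_of_ne_of_ne hy.1 hy.2]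

/-- A partial injection on `m` points extends to a permutation that is a product of at most `m`
transpositions. -/
theorem exists_perm_circuit [Nontrivial ι] {α : Type*} [DecidableEq α] (a b : α → ι)
    (s : Finset α) (ha : Set.InjOn a s) (hb : Set.InjOn b s) :
    ∃ (π : Equiv.Perm ι) (L : List (Matrix ι ι ℂ)), (∀ V ∈ L, IsTwoLevel V) ∧
      circuit L = permGate π ∧ L.length ≤ s.card ∧ ∀ e ∈ s, π (a e) = b e := by
  induction s using Finset.induction_on with
  | empty => exact ⟨1, [], by simp, by rw [circuit_nil, permGate_one], by simp, by simp⟩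
  | insert c s hc ih =>
    obtain ⟨π, L, hL, hcirc, hlen, hπ⟩ := ih (ha.mono (by simp)) (hb.mono (by simp))
    -- One further transposition corrects the image of `c`. Injectivity of `a` and `b` keeps the two
    -- swapped points away from the images already in place.
    refine ⟨Equiv.swap (π (a c)) (b c) * π, L ++ [permGate (Equiv.swap (π (a c)) (b c))],
      ?_, ?_, ?_, ?_⟩
    · intro V hV
      rcases List.mem_append.1 hV with h | h
      · exact hL V h
      · rw [List.mem_singleton.1 h]
        exact isTwoLevel_swap _ _
    · rw [circuit_append, circuit_singleton, hcirc, permGate_mul]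
    · rw [Finset.card_insert_of_notMem hc]
      simpa using hlen
    · intro e he
      rcases Finset.mem_insert.1 he with rfl | he'
      · simp
      · have hec : e ≠ c := fun h => hc (h ▸ he')
        have h1 : π (a e) ≠ π (a c) := fun h =>
          hec (ha (by simp [he']) (by simp) (π.injective h))
        have h2 : b e ≠ b c := fun h => hec (hb (by simp [he']) (by simp) h)
        rw [Equiv.Perm.mul_apply, Equiv.swap_apply_of_ne_of_ne h1 (by rw [hπ e he']; exact h2),
          hπ e he']

/-- The part of a block-diagonal matrix belonging to the labels in `s`, the identity elsewhere. -/
noncomputable def blockPart {κ : Type*} [DecidableEq κ] (f : ι → κ) (W : Matrix ι ι ℂ)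
    (s : Finset κ) : Matrix ι ι ℂ :=
  Matrix.of fun x y => if f x ∈ s then W x y else (1 : Matrix ι ι ℂ) x y

variable {κ : Type*} [DecidableEq κ] {f : ι → κ} {W : Matrix ι ι ℂ}

theorem blockPart_empty : blockPart f W ∅ = 1 := by
  ext x y
  simp [blockPart]

theorem blockPart_of_subset {s : Finset κ} (hs : ∀ x, f x ∈ s) : blockPart f W s = W := by
  ext x y
  simp [blockPart, hs]

/-- A nonzero `W x z` forces `f z = f x`, so the rows of the second factor that matter are all
treated like row `x`. With `V = Wᴴ` this gives unitarity; with `V = W` it adds one label to a set.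
-/
theorem blockPart_mul (hW : ∀ x y, W x y ≠ 0 → f x = f y) (V : Matrix ι ι ℂ)
    {s t : Finset κ} :
    blockPart f W s * blockPart f V t = Matrix.of fun x y =>
      if f x ∈ s then (if f x ∈ t then (W * V) x y else W x y)
      else if f x ∈ t then V x y else (1 : Matrix ι ι ℂ) x y := by
  ext x y
  rw [Matrix.mul_apply]
  by_cases hs : f x ∈ s
  · by_cases ht : f x ∈ t
    · simp only [blockPart, Matrix.of_apply, hs, ht, if_true, Matrix.mul_apply]
      refine Finset.sum_congr rfl fun z _ => ?_
      by_cases h : W x z = 0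
      · simp [h]
      · rw [← hW x z h, if_pos ht]
    · simp only [blockPart, Matrix.of_apply, hs, ht, if_true, if_false]
      rw [Finset.sum_eq_single y]
      · by_cases h : W x y = 0
        · simp [h]
        · rw [← hW x y h, if_neg ht]
          simp
      · intro z _ hz
        by_cases h : W x z = 0
        · simp [h]
        · rw [← hW x z h, if_neg ht]
          simp [hz]
      · simp
  · simp only [blockPart, Matrix.of_apply, hs, if_false]
    rw [Finset.sum_eq_single x]
    · simp
    · intro z _ hz
      simp [hz.symm]
    · simp

theorem blockPart_unitary (hW : ∀ x y, W x y ≠ 0 → f x = f y) (hu : W * Wᴴ = 1) (s : Finset κ) :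
    blockPart f W s * (blockPart f W s)ᴴ = 1 := by
  have : (blockPart f W s)ᴴ = blockPart f Wᴴ s := by
    ext x y
    simp only [blockPart, Matrix.conjTranspose_apply, Matrix.of_apply]
    by_cases hf : f x = f y
    · rw [hf]
      split_ifs
      · rfl
      · rw [Matrix.one_apply, Matrix.one_apply]
        simp [eq_comm]
    · have h1 : W y x = 0 := by
        by_contra h
        exact hf (hW y x h).symm
      have h2 : x ≠ y := fun h => hf (h ▸ rfl)
      simp [h1, h2, h2.symm]
  rw [this, blockPart_mul hW]
  ext x y
  by_cases h : f x ∈ s <;> simp [h, hu]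

/-- A block-diagonal unitary with blocks of size at most two is a product of as many two-level
unitaries as there are blocks. -/
theorem exists_circuit_of_blocks [Nontrivial ι] (hW : ∀ x y, W x y ≠ 0 → f x = f y)
    (hu : W * Wᴴ = 1) (hf : ∀ c, (Finset.univ.filter fun x => f x = c).card ≤ 2) :
    ∃ L : List (Matrix ι ι ℂ), (∀ V ∈ L, IsTwoLevel V) ∧ circuit L = W ∧
      L.length ≤ Fintype.card ι := by
  -- Labels are switched on one at a time. Each costs one factor, which differs from the identity
  -- only on the at most two states with that label.
  have key : ∀ s : Finset κ, ∃ L : List (Matrix ι ι ℂ), (∀ V ∈ L, IsTwoLevel V) ∧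
      circuit L = blockPart f W s ∧ L.length ≤ s.card := by
    intro s
    induction s using Finset.induction_on with
    | empty => exact ⟨[], by simp, by rw [circuit_nil, blockPart_empty], by simp⟩
    | insert c s hc ih =>
      obtain ⟨L, hL, hcirc, hlen⟩ := ih
      refine ⟨L ++ [blockPart f W {c}], ?_, ?_, ?_⟩
      · intro V hV
        rcases List.mem_append.1 hV with h | h
        · exact hL V h
        rw [List.mem_singleton.1 h]
        refine ⟨blockPart_unitary hW hu _, ?_⟩
        -- A block of size one is padded to two states; this is where at least two basis states are
        -- needed.
        obtain ⟨i, j, hij, hsub⟩ : ∃ i j : ι, i ≠ j ∧ ∀ x, f x = c → x = i ∨ x = j := by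
          obtain ⟨t, ht, htc⟩ := Finset.exists_superset_card_eq (hf c)
            (Nat.succ_le_of_lt Fintype.one_lt_card)
          obtain ⟨i, j, hij, rfl⟩ := Finset.card_eq_two.1 htc
          refine ⟨i, j, hij, fun x hx => ?_⟩
          have := ht (Finset.mem_filter.2 ⟨Finset.mem_univ x, hx⟩)
          simpa using this
        refine ⟨i, j, hij, fun x y hxy => ?_⟩
        simp only [blockPart, Matrix.of_apply, Finset.mem_singleton]
        split_ifs with hx
        · have hy : ¬ (y = i ∨ y = j) := fun h => hxy ⟨hsub x hx, h⟩
          have hfy : f y ≠ c := fun h => hy (hsub y h)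
          have h0 : W x y = 0 := by
            by_contra h
            exact hfy ((hW x y h).symm.trans hx)
          rw [h0, Matrix.one_apply_ne]
          rintro rfl
          exact hfy hx
        · rfl
      · rw [circuit_append, circuit_singleton, hcirc, blockPart_mul hW]
        ext x y
        simp only [blockPart, Matrix.of_apply, Finset.mem_insert, Finset.mem_singleton]
        by_cases h1 : f x = c
        · simp [h1, hc]
        · simp [h1]
      · rw [Finset.card_insert_of_notMem hc]
        simpa using hlen
  obtain ⟨L, hL, hcirc, hlen⟩ := key (Finset.univ.image f)
  refine ⟨L, hL, ?_, hlen.trans Finset.card_image_le⟩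
  rw [hcirc, blockPart_of_subset fun x => by simp]

/-- A unitary whose rows and columns carry labels respected by its nonzero entries, each label
occurring at most twice, is a product of at most `2 |ι|` two-level unitaries. -/
theorem exists_circuit_of_labels [Nontrivial ι] {g : ι → κ} (σ : Equiv.Perm ι)
    (hσ : ∀ x, f (σ x) = g x) (hW : ∀ x y, W x y ≠ 0 → g x = f y)
    (hu : W * Wᴴ = 1) (hf : ∀ c, (Finset.univ.filter fun x => f x = c).card ≤ 2) :
    ∃ L : List (Matrix ι ι ℂ), (∀ V ∈ L, IsTwoLevel V) ∧ circuit L = W ∧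
      L.length ≤ 2 * Fintype.card ι := by
  -- Permuting the rows by `σ` aligns row labels with column labels, so the product becomes block
  -- diagonal. The circuit for `σ⁻¹` then follows; each of the two stages costs at most `|ι|` gates.
  obtain ⟨L₁, h₁, hc₁, hl₁⟩ := exists_circuit_of_blocks (f := f) (W := permGate σ * W)
    (by
      intro x y h
      have : (permGate σ * W) x y = W (σ⁻¹ x) y := by
        simp only [Matrix.mul_apply, permGate, Matrix.of_apply]
        rw [Finset.sum_eq_single (σ⁻¹ x)] <;> simp +contextual
        · intro b hb hx
          exact absurd (by rw [hx]; simp) hb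
      rw [this] at h
      rw [← hW _ _ h, ← hσ]
      simp)
    (by
      rw [Matrix.conjTranspose_mul, Matrix.mul_assoc, ← Matrix.mul_assoc W, hu, Matrix.one_mul,
        permGate_mul_conjTranspose]) hf
  obtain ⟨π, L₂, h₂, hc₂, hl₂, hπ⟩ := exists_perm_circuit (ι := ι) id (σ⁻¹ : Equiv.Perm ι)
    Finset.univ (Set.injOn_id _) (Equiv.injective _).injOn
  have hπ' : π = σ⁻¹ := Equiv.ext fun x => hπ x (Finset.mem_univ x)
  refine ⟨L₁ ++ L₂, ?_, ?_, ?_⟩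
  · intro V hV
    rcases List.mem_append.1 hV with h | h
    exacts [h₁ V h, h₂ V h]
  · rw [circuit_append, hc₁, hc₂, hπ', ← Matrix.mul_assoc, permGate_mul, inv_mul_cancel,
      permGate_one, Matrix.one_mul]
  · rw [List.length_append]
    rw [Finset.card_univ] at hl₂
    omega

end Circuits

/-! ### Clebsch–Gordan transforms -/

/-- The entry of the lowering operator of the irrep of dimension `d` in column `c`. -/
noncomputable def lowerCoeff (d c : ℕ) : ℂ :=
  ((Real.sqrt (((c : ℕ) + 1 : ℝ) * ((d : ℝ) - 1 - (c : ℕ))) : ℝ) : ℂ)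

theorem spinLower_apply (d : ℕ) (r c : Fin d) :
    spinLower d r c = if (r : ℕ) = (c : ℕ) + 1 then lowerCoeff d c else 0 := rfl

theorem compZ_eq (a : ℕ) :
    compZ a = Matrix.diagonal fun p => ((a : ℂ) + 1) / 2 - ((p.1 : ℕ) + (p.2 : ℕ) : ℕ) := by
  unfold compZ spinZ
  rw [← Matrix.diagonal_one, ← Matrix.diagonal_one, Matrix.diagonal_kronecker_diagonal,
    Matrix.diagonal_kronecker_diagonal, Matrix.diagonal_add]
  congr 1
  ext p
  push_cast
  ring

/-- The number `(a + 1) / 2 - M` for an output state of a Clebsch–Gordan transform. -/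
def outLabel {a : ℕ} : Fin (a + 2) ⊕ Fin a → ℕ
  | Sum.inl i => i
  | Sum.inr i => i + 1

/-- In the `J^z` relation both sides have the entry `C r c` times an eigenvalue, so a nonzero entry
equates the eigenvalues. This selection rule is the source of all sparsity used below. -/
theorem IsClebschGordan.label_eq {a : ℕ} {C : Matrix (Fin (a + 2) ⊕ Fin a) (Fin (a + 1) × Fin 2) ℂ}
    (h : IsClebschGordan a C) {r : Fin (a + 2) ⊕ Fin a} {c : Fin (a + 1) × Fin 2}
    (hrc : C r c ≠ 0) : outLabel r = (c.1 : ℕ) + (c.2 : ℕ) := by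
  have h1 := congr_fun (congr_fun h.projection r) c
  rw [compZ_eq, spinZ, spinZ, Matrix.fromBlocks_diagonal, Matrix.mul_diagonal,
    Matrix.diagonal_mul, mul_comm] at h1
  have h2 := mul_right_cancel₀ hrc h1
  rcases r with i | i
  · simp only [outLabel]
    simp only [Sum.elim_inl] at h2
    have : ((i : ℕ) : ℂ) = (((c.1 : ℕ) + (c.2 : ℕ) : ℕ) : ℂ) := by
      push_cast at h2 ⊢
      linear_combination h2
    exact_mod_cast this
  · simp only [outLabel]
    simp only [Sum.elim_inr] at h2
    have : (((i : ℕ) + 1 : ℕ) : ℂ) = (((c.1 : ℕ) + (c.2 : ℕ) : ℕ) : ℂ) := by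
      push_cast at h2 ⊢
      linear_combination h2
    exact_mod_cast this

theorem card_filter_label_le (a t : ℕ) :
    (Finset.univ.filter fun c : Fin (a + 1) × Fin 2 => (c.1 : ℕ) + (c.2 : ℕ) = t).card ≤ 2 := by
  have : Set.InjOn Prod.snd
      (Finset.univ.filter fun c : Fin (a + 1) × Fin 2 => (c.1 : ℕ) + (c.2 : ℕ) = t :
        Set (Fin (a + 1) × Fin 2)) := by
    rintro ⟨x, y⟩ hx ⟨x', y'⟩ hx' (rfl : y = y')
    simp only [Finset.coe_filter, Finset.mem_univ, true_and, Set.mem_ofPred_eq] at hx hx'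
    ext
    · simp only
      omega
    · rfl
  simpa using Finset.card_le_card_of_injOn (t := Finset.univ) Prod.snd (by simp) this

theorem IsClebschGordan.card_row_le {a : ℕ}
    {C : Matrix (Fin (a + 2) ⊕ Fin a) (Fin (a + 1) × Fin 2) ℂ} (h : IsClebschGordan a C)
    (r : Fin (a + 2) ⊕ Fin a) : (Finset.univ.filter fun c => C r c ≠ 0).card ≤ 2 := by
  refine le_trans (Finset.card_le_card fun c hc => ?_) (card_filter_label_le a (outLabel r))
  simp only [Finset.mem_filter, Finset.mem_univ, true_and] at hc ⊢
  exact (h.label_eq hc).symm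

/-- The product of a matrix with the composite lowering operator. -/
theorem mul_compLower_apply {a : ℕ} {ρ : Type*} (M : Matrix ρ (Fin (a + 1) × Fin 2) ℂ) (r : ρ)
    (c : Fin (a + 1) × Fin 2) :
    (M * compLower a) r c =
      (if h : (c.1 : ℕ) + 1 < a + 1 then M r (⟨c.1 + 1, h⟩, c.2) * lowerCoeff (a + 1) c.1 else 0) +
      if c.2 = 0 then M r (c.1, 1) else 0 := by
  obtain ⟨i, b⟩ := c
  simp only [compLower, Matrix.mul_add, Matrix.add_apply]
  congr 1
  · simp only [Matrix.mul_apply, Matrix.kroneckerMap_apply, Fintype.sum_prod_type,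
      spinLower_apply, Matrix.one_apply]
    simp only [mul_ite, mul_one, mul_zero, Finset.sum_ite_eq', Finset.mem_univ, if_true]
    split_ifs with h
    · rw [Finset.sum_eq_single ⟨i + 1, h⟩]
      · simp
      · intro j _ hj
        rw [if_neg]
        intro h'
        exact hj (Fin.ext h')
      · simp
    · refine Finset.sum_eq_zero fun j _ => ?_
      rw [if_neg]
      have := j.2
      omega
  · simp only [Matrix.mul_apply, Matrix.kroneckerMap_apply, Fintype.sum_prod_type,
      spinLower_apply, Matrix.one_apply]
    rw [Finset.sum_eq_single i]
    · fin_cases b <;> norm_num [lowerCoeff]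
    · intro j _ hj
      simp [hj]
    · simp

theorem spinLower_mul_apply {d : ℕ} {ρ : Type*} (M : Matrix (Fin d) ρ ℂ) (i : Fin d) (c : ρ) :
    (spinLower d * M) i c =
      if h : 1 ≤ (i : ℕ) then lowerCoeff d (i - 1) * M ⟨i - 1, by omega⟩ c else 0 := by
  simp only [Matrix.mul_apply, spinLower_apply]
  split_ifs with h
  · rw [Finset.sum_eq_single ⟨i - 1, by omega⟩]
    · rw [if_pos (by change (i : ℕ) = i - 1 + 1; omega)]
    · intro j _ hj
      rw [if_neg, zero_mul]
      intro h'
      exact hj (Fin.ext (by simp only; omega))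
    · simp
  · refine Finset.sum_eq_zero fun j _ => ?_
    rw [if_neg (by omega), zero_mul]

/-- With `m = j - i` this is `i (d - i) + m² + m = j (j + 1)`, where the first term is the square of
the lowering coefficient into state `i`. -/
theorem spin_sq (d : ℕ) :
    spinLower d * (spinLower d)ᴴ + spinZ d * spinZ d + spinZ d =
      spinSqValue d • (1 : Matrix (Fin d) (Fin d) ℂ) := by
  ext i j
  rw [Matrix.add_apply, Matrix.add_apply, spinLower_mul_apply, spinZ, Matrix.diagonal_mul_diagonal,
    Matrix.smul_apply, Matrix.one_apply, Matrix.diagonal_apply, Matrix.diagonal_apply]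
  simp only [Matrix.conjTranspose_apply, spinLower_apply]
  by_cases hij : i = j
  · subst hij
    have hd : (i : ℝ) + 1 ≤ d := by exact_mod_cast i.2
    have key : (if h : 1 ≤ (i : ℕ) then lowerCoeff d (i - 1) *
        star (if (i : ℕ) = (i - 1 : ℕ) + 1 then lowerCoeff d (i - 1) else 0) else 0) =
        (((i : ℝ) * (d - i) : ℝ) : ℂ) := by
      split_ifs with h h'
      · obtain ⟨m, hm⟩ : ∃ m, (i : ℕ) = m + 1 := ⟨i - 1, by omega⟩
        rw [lowerCoeff, Complex.star_def, Complex.conj_ofReal, ← Complex.ofReal_mul,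
          Real.mul_self_sqrt]
        · rw [hm, Nat.add_sub_cancel]
          push_cast
          ring
        · rw [hm] at hd ⊢
          push_cast at hd
          simp only [Nat.add_sub_cancel]
          exact mul_nonneg (by positivity) (by linarith)
      · omega
      · have : (i : ℕ) = 0 := by omega
        simp [this]
    simp only [if_true, spinSqValue, smul_eq_mul, mul_one]
    rw [key]
    push_cast
    ring
  · have hne : (j : ℕ) ≠ i := fun h => hij (Fin.ext h.symm)
    simp only [hij, if_false, smul_zero, add_zero]
    split_ifs with h h'
    · omega
    · simp
    · rfl

/-- The `J²` relation is not independent: unitarity turns the lowering relation into one for the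
adjoint, and `J²` is a polynomial in `J^-`, its adjoint and `J^z` that is scalar on each multiplet
by `spin_sq`. -/
theorem isClebschGordan_of_lowering {a : ℕ}
    {C : Matrix (Fin (a + 2) ⊕ Fin a) (Fin (a + 1) × Fin 2) ℂ}
    (h1 : C * Cᴴ = 1) (h2 : Cᴴ * C = 1)
    (hz : C * compZ a = Matrix.fromBlocks (spinZ (a + 2)) 0 0 (spinZ a) * C)
    (hl : C * compLower a = Matrix.fromBlocks (spinLower (a + 2)) 0 0 (spinLower a) * C) :
    IsClebschGordan a C := by
  refine ⟨h1, h2, ?_, hz, hl⟩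
  have h3 : compLower a * Cᴴ = Cᴴ * Matrix.fromBlocks (spinLower (a + 2)) 0 0 (spinLower a) := by
    calc compLower a * Cᴴ = Cᴴ * (C * compLower a) * Cᴴ := by
          rw [← Matrix.mul_assoc Cᴴ, h2, Matrix.one_mul]
      _ = _ := by rw [hl, Matrix.mul_assoc, Matrix.mul_assoc, h1, Matrix.mul_one]
  have h4 := congr_arg Matrix.conjTranspose h3
  rw [Matrix.conjTranspose_mul, Matrix.conjTranspose_mul, Matrix.conjTranspose_conjTranspose,
    Matrix.fromBlocks_conjTranspose] at h4
  simp only [Matrix.conjTranspose_zero] at h4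
  rw [compSq, Matrix.mul_add, Matrix.mul_add, ← Matrix.mul_assoc, ← Matrix.mul_assoc, hl, hz,
    Matrix.mul_assoc, h4, Matrix.mul_assoc _ C, hz, ← Matrix.mul_assoc, ← Matrix.mul_assoc,
    ← Matrix.add_mul, ← Matrix.add_mul, ← spin_sq, ← spin_sq]
  simp [Matrix.fromBlocks_multiply, Matrix.fromBlocks_add]

/-! ### Existence of Clebsch–Gordan transforms -/

/-- A Clebsch–Gordan transform with real entries. -/
noncomputable def stdCG (a : ℕ) : Matrix (Fin (a + 2) ⊕ Fin a) (Fin (a + 1) × Fin 2) ℂ :=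
  Matrix.of fun r c =>
    if outLabel r = (c.1 : ℕ) + (c.2 : ℕ) then
      match r with
      | Sum.inl i => if c.2 = 0 then ((√((a : ℝ) + 1 - i) / √((a : ℝ) + 1) : ℝ) : ℂ)
          else ((√(i : ℝ) / √((a : ℝ) + 1) : ℝ) : ℂ)
      | Sum.inr i => if c.2 = 0 then ((-√((i : ℝ) + 1) / √((a : ℝ) + 1) : ℝ) : ℂ)
          else ((√((a : ℝ) - i) / √((a : ℝ) + 1) : ℝ) : ℂ)
    else 0

theorem stdCG_projection (a : ℕ) :
    stdCG a * compZ a = Matrix.fromBlocks (spinZ (a + 2)) 0 0 (spinZ a) * stdCG a := by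
  ext r c
  rw [compZ_eq, spinZ, spinZ, Matrix.fromBlocks_diagonal, Matrix.mul_diagonal,
    Matrix.diagonal_mul, mul_comm]
  by_cases h : outLabel r = (c.1 : ℕ) + (c.2 : ℕ)
  · congr 1
    rw [← h]
    rcases r with i | i <;> simp only [outLabel, Sum.elim_inl, Sum.elim_inr] <;> push_cast <;> ring
  · simp [stdCG, h]

/-- Entrywise, both sides vanish unless the row label is one more than the column label. What is
left reduces, after common square roots are taken out, to `(a - i') + 1 = a + 1 - i'` in the upper
multiplet and `(i + 1) - 1 = i` in the lower one; for qubit state `1` only one term occurs on each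
side. -/
theorem stdCG_lowering (a : ℕ) :
    stdCG a * compLower a = Matrix.fromBlocks (spinLower (a + 2)) 0 0 (spinLower a) * stdCG a := by
  have hD : √((a : ℝ) + 1) ≠ 0 := by positivity
  ext r ⟨i', b⟩
  have hi' : (i' : ℝ) ≤ a := by exact_mod_cast Nat.lt_succ_iff.1 i'.2
  rw [mul_compLower_apply]
  rcases r with i | i
  · have hR : (Matrix.fromBlocks (spinLower (a + 2)) 0 0 (spinLower a) * stdCG a) (Sum.inl i) (i', b)
        = (spinLower (a + 2) * (stdCG a).submatrix Sum.inl id) i (i', b) := by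
      simp [Matrix.mul_apply]
    rw [hR, spinLower_mul_apply]
    fin_cases b
    · simp only [stdCG, outLabel, Matrix.of_apply, Matrix.submatrix_apply, id]
      simp only [Fin.zero_eta, Fin.isValue, add_zero, if_true, Fin.val_one,
        one_ne_zero, if_false]
      by_cases hi : (i : ℕ) = i' + 1
      · have hlt : (i' : ℕ) + 1 < a + 2 := hi ▸ i.2
        have hi1 : (i : ℝ) = i' + 1 := by exact_mod_cast hi
        simp only [hi, if_true, lowerCoeff]
        simp only [le_add_iff_nonneg_left, zero_le, dite_true, Nat.add_sub_cancel, if_true]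
        -- In the last column, `i' = a`, there is no lower state of the first spin; the closed form
        -- still holds because `√(a - i') = 0`.
        have e1 : (if (i' : ℕ) + 1 < a + 1 then
            (((√((a : ℝ) + 1 - ((i' + 1 : ℕ) : ℝ)) / √((a : ℝ) + 1) : ℝ) : ℂ) *
              ((√(((i' : ℕ) + 1 : ℝ) * (((a + 1 : ℕ) : ℝ) - 1 - (i' : ℕ))) : ℝ) : ℂ)) else 0) =
            (((√((a : ℝ) - i') / √((a : ℝ) + 1) * (√((i' : ℝ) + 1) * √((a : ℝ) - i'))) : ℝ) : ℂ) := by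
          split_ifs with h
          · rw [← Complex.ofReal_mul, ← Real.sqrt_mul (by positivity)]
            congr 3
            · congr 1
              push_cast
              ring
            · congr 1
              push_cast
              ring
          · have : (a : ℝ) = i' := by
              have : a = i' := by omega
              exact_mod_cast this
            simp [this]
        simp only [dite_eq_ite]
        rw [e1]
        norm_cast
        have e2 : √(((i' : ℕ) + 1 : ℝ) * (((a + 2 : ℕ) : ℝ) - 1 - (i' : ℕ))) =
            √((i' : ℝ) + 1) * √((a : ℝ) + 1 - i') := by
          rw [← Real.sqrt_mul (by positivity)]
          congr 2
          push_cast
          ring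
        have e3 : √((a : ℝ) - i') * √((a : ℝ) - i') = a - i' := Real.mul_self_sqrt (by linarith)
        have e4 : √((a : ℝ) + 1 - i') * √((a : ℝ) + 1 - i') = a + 1 - i' :=
          Real.mul_self_sqrt (by linarith)
        push_cast at e2 ⊢
        rw [e2]
        field_simp
        linear_combination e3 - e4
      · have h2 : 1 ≤ (i : ℕ) → (i : ℕ) - 1 ≠ i' := by omega
        simp +contextual [hi, h2]
    · simp only [stdCG, outLabel, Matrix.of_apply, Matrix.submatrix_apply, id]
      simp only [Fin.mk_one, Fin.isValue, Fin.val_one, one_ne_zero, if_false, add_zero]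
      by_cases hi : (i : ℕ) = i' + 1 + 1
      · have hlt : (i' : ℕ) + 1 < a + 1 := by have := i.2; omega
        have hlt' : (i' : ℝ) + 1 ≤ a := by exact_mod_cast Nat.lt_succ_iff.1 hlt
        simp only [hi, if_true, lowerCoeff, hlt]
        simp only [le_add_iff_nonneg_left, zero_le, dite_true, Nat.add_sub_cancel, if_true]
        norm_cast
        push_cast
        rw [Real.sqrt_mul (by positivity), Real.sqrt_mul (by positivity)]
        have e1 : (a : ℝ) + 1 - 1 - i' = a - i' := by ring
        have e2 : (a : ℝ) + 2 - 1 - (i' + 1) = a - i' := by ring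
        rw [e1, e2]
        ring
      · have h2 : 1 ≤ (i : ℕ) → (i : ℕ) - 1 ≠ i' + 1 := by omega
        simp +contextual [hi, h2]
  · have hR : (Matrix.fromBlocks (spinLower (a + 2)) 0 0 (spinLower a) * stdCG a) (Sum.inr i) (i', b)
        = (spinLower a * (stdCG a).submatrix Sum.inr id) i (i', b) := by
      simp [Matrix.mul_apply]
    rw [hR, spinLower_mul_apply]
    have hia : (i : ℝ) + 1 ≤ a := by exact_mod_cast i.2
    fin_cases b
    · simp only [stdCG, outLabel, Matrix.of_apply, Matrix.submatrix_apply, id]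
      simp only [Fin.zero_eta, Fin.isValue, add_zero, if_true, Fin.val_one,
        one_ne_zero, if_false]
      by_cases hi : (i' : ℕ) = i
      · have hlt : (i' : ℕ) + 1 < a + 1 := by have := i.2; omega
        simp only [hi, if_true, lowerCoeff]
        -- For `i = 0` there is no state above to lower from, and the closed form vanishes through
        -- `√i`.
        have e1 : (if h : 1 ≤ (i : ℕ) then
            ((√(((i - 1 : ℕ) + 1 : ℝ) * ((a : ℝ) - 1 - (i - 1 : ℕ))) : ℝ) : ℂ) *
            (if (i : ℕ) - 1 + 1 = i then
              ((-√(((i - 1 : ℕ) : ℝ) + 1) / √((a : ℝ) + 1) : ℝ) : ℂ) else 0) else 0) =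
            ((-(√(i : ℝ) * √((a : ℝ) - i) * (√(i : ℝ) / √((a : ℝ) + 1))) : ℝ) : ℂ) := by
          split_ifs with h h'
          · have e : (((i : ℕ) - 1 : ℕ) : ℝ) = i - 1 := by push_cast [h]; ring
            rw [e, ← Complex.ofReal_mul, ← Real.sqrt_mul (by positivity)]
            congr 1
            rw [sub_add_cancel]
            ring_nf
          · omega
          · have : (i : ℕ) = 0 := by omega
            simp [this]
        rw [e1]
        simp only [show (i : ℕ) + 1 < a + 1 by omega, dite_true]
        norm_cast
        push_cast
        rw [Real.sqrt_mul (by positivity)]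
        have e2 : √((i : ℝ) + 1) * √((i : ℝ) + 1) = i + 1 := Real.mul_self_sqrt (by positivity)
        have e3 : √(i : ℝ) * √(i : ℝ) = i := Real.mul_self_sqrt (by positivity)
        have e4 : (a : ℝ) + 1 - 1 - i = a - i := by ring
        rw [e4]
        field_simp
        linear_combination -√((a : ℝ) - i) * e2 + √((a : ℝ) - i) * e3
      · have h2 : 1 ≤ (i : ℕ) → (i : ℕ) - 1 + 1 ≠ i' := by omega
        have h3 : (i : ℕ) ≠ i' := fun h => hi h.symm
        simp +contextual [h3]
    · simp only [stdCG, outLabel, Matrix.of_apply, Matrix.submatrix_apply, id]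
      simp only [Fin.mk_one, Fin.isValue, Fin.val_one, one_ne_zero, if_false, add_zero]
      by_cases hi : (i : ℕ) = i' + 1
      · have hlt : (i' : ℕ) + 1 < a + 1 := by have := i.2; omega
        have hi1 : (i : ℝ) = i' + 1 := by exact_mod_cast hi
        simp only [hi, if_true, lowerCoeff, hlt]
        simp only [le_add_iff_nonneg_left, zero_le, dite_true, Nat.add_sub_cancel, if_true]
        norm_cast
        push_cast
        rw [Real.sqrt_mul (by positivity), Real.sqrt_mul (by positivity)]
        have e1 : (a : ℝ) + 1 - 1 - i' = a - i' := by ring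
        have e2 : (a : ℝ) - 1 - i' = a - (i' + 1) := by ring
        rw [e1, e2]
        ring
      · have h2 : 1 ≤ (i : ℕ) → (i : ℕ) - 1 ≠ i' := by omega
        simp +contextual [hi]

/-- Rows with different labels have disjoint supports. Rows with label `t` live on the columns `(t,
0)` and `(t - 1, 1)`, as far as these exist, and there form a plane rotation. -/
theorem stdCG_mul_conjTranspose (a : ℕ) : stdCG a * (stdCG a)ᴴ = 1 := by
  have hD : √((a : ℝ) + 1) ≠ 0 := by positivity
  have hD2 : √((a : ℝ) + 1) * √((a : ℝ) + 1) = a + 1 := Real.mul_self_sqrt (by positivity)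
  ext r r'
  have hsum : (stdCG a * (stdCG a)ᴴ) r r' =
      ∑ i : Fin (a + 1), (stdCG a r (i, 0) * star (stdCG a r' (i, 0)) +
        stdCG a r (i, 1) * star (stdCG a r' (i, 1))) := by
    simp only [Matrix.mul_apply, Fintype.sum_prod_type, Matrix.conjTranspose_apply, Fin.sum_univ_two]
  rw [hsum]
  by_cases hl : outLabel r = outLabel r'
  swap
  · rw [Matrix.one_apply_ne (fun h => hl (congr_arg outLabel h))]
    refine Finset.sum_eq_zero fun i _ => ?_
    have (b : Fin 2) : stdCG a r (i, b) * star (stdCG a r' (i, b)) = 0 := by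
      by_cases h : outLabel r = (i : ℕ) + (b : ℕ)
      · have h' : outLabel r' ≠ (i : ℕ) + (b : ℕ) := fun h' => hl (h.trans h'.symm)
        simp [stdCG, h']
      · simp [stdCG, h]
    rw [this, this, add_zero]
  set t := outLabel r with ht
  -- The two terms of the row, with their boundary cases.
  have h0 : ∑ i : Fin (a + 1), stdCG a r (i, 0) * star (stdCG a r' (i, 0)) =
      if h : t < a + 1 then stdCG a r (⟨t, h⟩, 0) * star (stdCG a r' (⟨t, h⟩, 0)) else 0 := by
    split_ifs with h
    · refine Finset.sum_eq_single _ (fun i _ hi => ?_) (by simp)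
      have : outLabel r ≠ (i : ℕ) := fun h' => hi (Fin.ext (by rw [← h']))
      simp [stdCG, this]
    · refine Finset.sum_eq_zero fun i _ => ?_
      have : outLabel r ≠ (i : ℕ) := by have := i.2; omega
      simp [stdCG, this]
  have h1 : ∑ i : Fin (a + 1), stdCG a r (i, 1) * star (stdCG a r' (i, 1)) =
      if h : 1 ≤ t then stdCG a r (⟨t - 1, by
        rcases r with i | i <;> simp only [outLabel] at ht <;> omega⟩, 1) *
        star (stdCG a r' (⟨t - 1, by
        rcases r with i | i <;> simp only [outLabel] at ht <;> omega⟩, 1)) else 0 := by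
    split_ifs with h
    · refine Finset.sum_eq_single _ (fun i _ hi => ?_) (by simp)
      have : outLabel r ≠ (i : ℕ) + 1 := fun h' => hi (Fin.ext (by simp only; omega))
      simp [stdCG, this]
    · refine Finset.sum_eq_zero fun i _ => ?_
      have : outLabel r ≠ (i : ℕ) + 1 := by omega
      simp [stdCG, this]
  rw [Finset.sum_add_distrib, h0, h1]
  rcases r with i | i <;> rcases r' with i' | i' <;> simp only [outLabel] at ht hl
  · have hii : i = i' := Fin.ext (by omega)
    subst hii
    have hi : (i : ℝ) ≤ a + 1 := by exact_mod_cast Nat.lt_succ_iff.1 i.2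
    have e1 := Real.mul_self_sqrt (show (0 : ℝ) ≤ a + 1 - i by linarith)
    have e2 := Real.mul_self_sqrt (show (0 : ℝ) ≤ i by positivity)
    rw [Matrix.one_apply_eq]
    have e3 : (if h : t < a + 1 then stdCG a (Sum.inl i) (⟨t, h⟩, 0) *
        star (stdCG a (Sum.inl i) (⟨t, h⟩, 0)) else 0) = (((a + 1 - i) / (a + 1) : ℝ) : ℂ) := by
      split_ifs with h
      · simp only [stdCG, outLabel, Matrix.of_apply, ht, Fin.val_zero, add_zero, if_true,
          Complex.star_def, Complex.conj_ofReal, ← Complex.ofReal_mul]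
        rw [div_mul_div_comm, e1, hD2]
      · have : (i : ℝ) = a + 1 := by
          have : (i : ℕ) = a + 1 := by omega
          exact_mod_cast this
        simp [this]
    have e4 : (if h : 1 ≤ t then stdCG a (Sum.inl i) (⟨t - 1, by omega⟩, 1) *
        star (stdCG a (Sum.inl i) (⟨t - 1, by omega⟩, 1)) else 0) = ((i / (a + 1) : ℝ) : ℂ) := by
      split_ifs with h
      · simp only [stdCG, outLabel, Matrix.of_apply, Fin.val_one, one_ne_zero, if_false]
        rw [if_pos (by omega)]
        simp only [Complex.star_def, Complex.conj_ofReal, ← Complex.ofReal_mul]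
        rw [div_mul_div_comm, e2, hD2]
      · have : (i : ℕ) = 0 := by omega
        simp [this]
    rw [e3, e4, ← Complex.ofReal_add, ← add_div, sub_add_cancel, div_self (by positivity)]
    simp
  · rw [dif_pos (by omega), dif_pos (by omega)]
    have hi : (i : ℝ) = i' + 1 := by exact_mod_cast hl
    simp only [stdCG, outLabel, Matrix.of_apply, Fin.val_one, Fin.val_zero, one_ne_zero, if_false,
      add_zero, if_true]
    rw [if_pos (by omega), if_pos (by omega), if_pos (by omega), if_pos (by omega)]
    simp only [Complex.star_def, Complex.conj_ofReal]
    rw [Matrix.one_apply_ne (by simp), hi, show (a : ℝ) + 1 - (i' + 1) = a - i' by ring]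
    push_cast
    ring
  · rw [dif_pos (by omega), dif_pos (by omega)]
    have hi : (i' : ℝ) = i + 1 := by exact_mod_cast hl.symm
    simp only [stdCG, outLabel, Matrix.of_apply, Fin.val_one, Fin.val_zero, one_ne_zero, if_false,
      add_zero, if_true]
    rw [if_pos (by omega), if_pos (by omega), if_pos (by omega), if_pos (by omega)]
    simp only [Complex.star_def, Complex.conj_ofReal]
    rw [Matrix.one_apply_ne (by simp), hi, show (a : ℝ) + 1 - (i + 1) = a - i by ring]
    push_cast
    ring
  · have hii : i = i' := Fin.ext (by omega)
    subst hii
    rw [dif_pos (by omega), dif_pos (by omega), Matrix.one_apply_eq]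
    have hi : (i : ℝ) + 1 ≤ a := by exact_mod_cast i.2
    have e1 := Real.mul_self_sqrt (show (0 : ℝ) ≤ a - i by linarith)
    have e2 := Real.mul_self_sqrt (show (0 : ℝ) ≤ i + 1 by positivity)
    simp only [stdCG, outLabel, Matrix.of_apply, Fin.val_one, Fin.val_zero, one_ne_zero, if_false,
      add_zero, if_true]
    rw [if_pos (by omega), if_pos (by omega)]
    simp only [Complex.star_def, Complex.conj_ofReal]
    rw [← Complex.ofReal_mul, ← Complex.ofReal_mul, ← Complex.ofReal_add, div_mul_div_comm,
      div_mul_div_comm, neg_mul_neg, e1, e2, hD2, ← add_div, show (i : ℝ) + 1 + (a - i) = a + 1 by ring,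
      div_self (by positivity), Complex.ofReal_one]

theorem isClebschGordan_stdCG (a : ℕ) : IsClebschGordan a (stdCG a) := by
  refine isClebschGordan_of_lowering (stdCG_mul_conjTranspose a) ?_ (stdCG_projection a)
    (stdCG_lowering a)
  -- The matrix is square since `(a + 2) + a = (a + 1) * 2`, so a right inverse is a left inverse.
  rw [Matrix.mul_eq_one_comm_of_card_eq]
  · exact stdCG_mul_conjTranspose a
  · simp
    ring

/-! ### Operators on the used basis states -/

section Embedding

variable {ι α : Type*} [Fintype ι] [DecidableEq ι] [Fintype α] [DecidableEq α]

/-- `V` acting on the span of the columns of `E`, the identity on the orthogonal complement. -/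
noncomputable def embedOp (E : Matrix ι α ℂ) (V : Matrix α α ℂ) : Matrix ι ι ℂ :=
  E * V * Eᴴ + (1 - E * Eᴴ)

/-- The isometry that places basis states at their positions. -/
noncomputable def placement (φ : α → ι) : Matrix ι α ℂ :=
  Matrix.of fun x e => if x = φ e then 1 else 0

theorem placement_isometry {φ : α → ι} (hφ : Function.Injective φ) :
    (placement φ)ᴴ * placement φ = 1 := by
  ext e e'
  simp [placement, Matrix.mul_apply, Matrix.one_apply, hφ.eq_iff, apply_ite (star : ℂ → ℂ)]
  simp [eq_comm]

theorem embedOp_one (E : Matrix ι α ℂ) : embedOp E 1 = 1 := by simp [embedOp]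

/-- For an isometry `E` the summands supported on the range of `E` and on its complement annihilate
each other. Circuits can therefore be transported gate by gate from the used states to the register.
-/
theorem embedOp_mul {E : Matrix ι α ℂ} (hE : Eᴴ * E = 1) (V W : Matrix α α ℂ) :
    embedOp E (V * W) = embedOp E V * embedOp E W := by
  have h1 : E * V * Eᴴ * (E * W * Eᴴ) = E * (V * W) * Eᴴ := by
    calc E * V * Eᴴ * (E * W * Eᴴ) = E * V * (Eᴴ * E) * W * Eᴴ := by
          simp only [Matrix.mul_assoc]
      _ = _ := by rw [hE, Matrix.mul_one]; simp only [Matrix.mul_assoc]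
  have h2 : E * V * Eᴴ * (E * Eᴴ) = E * V * Eᴴ := by
    calc E * V * Eᴴ * (E * Eᴴ) = E * V * (Eᴴ * E) * Eᴴ := by simp only [Matrix.mul_assoc]
      _ = _ := by rw [hE, Matrix.mul_one]
  have h3 : E * Eᴴ * (E * W * Eᴴ) = E * W * Eᴴ := by
    calc E * Eᴴ * (E * W * Eᴴ) = E * (Eᴴ * E) * W * Eᴴ := by simp only [Matrix.mul_assoc]
      _ = _ := by rw [hE, Matrix.mul_one]
  have h4 : E * Eᴴ * (E * Eᴴ) = E * Eᴴ := by
    calc E * Eᴴ * (E * Eᴴ) = E * (Eᴴ * E) * Eᴴ := by simp only [Matrix.mul_assoc]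
      _ = _ := by rw [hE, Matrix.mul_one]
  simp only [embedOp, add_mul, mul_add, sub_mul, mul_sub, one_mul, mul_one, h1, h2, h3, h4]
  abel

theorem embedOp_mul_embed {E : Matrix ι α ℂ} (hE : Eᴴ * E = 1) (V : Matrix α α ℂ) :
    embedOp E V * E = E * V := by
  rw [embedOp, Matrix.add_mul, Matrix.sub_mul, Matrix.mul_assoc _ Eᴴ E, Matrix.mul_assoc E Eᴴ E, hE]
  simp

theorem embedOp_conjTranspose (E : Matrix ι α ℂ) (V : Matrix α α ℂ) :
    (embedOp E V)ᴴ = embedOp E Vᴴ := by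
  simp [embedOp, Matrix.conjTranspose_mul, Matrix.mul_assoc]

theorem IsTwoLevel.embedOp {φ : α → ι} (hφ : Function.Injective φ) {V : Matrix α α ℂ}
    (hV : IsTwoLevel V) : IsTwoLevel (embedOp (placement φ) V) := by
  have hE := placement_isometry hφ
  obtain ⟨hu, i, j, hij, h⟩ := hV
  refine ⟨?_, φ i, φ j, hφ.ne hij, fun x y hxy => ?_⟩
  · rw [embedOp_conjTranspose, ← embedOp_mul hE, hu, embedOp_one]
  -- In this form the deviation from the identity is visibly that of `V`, moved along `φ`.
  · have : QSchur.embedOp (placement φ) V = placement φ * (V - 1) * (placement φ)ᴴ + 1 := by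
      simp only [QSchur.embedOp, Matrix.mul_sub, Matrix.sub_mul, Matrix.mul_one]
      abel
    rw [this, Matrix.add_apply, add_eq_right, Matrix.mul_apply]
    refine Finset.sum_eq_zero fun e' _ => ?_
    rw [Matrix.mul_apply, Finset.sum_mul]
    refine Finset.sum_eq_zero fun e _ => ?_
    simp only [placement, Matrix.of_apply, Matrix.conjTranspose_apply]
    by_cases hx : x = φ e
    · by_cases hy : y = φ e'
      · have : V e e' = (1 : Matrix α α ℂ) e e' := h e e' fun hh => hxy (by
          subst hx hy
          simpa [hφ.eq_iff] using hh)
        simp [this]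
      · simp [hy]
    · simp [hx]

end Embedding

/-! ### The size of the register -/

/-- With its counterpart for **stat**, this ensures that no label occurring in the steps is reduced
modulo the register size. -/
theorem par_lt {n m : ℕ} (h : m ≤ n / 2) : m < 2 ^ parQubits n :=
  lt_of_lt_of_le (Nat.lt_succ_of_le h) (Nat.le_pow_clog one_lt_two _)

theorem stat_lt {n m : ℕ} (h : m ≤ n) : m < 2 ^ statQubits n :=
  lt_of_lt_of_le (Nat.lt_succ_of_le h) (Nat.le_pow_clog one_lt_two _)

theorem ofNat_inj {N : ℕ} [NeZero N] {a b : ℕ} (ha : a < N) (hb : b < N)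
    (h : Fin.ofNat N a = Fin.ofNat N b) : a = b := by
  have := congr_arg Fin.val h
  simpa [Fin.val_ofNat, Nat.mod_eq_of_lt ha, Nat.mod_eq_of_lt hb] using this

theorem val_ofNat_of_lt {N : ℕ} [NeZero N] {a : ℕ} (ha : a < N) : (Fin.ofNat N a : ℕ) = a := by
  simp [Nat.mod_eq_of_lt ha]

instance (n k : ℕ) [NeZero n] : Nontrivial (Work n k) := by
  refine ⟨(0, 0, Fin.ofNat _ 0), (0, 0, Fin.ofNat _ 1), fun h => ?_⟩
  have h1 := congr_arg (fun x : Work n k => x.2.2) h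
  exact absurd (ofNat_inj (stat_lt (by omega)) (stat_lt (NeZero.one_le)) h1) (by simp)

instance (k : ℕ) : Nontrivial (SlotState k) :=
  ⟨⟨0, 0, 0⟩, ⟨0, 0, 1⟩, fun h => by
    have h1 := congr_arg (fun x : SlotState k => x.2.2) h
    exact absurd h1 (by simp)⟩

/-- For `k ≥ 2` the bit is read off its own wire. For `k = 1` it shares **par** with `l`, but then
`l = 0` is the only slot, so the sum `l + b` still determines both. -/
theorem slotPos_injective {n k : ℕ} (h1 : 1 ≤ k) (hk : k + 1 ≤ n) :
    Function.Injective (slotPos n k) := by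
  rintro ⟨l, i, b⟩ ⟨l', i', b'⟩ h
  have hl := l.2
  have hl' := l'.2
  have hi := i.2
  have hi' := i'.2
  have hb := b.2
  have hb' := b'.2
  simp only [slotPos, Prod.mk.injEq] at h
  obtain ⟨hw, hp, hs⟩ := h
  have hs' := ofNat_inj (stat_lt (by omega)) (stat_lt (by omega)) hs
  have hlb : (l : ℕ) = l' ∧ (b : ℕ) = b' := by
    by_cases hk1 : k = 1
    · subst hk1
      simp only [if_true] at hp
      have := ofNat_inj (par_lt (by omega)) (par_lt (by omega)) hp
      omega
    · simp only [hk1, if_false, add_zero] at hp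
      have := ofNat_inj (par_lt (by omega)) (par_lt (by omega)) hp
      have hb := congr_fun hw ⟨⟨k - 2, by omega⟩, by simp only; omega⟩
      exact ⟨this, congr_arg Fin.val hb⟩
  obtain rfl : l = l' := Fin.ext hlb.1
  obtain rfl : b = b' := Fin.ext hlb.2
  obtain rfl : i = i' := Fin.ext hs'
  rfl

/-- The final position of the output state of a Clebsch–Gordan transform. -/
def outPos (n k l : ℕ) {a : ℕ} : Fin (a + 2) ⊕ Fin a → Work n k
  | Sum.inl i => (fun _ => 0, Fin.ofNat _ l, Fin.ofNat _ (i : ℕ))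
  | Sum.inr i => (fun _ => 1, Fin.ofNat _ (l + 1), Fin.ofNat _ (i : ℕ))

/-- The position to which the reordering moves a used basis state. -/
def slotTarget (n k : ℕ) (e : SlotState k) : Work n k :=
  outPos n k (e.1 : ℕ) ((outIndex (k - 2 * (e.1 : ℕ))).symm e.2)

theorem outPos_injective {n k : ℕ} (h1 : 1 ≤ k) (hk : k + 1 ≤ n) {l l' : Fin (k / 2 + 1)}
    {r : Fin (k - 2 * (l : ℕ) + 2) ⊕ Fin (k - 2 * (l : ℕ))}
    {r' : Fin (k - 2 * (l' : ℕ) + 2) ⊕ Fin (k - 2 * (l' : ℕ))}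
    (h : outPos n k l r = outPos n k l' r') :
    (⟨l, r⟩ : Σ l : Fin (k / 2 + 1), Fin (k - 2 * (l : ℕ) + 2) ⊕ Fin (k - 2 * (l : ℕ))) =
      ⟨l', r'⟩ := by
  have hl := l.2
  have hl' := l'.2
  -- The two branches can share wire contents only if there is no wire. In that case `k = 1` and all
  -- slots have label `0`, so the **par** values `l` and `l' + 1` differ.
  have hbit : (fun _ => 0 : NewWire n k → Fin 2) = (fun _ => 1) → k = 1 := by
    intro hw
    by_contra hk1
    have := congr_fun hw ⟨⟨k - 2, by omega⟩, by simp only; omega⟩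
    simp at this
  rcases r with i | i <;> rcases r' with i' | i' <;>
    simp only [outPos, Prod.mk.injEq] at h <;> have hi := i.2 <;> have hi' := i'.2 <;>
    obtain ⟨hw, hp, hs⟩ := h <;>
    have hp' := ofNat_inj (par_lt (by omega)) (par_lt (by omega)) hp <;>
    have hs' := ofNat_inj (stat_lt (by omega)) (stat_lt (by omega)) hs
  · obtain rfl : l = l' := Fin.ext hp'
    obtain rfl : i = i' := Fin.ext hs'
    rfl
  · have := hbit hw
    omega
  · have := hbit hw.symm
    omega
  · obtain rfl : l = l' := Fin.ext (by omega)
    obtain rfl : i = i' := Fin.ext hs'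
    rfl

theorem slotTarget_injective {n k : ℕ} (h1 : 1 ≤ k) (hk : k + 1 ≤ n) :
    Function.Injective (slotTarget n k) := by
  rintro ⟨l, c⟩ ⟨l', c'⟩ h
  have := outPos_injective h1 hk h
  simp only [Sigma.mk.injEq] at this
  obtain ⟨rfl, h2⟩ := this
  simpa using h2

theorem card_slotState (k : ℕ) : Fintype.card (SlotState k) = 2 * irrepDimSum k := by
  simp only [SlotState, Fintype.card_sigma, Fintype.card_prod, Fintype.card_fin, irrepDimSum,
    Finset.mul_sum]
  rw [← Fin.sum_univ_eq_sum_range (fun l => 2 * (k - 2 * l + 1))]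
  exact Finset.sum_congr rfl fun l _ => mul_comm _ _

/-! ### Decomposition of the steps into two-level unitaries -/

theorem superBlocks_unitary {C : CGFamily} (hC : ∀ a, IsClebschGordan a (C a)) (k : ℕ) :
    superBlocks C k * (superBlocks C k)ᴴ = 1 := by
  rw [superBlocks, Matrix.blockDiagonal'_conjTranspose, ← Matrix.blockDiagonal'_mul,
    ← Matrix.blockDiagonal'_one]
  congr 1
  ext1 l
  rw [Matrix.conjTranspose_submatrix, ← Matrix.submatrix_mul _ _ _ id _ Function.bijective_id,
    (hC _).mul_conjTranspose, Matrix.submatrix_one_equiv]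
  rfl

/-- Each projection occurs equally often in the coupled and the product basis. This matching
supplies the row permutation for `exists_circuit_of_labels`. -/
theorem exists_label_equiv (a : ℕ) : ∃ τ : Fin (a + 2) ⊕ Fin a ≃ Fin (a + 1) × Fin 2,
    ∀ r, ((τ r).1 : ℕ) + ((τ r).2 : ℕ) = outLabel r := by
  let f : Fin (a + 2) ⊕ Fin a → Fin (a + 1) × Fin 2 := fun r => match r with
    -- The lowest state of the larger multiplet has no partner with qubit `0`; it takes the one
    -- state with qubit `1` that the smaller multiplet leaves free.
    | Sum.inl i => if h : (i : ℕ) < a + 1 then (⟨i, h⟩, 0) else (⟨a, by omega⟩, 1)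
    | Sum.inr i => (⟨i, by omega⟩, 1)
  have hf : ∀ r, ((f r).1 : ℕ) + ((f r).2 : ℕ) = outLabel r := by
    rintro (i | i)
    · simp only [f, outLabel]
      split_ifs
      · simp
      · simp only [Fin.val_one]
        omega
    · simp [f, outLabel]
  have hinj : Function.Injective f := by
    rintro (i | i) (j | j) h
    · have h1 := (hf (Sum.inl i)).symm.trans
        ((congr_arg (fun c => (c.1 : ℕ) + (c.2 : ℕ)) h).trans (hf (Sum.inl j)))
      exact congr_arg Sum.inl (Fin.ext h1)
    · simp only [f] at h
      split_ifs at h <;> simp at h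
      omega
    · simp only [f] at h
      split_ifs at h <;> simp at h
      omega
    · have h1 := (hf (Sum.inr i)).symm.trans
        ((congr_arg (fun c => (c.1 : ℕ) + (c.2 : ℕ)) h).trans (hf (Sum.inr j)))
      exact congr_arg Sum.inr (Fin.ext (by simp only [outLabel] at h1; omega))
  have hbij := (Fintype.bijective_iff_injective_and_card f).2 ⟨hinj, by simp; ring⟩
  exact ⟨Equiv.ofBijective f hbij, hf⟩

theorem exists_superBlocks_circuit {C : CGFamily} (hC : ∀ a, IsClebschGordan a (C a)) (k : ℕ) :
    ∃ L : List (Matrix (SlotState k) (SlotState k) ℂ), (∀ V ∈ L, IsTwoLevel V) ∧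
      circuit L = superBlocks C k ∧ L.length ≤ 4 * irrepDimSum k := by
  choose τ hτ using exists_label_equiv
  -- The label is the slot together with the conserved projection. Given the label, the qubit value
  -- determines the column, whence multiplicity at most two.
  obtain ⟨L, h1, h2, h3⟩ := exists_circuit_of_labels (W := superBlocks C k)
    (f := fun e : SlotState k => ((e.1 : ℕ), (e.2.1 : ℕ) + (e.2.2 : ℕ)))
    (g := fun e : SlotState k => ((e.1 : ℕ), outLabel ((outIndex (k - 2 * (e.1 : ℕ))).symm e.2)))
    (Equiv.sigmaCongrRight fun l : Fin (k / 2 + 1) => (outIndex (k - 2 * (l : ℕ))).symm.trans (τ _))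
    (by
      rintro ⟨l, c⟩
      exact Prod.ext rfl (hτ _ _))
    (by
      rintro ⟨l, c⟩ ⟨l', c'⟩ h
      by_cases hl : l = l'
      · subst hl
        rw [superBlocks, Matrix.blockDiagonal'_apply_eq] at h
        simp [(hC _).label_eq h]
      · rw [superBlocks, Matrix.blockDiagonal'_apply_ne _ _ _ hl] at h
        exact absurd rfl h)
    (superBlocks_unitary hC k)
    (by
      intro c
      have : Set.InjOn (fun e : SlotState k => e.2.2) (Finset.univ.filter fun e : SlotState k =>
          ((e.1 : ℕ), (e.2.1 : ℕ) + (e.2.2 : ℕ)) = c : Set (SlotState k)) := by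
        rintro ⟨l, i, b⟩ hx ⟨l', i', b'⟩ hx' (rfl : b = b')
        simp only [Finset.coe_filter, Finset.mem_univ, true_and, Set.mem_ofPred_eq] at hx hx'
        have h := hx.trans hx'.symm
        simp only [Prod.mk.injEq] at h
        obtain rfl : l = l' := Fin.ext h.1
        obtain rfl : i = i' := Fin.ext (by omega)
        rfl
      simpa using Finset.card_le_card_of_injOn (t := Finset.univ) _ (by simp) this)
  refine ⟨L, h1, h2, h3.trans ?_⟩
  rw [card_slotState]
  omega

theorem superCG_eq (n k : ℕ) (C : CGFamily) :
    superCG n k C = embedOp (placement (slotPos n k)) (superBlocks C k) := rfl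

theorem exists_superCG_circuit {C : CGFamily} (hC : ∀ a, IsClebschGordan a (C a)) {n k : ℕ}
    (h1 : 1 ≤ k) (hk : k + 1 ≤ n) :
    ∃ L : List (Matrix (Work n k) (Work n k) ℂ), (∀ V ∈ L, IsTwoLevel V) ∧
      circuit L = superCG n k C ∧ L.length ≤ 4 * irrepDimSum k := by
  obtain ⟨L, hL, hc, hlen⟩ := exists_superBlocks_circuit hC k
  have hinj := slotPos_injective h1 hk
  refine ⟨L.map (embedOp (placement (slotPos n k))), ?_, ?_, by simpa using hlen⟩
  · intro V hV
    obtain ⟨W, hW, rfl⟩ := List.mem_map.1 hV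
    exact (hL W hW).embedOp hinj
  · rw [circuit_map _ (embedOp_one _) (embedOp_mul (placement_isometry hinj)), hc, superCG_eq]

theorem superCG_unitary {C : CGFamily} (hC : ∀ a, IsClebschGordan a (C a)) {n k : ℕ}
    (h1 : 1 ≤ k) (hk : k + 1 ≤ n) : superCG n k C * (superCG n k C)ᴴ = 1 := by
  rw [superCG_eq, embedOp_conjTranspose,
    ← embedOp_mul (placement_isometry (slotPos_injective h1 hk)), superBlocks_unitary hC,
    embedOp_one]

theorem isReordering_iff {n k : ℕ} {π : Equiv.Perm (Work n k)} :
    IsReordering n k π ↔ ∀ e, π (slotPos n k e) = slotTarget n k e := by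
  constructor
  · rintro h ⟨l, c⟩
    obtain ⟨r, rfl⟩ := (outIndex (k - 2 * (l : ℕ))).surjective c
    rcases r with i | i
    · rw [(h l).1 i]
      simp [slotTarget, outPos]
    · rw [(h l).2 i]
      simp [slotTarget, outPos]
  · intro h l
    exact ⟨fun i => by rw [h]; simp [slotTarget, outPos],
      fun i => by rw [h]; simp [slotTarget, outPos]⟩

/-- Source and target positions are both injective on the `2 * irrepDimSum k` used states; where the
ghost states go is left to the completion by transpositions. -/
theorem exists_reordering_circuit {n k : ℕ} (h1 : 1 ≤ k) (hk : k + 1 ≤ n) :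
    ∃ (π : Equiv.Perm (Work n k)) (L : List (Matrix (Work n k) (Work n k) ℂ)),
      IsReordering n k π ∧ (∀ V ∈ L, IsTwoLevel V) ∧ circuit L = permGate π ∧
        L.length ≤ 2 * irrepDimSum k := by
  have : NeZero n := ⟨by omega⟩
  obtain ⟨π, L, hL, hc, hlen, hπ⟩ := exists_perm_circuit (slotPos n k) (slotTarget n k) Finset.univ
    (slotPos_injective h1 hk).injOn (slotTarget_injective h1 hk).injOn
  refine ⟨π, L, isReordering_iff.2 fun e => hπ e (Finset.mem_univ e), hL, hc, ?_⟩
  rwa [Finset.card_univ, card_slotState] at hlen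

/-! ### Lifting a step to the register -/

/-- The state of the register that agrees with `ω` on the qubits of step `k` and with `r` on all
other qubits. -/
def combine {n k : ℕ} (r : Reg n) (ω : Work n k) : Reg n :=
  (fun w => if h : (w : ℕ) + 2 = k then ω.1 ⟨w, h⟩ else r.1 w, ω.2)

theorem toWork_combine {n k : ℕ} (r : Reg n) (ω : Work n k) : toWork n k (combine r ω) = ω := by
  refine Prod.ext (funext fun w => ?_) rfl
  simp [toWork, combine, w.2]

theorem combine_toWork {n k : ℕ} {r y : Reg n}
    (h : ∀ w : Fin (n - 2), (w : ℕ) + 2 ≠ k → r.1 w = y.1 w) : combine r (toWork n k y) = y := by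
  refine Prod.ext (funext fun w => ?_) rfl
  simp only [combine, toWork]
  split_ifs with hw
  · rfl
  · exact h w hw

/-- Only register states that agree with `r` off the qubits of the step contribute, and `combine r`
parametrises exactly these. -/
theorem sum_lift {n k : ℕ} (V : Matrix (Work n k) (Work n k) ℂ) (r : Reg n) (v : Reg n → ℂ) :
    ∑ y, lift n k V r y * v y = ∑ ω, V (toWork n k r) ω * v (combine r ω) := by
  classical
  have h0 : ∀ y, lift n k V r y * v y =
      if ∀ w : Fin (n - 2), (w : ℕ) + 2 ≠ k → r.1 w = y.1 w then
        V (toWork n k r) (toWork n k y) * v y else 0 := by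
    intro y
    simp only [lift, Matrix.of_apply, ite_mul, zero_mul]
  simp only [h0]
  rw [← Finset.sum_filter]
  symm
  refine Finset.sum_bij (fun ω _ => combine r ω) ?_ ?_ ?_ ?_
  · intro ω _
    simp only [Finset.mem_filter, Finset.mem_univ, true_and, combine]
    intro w hw
    simp [hw]
  · intro ω _ ω' _ h
    rw [← toWork_combine r ω, h, toWork_combine]
  · intro y hy
    exact ⟨toWork n k y, Finset.mem_univ _, combine_toWork (by simpa using hy)⟩
  · intro ω _
    rw [toWork_combine]

theorem lift_one (n k : ℕ) : lift n k 1 = 1 := by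
  ext x y
  simp only [lift, Matrix.of_apply, Matrix.one_apply]
  by_cases h : x = y
  · simp [h]
  · rw [if_neg h]
    split_ifs with h1 h2
    · exact absurd (by rw [← combine_toWork h1, ← h2, combine_toWork fun _ _ => rfl]) h
    · rfl
    · rfl

theorem lift_mul (n k : ℕ) (V W : Matrix (Work n k) (Work n k) ℂ) :
    lift n k (V * W) = lift n k V * lift n k W := by
  ext x y
  rw [Matrix.mul_apply, sum_lift V x (fun z => lift n k W z y)]
  have h : ∀ ω : Work n k, (∀ w : Fin (n - 2), (w : ℕ) + 2 ≠ k → (combine x ω).1 w = y.1 w) ↔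
      ∀ w : Fin (n - 2), (w : ℕ) + 2 ≠ k → x.1 w = y.1 w := by
    intro ω
    refine forall₂_congr fun w hw => ?_
    simp [combine, hw]
  simp only [lift, Matrix.of_apply, h, toWork_combine]
  split_ifs
  · rw [Matrix.mul_apply]
  · simp

theorem lift_conjTranspose (n k : ℕ) (V : Matrix (Work n k) (Work n k) ℂ) :
    (lift n k V)ᴴ = lift n k Vᴴ := by
  ext x y
  simp only [lift, Matrix.of_apply, Matrix.conjTranspose_apply]
  rw [apply_ite (star : ℂ → ℂ), star_zero]
  refine if_congr (forall₂_congr fun _ _ => eq_comm) rfl rfl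

/-- Restricted to the initial states, this later makes the Schur matrix an isometry without any
computation with amplitudes. -/
theorem recursion_unitary {C : CGFamily} (hC : ∀ a, IsClebschGordan a (C a)) {n : ℕ}
    (π : ∀ k, Equiv.Perm (Work n k)) {m : ℕ} (hm : m + 1 ≤ n) :
    (recursion n C π m)ᴴ * recursion n C π m = 1 := by
  induction m with
  | zero => simp [recursion]
  | succ m ih =>
    have h1 := congr_arg (lift n (m + 1))
      (mul_eq_one_comm.1 (permGate_mul_conjTranspose (π (m + 1))))
    have h2 := congr_arg (lift n (m + 1)) (mul_eq_one_comm.1 (superCG_unitary hC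
      (n := n) (k := m + 1) (by omega) (by omega)))
    rw [lift_mul, ← lift_conjTranspose, lift_one] at h1 h2
    rw [recursion, Matrix.conjTranspose_mul, Matrix.conjTranspose_mul]
    calc _ = (recursion n C π m)ᴴ * ((lift n (m + 1) (superCG n (m + 1) C))ᴴ *
          ((lift n (m + 1) (permGate (π (m + 1))))ᴴ * lift n (m + 1) (permGate (π (m + 1)))) *
          lift n (m + 1) (superCG n (m + 1) C)) * recursion n C π m := by
            simp only [Matrix.mul_assoc]
      _ = 1 := by rw [h1, Matrix.mul_one, h2, Matrix.mul_one, ih (by omega)]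

/-! ### Gate counts -/

theorem exists_recursion_circuit {n : ℕ} {C : CGFamily} {π : ∀ k, Equiv.Perm (Work n k)}
    {cg re : ∀ k, List (Matrix (Work n k) (Work n k) ℂ)} {m : ℕ}
    (h : ∀ k ∈ Finset.Icc 1 m, (∀ V ∈ cg k, IsTwoLevel V) ∧ circuit (cg k) = superCG n k C ∧
      (cg k).length ≤ 4 * irrepDimSum k ∧ (∀ V ∈ re k, IsTwoLevel V) ∧
      circuit (re k) = permGate (π k) ∧ (re k).length ≤ 2 * irrepDimSum k) :
    ∃ gates : List (Matrix (Reg n) (Reg n) ℂ),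
      (∀ G ∈ gates, ∃ k ∈ Finset.Icc 1 m, ∃ V : Matrix (Work n k) (Work n k) ℂ,
        IsTwoLevel V ∧ G = lift n k V) ∧
      circuit gates = recursion n C π m ∧
      gates.length ≤ 6 * ∑ k ∈ Finset.Icc 1 m, irrepDimSum k := by
  induction m with
  | zero => exact ⟨[], by simp, by simp [circuit_nil, recursion], by simp⟩
  | succ m ih =>
    obtain ⟨gates, hg, hc, hlen⟩ := ih fun k hk => h k (by simp at hk ⊢; omega)
    obtain ⟨h1, h2, h3, h4, h5, h6⟩ := h (m + 1) (by simp)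
    refine ⟨gates ++ (cg (m + 1)).map (lift n (m + 1)) ++ (re (m + 1)).map (lift n (m + 1)),
      ?_, ?_, ?_⟩
    · intro G hG
      simp only [List.mem_append, List.mem_map] at hG
      rcases hG with (hG | ⟨V, hV, rfl⟩) | ⟨V, hV, rfl⟩
      · obtain ⟨k, hk, hV⟩ := hg G hG
        exact ⟨k, by simp at hk ⊢; omega, hV⟩
      · exact ⟨m + 1, by simp, V, h1 V hV, rfl⟩
      · exact ⟨m + 1, by simp, V, h4 V hV, rfl⟩
    · rw [circuit_append, circuit_append, circuit_map _ (lift_one _ _) (lift_mul _ _),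
        circuit_map _ (lift_one _ _) (lift_mul _ _), hc, h2, h5, recursion, Matrix.mul_assoc]
    · rw [Finset.sum_Icc_succ_top (by omega)]
      simp only [List.length_append, List.length_map]
      omega

/-- Passing from `k` to `k + 2` adds one irrep of dimension `k + 3`, and `(k + 4)² - (k + 2)² = 4 (k
+ 3)`. The bound is an equality for even `k`. -/
theorem four_mul_irrepDimSum_le (k : ℕ) : 4 * irrepDimSum k ≤ (k + 2) ^ 2 := by
  induction k using Nat.strong_induction_on with
  | _ k ih =>
    match k, ih with
    | 0, _ => simp [irrepDimSum]
    | 1, _ => simp [irrepDimSum]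
    | k + 2, ih =>
      have h := ih k (by omega)
      have : irrepDimSum (k + 2) = irrepDimSum k + (k + 3) := by
        rw [irrepDimSum, irrepDimSum, show (k + 2) / 2 + 1 = (k / 2 + 1) + 1 by omega,
          Finset.sum_range_succ']
        congr 1
        refine Finset.sum_congr rfl fun l _ => ?_
        omega
      rw [this]
      nlinarith

/-- The cubic is exactly `(3 / 2) ∑_{k = 1}^{n - 1} (k + 2)²`; the constant `-6` makes it vanish for
`n = 1`, where the induction starts. -/
theorem gateBound_le (n : ℕ) (hn : 2 ≤ n) :
    (gateBound n : ℝ) ≤ (n : ℝ) ^ 3 / 2 + 9 * (n : ℝ) ^ 2 / 4 + 13 * (n : ℝ) / 4 - 6 := by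
  obtain ⟨m, rfl⟩ : ∃ m, n = m + 1 := ⟨n - 1, by omega⟩
  clear hn
  rw [gateBound, Nat.add_sub_cancel]
  induction m with
  | zero => norm_num
  | succ m ih =>
    rw [Finset.sum_Icc_succ_top (by omega)]
    have h := four_mul_irrepDimSum_le (m + 1)
    have h' : 4 * (irrepDimSum (m + 1) : ℝ) ≤ ((m : ℝ) + 1 + 2) ^ 2 := by exact_mod_cast h
    push_cast at ih ⊢
    nlinarith

theorem polynomial_bound (n : ℕ) (hn : 2 ≤ n) :
    (n : ℝ) ^ 3 / 2 + 9 * (n : ℝ) ^ 2 / 4 + 13 * (n : ℝ) / 4 - 6 < 2 * (n : ℝ) ^ 3 := by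
  -- In the variable `m = n - 2` the difference of the two sides has only positive coefficients.
  obtain ⟨m, rfl⟩ : ∃ m, n = m + 2 := ⟨n - 2, by omega⟩
  push_cast
  have : (0 : ℝ) ≤ m := by positivity
  nlinarith [pow_nonneg this 2, pow_nonneg this 3]

/-! ### Irreducibility of unitary representations -/

section Irreducible

variable {G ι : Type*} [Group G] [Fintype ι] [DecidableEq ι]

/-- The representation given by a multiplicative family of matrices. -/
noncomputable def matrixRep (f : G → Matrix ι ι ℂ) (h1 : f 1 = 1)
    (hmul : ∀ g h, f (g * h) = f g * f h) : Representation ℂ G (ι → ℂ) where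
  toFun g := Matrix.toLin' (f g)
  map_one' := by rw [h1, Matrix.toLin'_one]; rfl
  map_mul' g h := by rw [hmul, Matrix.toLin'_mul]; rfl

theorem toMatrix'_matrixRep (f : G → Matrix ι ι ℂ) (h1 : f 1 = 1)
    (hmul : ∀ g h, f (g * h) = f g * f h) (g : G) :
    LinearMap.toMatrix' (matrixRep f h1 hmul g) = f g :=
  LinearMap.toMatrix'_toLin' _

/-- A unitary matrix representation whose commutant consists of scalars is irreducible. -/
theorem isIrreducible_matrixRep [Nonempty ι] (f : G → Matrix ι ι ℂ) (h1 : f 1 = 1)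
    (hmul : ∀ g h, f (g * h) = f g * f h) (hstar : ∀ g, (f g)ᴴ = f g⁻¹)
    (hcomm : ∀ Y : Matrix ι ι ℂ, (∀ g, f g * Y = Y * f g) → ∃ c : ℂ, Y = c • 1) :
    (matrixRep f h1 hmul).IsIrreducible := by
  set ρ := matrixRep f h1 hmul with hρ
  -- The orthogonal projection `P` onto an invariant subspace lies in the commutant, hence is a
  -- scalar `c`. If `c = 0` the subspace is zero; otherwise every vector is a multiple of its
  -- projection.
  have key : ∀ V : Subrepresentation ρ, V.toSubmodule = ⊥ ∨ V.toSubmodule = ⊤ := by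
    intro V
    let e : (ι → ℂ) ≃ₗ[ℂ] EuclideanSpace ℂ ι := (WithLp.linearEquiv 2 ℂ (ι → ℂ)).symm
    let K : Submodule ℂ (EuclideanSpace ℂ ι) := V.toSubmodule.map e.toLinearMap
    let P : (ι → ℂ) →ₗ[ℂ] (ι → ℂ) :=
      e.symm.toLinearMap ∘ₗ K.starProjection.toLinearMap ∘ₗ e.toLinearMap
    have hinner : ∀ (g : G) (v w : ι → ℂ),
        inner ℂ (e v) (e (f g *ᵥ w)) = inner ℂ (e (f g⁻¹ *ᵥ v)) (e w) := by
      intro g v w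
      change inner ℂ (WithLp.toLp 2 v) (WithLp.toLp 2 (f g *ᵥ w)) =
        inner ℂ (WithLp.toLp 2 (f g⁻¹ *ᵥ v)) (WithLp.toLp 2 w)
      rw [EuclideanSpace.inner_toLp_toLp, EuclideanSpace.inner_toLp_toLp, ← hstar,
        Matrix.star_mulVec, Matrix.conjTranspose_conjTranspose, dotProduct_comm,
        dotProduct_comm w, Matrix.dotProduct_mulVec]
    have hmem : ∀ (g : G) (v : ι → ℂ), v ∈ V.toSubmodule → f g *ᵥ v ∈ V.toSubmodule :=
      fun g v hv => V.apply_mem_toSubmodule g hv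
    -- Unitarity makes the orthogonal complement invariant as well, so `f g` respects the
    -- decomposition of `v`.
    have hP : ∀ (g : G) (v : ι → ℂ), P (f g *ᵥ v) = f g *ᵥ P v := by
      intro g v
      change e.symm (K.starProjection (e (f g *ᵥ v))) = f g *ᵥ e.symm (K.starProjection (e v))
      rw [LinearEquiv.symm_apply_eq]
      obtain ⟨u, hu, hue⟩ := K.starProjection_apply_mem (e v)
      change e u = _ at hue
      rw [← hue, LinearEquiv.symm_apply_apply]
      refine Submodule.eq_starProjection_of_mem_orthogonal
        ⟨f g *ᵥ u, hmem g u hu, rfl⟩ ?_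
      rw [Submodule.mem_orthogonal]
      rintro _ ⟨w, hw, rfl⟩
      have h2 : inner ℂ (e (f g⁻¹ *ᵥ w)) (e v - e u) = 0 := by
        have := K.sub_starProjection_mem_orthogonal (e v)
        rw [← hue, Submodule.mem_orthogonal] at this
        exact this _ ⟨_, hmem g⁻¹ w hw, rfl⟩
      rw [← map_sub, ← hinner, Matrix.mulVec_sub, map_sub] at h2
      exact h2
    obtain ⟨c, hc⟩ := hcomm (LinearMap.toMatrix' P) (by
      intro g
      apply Matrix.toLin'.injective
      rw [Matrix.toLin'_mul, Matrix.toLin'_mul, Matrix.toLin'_toMatrix']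
      refine LinearMap.ext fun v => ?_
      simp [hP])
    have hPc : ∀ v, P v = c • v := by
      intro v
      rw [← LinearMap.toMatrix'_mulVec, hc, Matrix.smul_mulVec, Matrix.one_mulVec]
    have hPV : ∀ v ∈ V.toSubmodule, P v = v := by
      intro v hv
      change e.symm (K.starProjection (e v)) = v
      have hK : e v ∈ K := ⟨v, hv, rfl⟩
      rw [Submodule.starProjection_eq_self_iff.2 hK]
      simp
    by_cases h0 : c = 0
    · left
      rw [Submodule.eq_bot_iff]
      intro v hv
      rw [← hPV v hv, hPc, h0, zero_smul]
    · right
      rw [Submodule.eq_top_iff']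
      intro v
      obtain ⟨u, hu, hue⟩ := K.starProjection_apply_mem (e v)
      have : P v = u := by
        change e.symm (K.starProjection (e v)) = u
        rw [← hue]
        simp
      rw [hPc] at this
      have h3 : v = c⁻¹ • u := by rw [← this, smul_smul, inv_mul_cancel₀ h0, one_smul]
      rw [h3]
      exact V.toSubmodule.smul_mem _ hu
  have hbt : (⊥ : Subrepresentation ρ) ≠ ⊤ := by
    intro h
    have h' : (⊥ : Submodule ℂ (ι → ℂ)) = ⊤ := congr_arg Subrepresentation.toSubmodule h
    exact bot_ne_top h'
  exact
    { exists_pair_ne := ⟨⊥, ⊤, hbt⟩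
      eq_bot_or_eq_top := fun V => (key V).imp
        (fun h => Subrepresentation.toSubmodule_injective h)
        (fun h => Subrepresentation.toSubmodule_injective h) }

end Irreducible

/-! ### Operators on qubits -/

section Qubits

variable {n : ℕ}

/-- The number of ones of a bit string. -/
def weight (x : Fin n → Fin 2) : ℕ := ∑ t, (x t : ℕ)

/-- The collective lowering operator in the computational basis. -/
noncomputable def lowTotal (n : ℕ) : Matrix (Fin n → Fin 2) (Fin n → Fin 2) ℂ :=
  Matrix.of fun x y => ∑ t, if y t = 0 ∧ x = Function.update y t 1 then 1 else 0

theorem permQubits_mul_apply (s : Equiv.Perm (Fin n)) {κ : Type*} (A : Matrix (Fin n → Fin 2) κ ℂ)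
    (x : Fin n → Fin 2) (c : κ) : (permQubits n s * A) x c = A (fun t => x (s t)) c := by
  rw [Matrix.mul_apply, Finset.sum_eq_single (fun t => x (s t))]
  · simp [permQubits]
  · intro y _ hy
    rw [permQubits, Matrix.of_apply, if_neg, zero_mul]
    rintro rfl
    exact hy (by simp)
  · simp

theorem mul_permQubits_apply (s : Equiv.Perm (Fin n)) {κ : Type*} (A : Matrix κ (Fin n → Fin 2) ℂ)
    (y : Fin n → Fin 2) (c : κ) : (A * permQubits n s) c y = A c (fun t => y (s⁻¹ t)) := by
  rw [Matrix.mul_apply, Finset.sum_eq_single (fun t => y (s⁻¹ t))]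
  · simp [permQubits]
  · intro x _ hx
    rw [permQubits, Matrix.of_apply, if_neg hx, mul_zero]
  · simp

/-- This makes the commutant of `S_n` combinatorial: its elements are the functions on pairs of
strings that are constant on orbits. -/
theorem commute_permQubits_iff {s : Equiv.Perm (Fin n)}
    {A : Matrix (Fin n → Fin 2) (Fin n → Fin 2) ℂ} :
    A * permQubits n s = permQubits n s * A ↔
      ∀ x y, A (fun t => x (s t)) (fun t => y (s t)) = A x y := by
  constructor
  · intro h x y
    have := congr_fun (congr_fun h x) (fun t => y (s t))
    rw [permQubits_mul_apply, mul_permQubits_apply] at this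
    simpa using this.symm
  · intro h
    ext x y
    rw [permQubits_mul_apply, mul_permQubits_apply, ← h x]
    simp

theorem permQubits_one : permQubits n 1 = 1 := by
  ext x y
  simp [permQubits, Matrix.one_apply]

theorem permQubits_mul (s s' : Equiv.Perm (Fin n)) :
    permQubits n (s * s') = permQubits n s * permQubits n s' := by
  ext x y
  rw [permQubits_mul_apply]
  simp only [permQubits, Matrix.of_apply]
  refine if_congr ⟨?_, ?_⟩ rfl rfl
  · rintro rfl
    simp
  · intro h
    funext t
    have := congr_fun h (s⁻¹ t)
    simpa using this

theorem permQubits_conjTranspose (s : Equiv.Perm (Fin n)) :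
    (permQubits n s)ᴴ = permQubits n s⁻¹ := by
  ext x y
  simp only [permQubits, Matrix.conjTranspose_apply, Matrix.of_apply]
  rw [apply_ite (star : ℂ → ℂ), star_one, star_zero]
  refine if_congr ⟨?_, ?_⟩ rfl rfl
  · rintro rfl
    simp
  · rintro rfl
    simp

theorem weight_perm (x : Fin n → Fin 2) (s : Equiv.Perm (Fin n)) :
    weight (fun t => x (s t)) = weight x :=
  Equiv.sum_comp s fun t => (x t : ℕ)

theorem lowTotal_permQubits (s : Equiv.Perm (Fin n)) :
    lowTotal n * permQubits n s = permQubits n s * lowTotal n := by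
  rw [commute_permQubits_iff]
  intro x y
  simp only [lowTotal, Matrix.of_apply]
  rw [← Equiv.sum_comp s fun t => if y t = 0 ∧ x = Function.update y t 1 then (1 : ℂ) else 0]
  refine Finset.sum_congr rfl fun t _ => if_congr (and_congr_right fun _ => ?_) rfl rfl
  constructor
  · intro h
    funext u
    have := congr_fun h (s⁻¹ u)
    simpa [Function.update_apply, Equiv.symm_apply_eq] using this
  · rintro rfl
    funext u
    simp [Function.update_apply]

theorem tensorPower_permQubits (U : Matrix.unitaryGroup (Fin 2) ℂ) (s : Equiv.Perm (Fin n)) :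
    tensorPower n U * permQubits n s = permQubits n s * tensorPower n U := by
  rw [commute_permQubits_iff]
  intro x y
  exact Equiv.prod_comp s fun t => (U : Matrix (Fin 2) (Fin 2) ℂ) (x t) (y t)

theorem tensorPower_one : tensorPower n 1 = 1 := by
  ext x y
  simp only [tensorPower, Matrix.of_apply, Matrix.one_apply, OneMemClass.coe_one]
  by_cases h : x = y
  · simp [h]
  · obtain ⟨t, ht⟩ := Function.ne_iff.1 h
    rw [if_neg h]
    exact Finset.prod_eq_zero (Finset.mem_univ t) (by simp [ht])

theorem tensorPower_mul (U V : Matrix.unitaryGroup (Fin 2) ℂ) :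
    tensorPower n (U * V) = tensorPower n U * tensorPower n V := by
  ext x z
  simp only [tensorPower, Matrix.of_apply, Matrix.mul_apply, Submonoid.coe_mul]
  rw [Finset.prod_univ_sum, Fintype.piFinset_univ]
  simp only [Finset.prod_mul_distrib]

theorem tensorPower_conjTranspose (U : Matrix.unitaryGroup (Fin 2) ℂ) :
    (tensorPower n U)ᴴ = tensorPower n U⁻¹ := by
  ext x y
  simp only [tensorPower, Matrix.conjTranspose_apply, Matrix.of_apply, star_prod]
  rfl

/-- The number of common ones of two bit strings. -/
def overlap (x y : Fin n → Fin 2) : ℕ := ∑ t, (x t : ℕ) * (y t : ℕ)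

theorem overlap_le (x y : Fin n → Fin 2) : overlap x y ≤ weight x :=
  Finset.sum_le_sum fun t _ => by
    have := (y t).2
    nlinarith

/-- Pairs of bit strings of equal weights and overlap differ by a permutation of the positions. -/
theorem exists_perm_of_overlap {x y x' y' : Fin n → Fin 2} (hx : weight x = weight x')
    (hy : weight y = weight y') (ho : overlap x y = overlap x' y') :
    ∃ s : Equiv.Perm (Fin n), (fun t => x' (s t)) = x ∧ (fun t => y' (s t)) = y := by
  classical
  -- The numbers of positions with joint values `00`, `01`, `10`, `11` are affine in the two weights
  -- and the overlap. Equal data give fibres of equal size, and bijections of fibres glue to a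
  -- permutation.
  have count : ∀ (x y : Fin n → Fin 2) (a b : Fin 2),
      (Fintype.card {t // (x t, y t) = (a, b)} : ℤ) =
        if a = 1 then (if b = 1 then (overlap x y : ℤ) else weight x - overlap x y)
        else if b = 1 then (weight y : ℤ) - overlap x y
        else n - weight x - weight y + overlap x y := by
    intro x y a b
    rw [Fintype.card_subtype, Finset.card_filter]
    push_cast
    have hn : (n : ℤ) = ∑ _t : Fin n, (1 : ℤ) := by simp
    simp only [overlap, weight]
    push_cast
    rw [hn]
    fin_cases a <;> fin_cases b <;> simp only [← Finset.sum_sub_distrib, ← Finset.sum_add_distrib,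
      Fin.zero_eta, Fin.mk_one, Fin.isValue, zero_ne_one, if_true, if_false] <;>
    · refine Finset.sum_congr rfl fun t _ => ?_
      generalize x t = u
      generalize y t = v
      revert u v
      decide
  have hcard : ∀ c : Fin 2 × Fin 2,
      Nonempty ({t // (x t, y t) = c} ≃ {t // (x' t, y' t) = c}) := by
    rintro ⟨a, b⟩
    refine Fintype.card_eq.1 ?_
    have h1 := count x y a b
    have h2 := count x' y' a b
    rw [hx, hy, ho, ← h2] at h1
    exact_mod_cast h1
  let e c := (hcard c).some
  refine ⟨Equiv.ofFiberEquiv e, ?_⟩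
  have h := fun t => Equiv.ofFiberEquiv_map (f := fun t => (x t, y t)) (g := fun t => (x' t, y' t)) e t
  exact ⟨funext fun t => congr_arg Prod.fst (h t), funext fun t => congr_arg Prod.snd (h t)⟩

/-- The matrix of ones on pairs of strings of weight `w` with overlap `o`. -/
noncomputable def orbital (n w o : ℕ) : Matrix (Fin n → Fin 2) (Fin n → Fin 2) ℂ :=
  Matrix.of fun x y => if weight x = w ∧ weight y = w ∧ overlap x y = o then 1 else 0

/-- An operator on the strings of weight `w` that commutes with all permutations is a combination of
`w + 1` fixed matrices. -/
theorem mem_span_orbital {w : ℕ} {A : Matrix (Fin n → Fin 2) (Fin n → Fin 2) ℂ}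
    (hA : ∀ s, A * permQubits n s = permQubits n s * A)
    (hw : ∀ x y, A x y ≠ 0 → weight x = w ∧ weight y = w) :
    A ∈ Submodule.span ℂ (Set.range fun o : Fin (w + 1) => orbital n w o) := by
  classical
  -- An overlap that no pair realises gets the constant `0`; only the upper bound `w + 1` on the
  -- number of matrices matters.
  have hex : ∀ o : ℕ, ∃ c : ℂ, ∀ x y, weight x = w → weight y = w → overlap x y = o → A x y = c := by
    intro o
    by_cases h : ∃ x y : Fin n → Fin 2, weight x = w ∧ weight y = w ∧ overlap x y = o
    · obtain ⟨x', y', hx', hy', ho'⟩ := h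
      refine ⟨A x' y', fun x y hx hy ho => ?_⟩
      obtain ⟨s, rfl, rfl⟩ := exists_perm_of_overlap (hx.trans hx'.symm) (hy.trans hy'.symm)
        (ho.trans ho'.symm)
      exact commute_permQubits_iff.1 (hA s) x' y'
    · push Not at h
      exact ⟨0, fun x y hx hy ho => absurd ho (h x y hx hy)⟩
  choose c hc using hex
  have : A = ∑ o : Fin (w + 1), c o • orbital n w o := by
    ext x y
    simp only [Matrix.sum_apply, Matrix.smul_apply, orbital, Matrix.of_apply, smul_eq_mul, mul_ite,
      mul_one, mul_zero]
    by_cases h : weight x = w ∧ weight y = w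
    · rw [Finset.sum_eq_single ⟨overlap x y, by have := overlap_le x y; omega⟩]
      · rw [if_pos ⟨h.1, h.2, rfl⟩]
        exact hc _ x y h.1 h.2 rfl
      · intro o _ ho
        rw [if_neg]
        rintro ⟨-, -, h3⟩
        exact ho (Fin.ext h3.symm)
      · simp
    · have h0 : A x y = 0 := by
        by_contra h'
        exact h (hw x y h')
      rw [h0, Finset.sum_eq_zero]
      intro o _
      rw [if_neg]
      tauto
  rw [this]
  exact Submodule.sum_mem _ fun o _ => Submodule.smul_mem _ _ (Submodule.subset_span ⟨o, rfl⟩)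

end Qubits

/-! ### Schur–Weyl duality for qubits -/

section SchurWeyl

theorem spinLower_mul_conjTranspose (d : ℕ) :
    spinLower d * (spinLower d)ᴴ = Matrix.diagonal fun i : Fin d => (i : ℂ) * ((d : ℂ) - i) := by
  have h := spin_sq d
  rw [add_assoc, ← eq_sub_iff_add_eq] at h
  rw [h, spinZ, Matrix.diagonal_mul_diagonal, Matrix.diagonal_add, ← Matrix.diagonal_one,
    ← Matrix.diagonal_smul, Matrix.diagonal_sub]
  congr 1
  ext i
  simp only [Pi.smul_apply, smul_eq_mul, mul_one, spinSqValue]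
  ring

theorem lowerCoeff_ne_zero {d c : ℕ} (h : c + 1 < d) : lowerCoeff d c ≠ 0 := by
  have h' : (c : ℝ) + 1 < d := by exact_mod_cast h
  rw [lowerCoeff, Complex.ofReal_ne_zero, Real.sqrt_ne_zero']
  exact mul_pos (by positivity) (by linarith)

theorem mul_placement_apply {ι α ρ : Type*} [Fintype ι] [DecidableEq ι] (A : Matrix ρ ι ℂ)
    (φ : α → ι) (r : ρ) (e : α) : (A * placement φ) r e = A r (φ e) := by
  simp [Matrix.mul_apply, placement]

theorem placement_conjTranspose_mul_apply {ι α ρ : Type*} [Fintype ι] [DecidableEq ι]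
    (A : Matrix ι ρ ℂ) (φ : α → ι) (e : α) (r : ρ) :
    ((placement φ)ᴴ * A) e r = A (φ e) r := by
  simp [Matrix.mul_apply, placement, apply_ite (star : ℂ → ℂ)]

variable (n : ℕ) (Mult : Fin (n / 2 + 1) → Type) [∀ l, Fintype (Mult l)]
  [∀ l, DecidableEq (Mult l)]

/-- The lowering operator on `⨁_λ P_λ ⊗ Q_λ`. -/
noncomputable def lowBlock : Matrix (SchurLabel n Mult) (SchurLabel n Mult) ℂ :=
  Matrix.blockDiagonal' fun l =>
    (1 : Matrix (Mult l) (Mult l) ℂ) ⊗ₖ spinLower (n - 2 * (l : ℕ) + 1)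

variable {n Mult}

theorem lowBlock_mul_conjTranspose : lowBlock n Mult * (lowBlock n Mult)ᴴ =
    Matrix.diagonal fun r => ((r.2.2 : ℕ) : ℂ) * (((n - 2 * (r.1 : ℕ) + 1 : ℕ) : ℂ) - (r.2.2 : ℕ)) := by
  rw [lowBlock, Matrix.blockDiagonal'_conjTranspose, ← Matrix.blockDiagonal'_mul]
  refine Eq.trans (congr_arg _ (funext fun l => ?_)) (Matrix.blockDiagonal'_diagonal
    fun (l : Fin (n / 2 + 1)) (c : Mult l × Fin (n - 2 * (l : ℕ) + 1)) =>
      ((c.2 : ℕ) : ℂ) * (((n - 2 * (l : ℕ) + 1 : ℕ) : ℂ) - (c.2 : ℕ)))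
  rw [Matrix.conjTranspose_kronecker, ← Matrix.mul_kronecker_mul, spinLower_mul_conjTranspose,
    Matrix.conjTranspose_one, Matrix.mul_one, ← Matrix.diagonal_one,
    Matrix.diagonal_kronecker_diagonal]
  simp only [one_mul]

theorem mul_lowBlock_apply {ρ : Type*} (X : Matrix ρ (SchurLabel n Mult) ℂ) (r : ρ)
    (l : Fin (n / 2 + 1)) (m : Mult l) (i : Fin (n - 2 * (l : ℕ) + 1))
    (h : (i : ℕ) + 1 < n - 2 * (l : ℕ) + 1) :
    (X * lowBlock n Mult) r ⟨l, m, i⟩ =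
      X r ⟨l, m, ⟨i + 1, h⟩⟩ * lowerCoeff (n - 2 * (l : ℕ) + 1) i := by
  rw [Matrix.mul_apply, Finset.sum_eq_single ⟨l, m, ⟨i + 1, h⟩⟩]
  · simp [lowBlock, Matrix.blockDiagonal'_apply_eq, spinLower_apply]
  · rintro ⟨l', m', i'⟩ _ hne
    by_cases hl : l' = l
    · subst hl
      rw [lowBlock, Matrix.blockDiagonal'_apply_eq, Matrix.kroneckerMap_apply, spinLower_apply,
        Matrix.one_apply]
      by_cases hm : m' = m
      · subst hm
        have hi : (i' : ℕ) ≠ i + 1 := fun hi =>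
          hne (by rw [show i' = ⟨i + 1, h⟩ from Fin.ext hi])
        simp [hi]
      · simp [hm]
    · rw [lowBlock, Matrix.blockDiagonal'_apply_ne _ _ _ hl, mul_zero]
  · simp

theorem lowBlock_mul_apply {ρ : Type*} (X : Matrix (SchurLabel n Mult) ρ ℂ) (r : ρ)
    (l : Fin (n / 2 + 1)) (m : Mult l) (i : Fin (n - 2 * (l : ℕ) + 1)) :
    (lowBlock n Mult * X) ⟨l, m, i⟩ r =
      if h : 1 ≤ (i : ℕ) then
        lowerCoeff (n - 2 * (l : ℕ) + 1) (i - 1) * X ⟨l, m, ⟨i - 1, by omega⟩⟩ r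
      else 0 := by
  have : (lowBlock n Mult * X) ⟨l, m, i⟩ r =
      (spinLower (n - 2 * (l : ℕ) + 1) * Matrix.of fun i r => X ⟨l, m, i⟩ r) i r := by
    rw [Matrix.mul_apply, Matrix.mul_apply, Fintype.sum_sigma, Finset.sum_eq_single l]
    · rw [Fintype.sum_prod_type, Finset.sum_eq_single m]
      · simp [lowBlock, Matrix.blockDiagonal'_apply_eq]
      · intro m' _ hm
        simp [lowBlock, Matrix.blockDiagonal'_apply_eq, hm.symm]
      · simp
    · intro l' _ hl
      refine Finset.sum_eq_zero fun c _ => ?_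
      rw [lowBlock, Matrix.blockDiagonal'_apply_ne _ _ _ hl.symm, zero_mul]
    · simp
  rw [this, spinLower_mul_apply]
  rfl

/-- Operators acting on the multiplicity labels only. -/
noncomputable def multOp (p : ∀ l, Matrix (Mult l) (Mult l) ℂ) :
    Matrix (SchurLabel n Mult) (SchurLabel n Mult) ℂ :=
  Matrix.blockDiagonal' fun l =>
    p l ⊗ₖ (1 : Matrix (Fin (n - 2 * (l : ℕ) + 1)) (Fin (n - 2 * (l : ℕ) + 1)) ℂ)

/-- An operator that commutes with the spin operators acts on the multiplicity labels only. -/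
theorem eq_blockDiagonal_of_commute {X : Matrix (SchurLabel n Mult) (SchurLabel n Mult) ℂ}
    (hX : X * lowBlock n Mult = lowBlock n Mult * X)
    (hX' : X * (lowBlock n Mult)ᴴ = (lowBlock n Mult)ᴴ * X)
    (hw : ∀ r r', X r r' ≠ 0 → (r.1 : ℕ) + (r.2.2 : ℕ) = (r'.1 : ℕ) + (r'.2.2 : ℕ)) :
    X = multOp fun l => Matrix.of fun m m' : Mult l => X ⟨l, m, 0⟩ ⟨l, m', 0⟩ := by
  -- `J^- J^+` is diagonal, and within a weight space its eigenvalues tell the irreps apart, so `X`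
  -- cannot mix different `l`.
  have hdiag : X * (lowBlock n Mult * (lowBlock n Mult)ᴴ) =
      lowBlock n Mult * (lowBlock n Mult)ᴴ * X := by
    rw [← Matrix.mul_assoc, hX, Matrix.mul_assoc, hX', Matrix.mul_assoc]
  rw [lowBlock_mul_conjTranspose] at hdiag
  -- Commutation with `J^-` carries the matrix on multiplicity labels unchanged down the ladder, as
  -- the lowering coefficients do not vanish.
  have hstep : ∀ (l : Fin (n / 2 + 1)) (m m' : Mult l) (i : ℕ) (h : i < n - 2 * (l : ℕ) + 1),
      X ⟨l, m, ⟨i, h⟩⟩ ⟨l, m', ⟨i, h⟩⟩ = X ⟨l, m, 0⟩ ⟨l, m', 0⟩ := by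
    intro l m m' i
    induction i with
    | zero => intro h; rfl
    | succ i ih =>
      intro h
      rw [← ih (by omega)]
      have h1 := congr_fun (congr_fun hX ⟨l, m, ⟨i + 1, h⟩⟩) ⟨l, m', ⟨i, by omega⟩⟩
      rw [mul_lowBlock_apply _ _ _ _ _ h, lowBlock_mul_apply, dif_pos (by simp), mul_comm] at h1
      exact mul_left_cancel₀ (lowerCoeff_ne_zero h) h1
  ext ⟨l, m, i⟩ ⟨l', m', i'⟩
  rw [multOp]
  by_cases hl : l = l'
  · subst hl
    rw [Matrix.blockDiagonal'_apply_eq, Matrix.kroneckerMap_apply, Matrix.of_apply,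
      Matrix.one_apply]
    by_cases hi : i = i'
    · subst hi
      rw [if_pos rfl, mul_one]
      exact hstep l m m' i i.2
    · rw [if_neg hi, mul_zero]
      by_contra h
      have := hw _ _ h
      exact hi (Fin.ext (by simpa using this))
  · rw [Matrix.blockDiagonal'_apply_ne _ _ _ hl]
    by_contra h
    have hwt := hw _ _ h
    have h1 := congr_fun (congr_fun hdiag ⟨l, m, i⟩) ⟨l', m', i'⟩
    rw [Matrix.mul_diagonal, Matrix.diagonal_mul, mul_comm] at h1
    have h2 := mul_right_cancel₀ h h1
    have e1 : ((n - 2 * (l : ℕ) + 1 : ℕ) : ℤ) = n - 2 * l + 1 := by omega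
    have e2 : ((n - 2 * (l' : ℕ) + 1 : ℕ) : ℤ) = n - 2 * l' + 1 := by omega
    have h3 : (i' : ℤ) * (((n - 2 * (l' : ℕ) + 1 : ℕ) : ℤ) - i') =
        i * (((n - 2 * (l : ℕ) + 1 : ℕ) : ℤ) - i) := by exact_mod_cast h2
    rw [e1, e2] at h3
    simp only at hwt
    have hi : (i : ℤ) = l' + i' - l := by omega
    rw [hi] at h3
    -- This is the difference of the two eigenvalues at equal weight. The second factor is positive
    -- because `l + l' ≤ n`.
    have h4 : ((l' : ℤ) - l) * (n + 1 - l - l') = 0 := by linear_combination -h3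
    rcases mul_eq_zero.1 h4 with h5 | h5
    · exact hl (Fin.ext (by omega))
    · have := l.2
      have := l'.2
      omega

/-- A unitary change of basis to states of definite spin projection on which the collective lowering
operator acts in the standard way. -/
structure IsSpinBasis (S : Matrix (SchurLabel n Mult) (Fin n → Fin 2) ℂ) : Prop where
  mul_conjTranspose : S * Sᴴ = 1
  conjTranspose_mul : Sᴴ * S = 1
  weight_eq : ∀ r x, S r x ≠ 0 → weight x = (r.1 : ℕ) + (r.2.2 : ℕ)
  lowering : S * lowTotal n = lowBlock n Mult * S

/-- The action of a permutation on the multiplicity space. -/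
noncomputable def multMatrix (S : Matrix (SchurLabel n Mult) (Fin n → Fin 2) ℂ)
    (l : Fin (n / 2 + 1)) (s : Equiv.Perm (Fin n)) : Matrix (Mult l) (Mult l) ℂ :=
  Matrix.of fun m m' => (S * permQubits n s * Sᴴ) ⟨l, m, 0⟩ ⟨l, m', 0⟩

namespace IsSpinBasis

variable {S : Matrix (SchurLabel n Mult) (Fin n → Fin 2) ℂ}

theorem conj_mul (hS : IsSpinBasis S) {A B : Matrix (Fin n → Fin 2) (Fin n → Fin 2) ℂ} :
    S * (A * B) * Sᴴ = (S * A * Sᴴ) * (S * B * Sᴴ) := by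
  calc S * (A * B) * Sᴴ = S * A * (1 : Matrix (Fin n → Fin 2) (Fin n → Fin 2) ℂ) * B * Sᴴ := by rw [Matrix.mul_one]; simp only [Matrix.mul_assoc]
    _ = _ := by rw [← hS.conjTranspose_mul]; simp only [Matrix.mul_assoc]

theorem conj_lowTotal (hS : IsSpinBasis S) : S * lowTotal n * Sᴴ = lowBlock n Mult := by
  rw [hS.lowering, Matrix.mul_assoc, hS.mul_conjTranspose, Matrix.mul_one]

theorem weight_conj (hS : IsSpinBasis S) {A : Matrix (Fin n → Fin 2) (Fin n → Fin 2) ℂ}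
    (hA : ∀ x y, A x y ≠ 0 → weight x = weight y) {r r' : SchurLabel n Mult}
    (h : (S * A * Sᴴ) r r' ≠ 0) :
    (r.1 : ℕ) + (r.2.2 : ℕ) = (r'.1 : ℕ) + (r'.2.2 : ℕ) := by
  rw [Matrix.mul_apply] at h
  obtain ⟨y, -, hy⟩ := Finset.exists_ne_zero_of_sum_ne_zero h
  rw [Matrix.mul_apply] at hy
  obtain ⟨x, -, hx⟩ := Finset.exists_ne_zero_of_sum_ne_zero (left_ne_zero_of_mul hy)
  have h1 := hS.weight_eq _ _ (left_ne_zero_of_mul hx)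
  have h2 := hS.weight_eq r' y (by
    have := right_ne_zero_of_mul hy
    rw [Matrix.conjTranspose_apply] at this
    exact fun h0 => this (by rw [h0, star_zero]))
  rw [← h1, ← h2]
  exact hA _ _ (right_ne_zero_of_mul hx)

/-- Permutations preserve weight and commute with the collective lowering operator. Commutation with
its adjoint is the adjoint of the relation for `s⁻¹`. -/
theorem conj_permQubits (hS : IsSpinBasis S) (s : Equiv.Perm (Fin n)) : S * permQubits n s * Sᴴ =
    multOp fun l => multMatrix S l s := by
  have hcomm : ∀ s, S * permQubits n s * Sᴴ * lowBlock n Mult =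
      lowBlock n Mult * (S * permQubits n s * Sᴴ) := by
    intro s
    rw [← hS.conj_lowTotal, ← hS.conj_mul, ← hS.conj_mul, lowTotal_permQubits]
  refine eq_blockDiagonal_of_commute (hcomm s) ?_ fun r r' h => hS.weight_conj ?_ h
  · have := congr_arg Matrix.conjTranspose (hcomm s⁻¹)
    simp only [Matrix.conjTranspose_mul, Matrix.conjTranspose_conjTranspose,
      permQubits_conjTranspose, inv_inv] at this
    simp only [Matrix.mul_assoc] at this ⊢
    exact this.symm
  · intro x y hxy
    have : x = fun t => y (s⁻¹ t) := by
      by_contra hne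
      exact hxy (by simp only [permQubits, Matrix.of_apply, if_neg hne])
    rw [this, weight_perm]

theorem multMatrix_one (hS : IsSpinBasis S) (l : Fin (n / 2 + 1)) : multMatrix S l 1 = 1 := by
  ext m m'
  rw [multMatrix, Matrix.of_apply, permQubits_one, Matrix.mul_one, hS.mul_conjTranspose]
  simp [Matrix.one_apply]

theorem multMatrix_mul (hS : IsSpinBasis S) (l : Fin (n / 2 + 1)) (s s' : Equiv.Perm (Fin n)) :
    multMatrix S l (s * s') = multMatrix S l s * multMatrix S l s' := by
  ext m m'
  rw [multMatrix, Matrix.of_apply, permQubits_mul, hS.conj_mul, hS.conj_permQubits,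
    hS.conj_permQubits, multOp, multOp, ← Matrix.blockDiagonal'_mul, Matrix.blockDiagonal'_apply_eq,
    ← Matrix.mul_kronecker_mul]
  simp [multMatrix]

theorem multMatrix_conjTranspose (l : Fin (n / 2 + 1)) (s : Equiv.Perm (Fin n)) :
    (multMatrix S l s)ᴴ = multMatrix S l s⁻¹ := by
  ext m m'
  have : S * permQubits n s⁻¹ * Sᴴ = (S * permQubits n s * Sᴴ)ᴴ := by
    simp only [Matrix.conjTranspose_mul, Matrix.conjTranspose_conjTranspose,
      permQubits_conjTranspose, Matrix.mul_assoc]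
  rw [multMatrix, multMatrix, this]
  rfl

end IsSpinBasis

variable (Mult) in
/-- The embedding of the multiplicity space as the copy of `P_λ` spanned by the states `i` of
`Q_λ`. -/
noncomputable def multEmbed (l : Fin (n / 2 + 1)) (i : Fin (n - 2 * (l : ℕ) + 1)) :
    Matrix (SchurLabel n Mult) (Mult l) ℂ :=
  placement fun m => (⟨l, m, i⟩ : SchurLabel n Mult)

theorem multEmbed_apply (l : Fin (n / 2 + 1)) (i : Fin (n - 2 * (l : ℕ) + 1))
    (r : SchurLabel n Mult) (m : Mult l) :
    multEmbed Mult l i r m = if r = ⟨l, m, i⟩ then 1 else 0 := rfl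

theorem multEmbed_isometry (l : Fin (n / 2 + 1)) (i : Fin (n - 2 * (l : ℕ) + 1)) :
    (multEmbed Mult l i)ᴴ * multEmbed Mult l i = 1 :=
  placement_isometry fun m m' h => by simpa using h

theorem multOp_mul_multEmbed (p : ∀ l, Matrix (Mult l) (Mult l) ℂ) (l : Fin (n / 2 + 1))
    (i : Fin (n - 2 * (l : ℕ) + 1)) :
    multOp p * multEmbed Mult l i = multEmbed Mult l i * p l := by
  ext ⟨l', m', i'⟩ m
  rw [multEmbed, mul_placement_apply, Matrix.mul_apply, multOp]
  by_cases hl : l' = l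
  · subst hl
    rw [Matrix.blockDiagonal'_apply_eq, Matrix.kroneckerMap_apply, Matrix.one_apply]
    by_cases hi : i' = i
    · subst hi
      simp [placement]
    · simp [placement, hi]
  · rw [Matrix.blockDiagonal'_apply_ne _ _ _ hl]
    simp [placement, hl]

theorem multEmbed_mul_multOp (p : ∀ l, Matrix (Mult l) (Mult l) ℂ) (l : Fin (n / 2 + 1))
    (i : Fin (n - 2 * (l : ℕ) + 1)) :
    (multEmbed Mult l i)ᴴ * multOp p = p l * (multEmbed Mult l i)ᴴ := by
  have h := congr_arg Matrix.conjTranspose (multOp_mul_multEmbed (fun l => (p l)ᴴ) l i)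
  rw [Matrix.conjTranspose_mul, Matrix.conjTranspose_mul, multOp, Matrix.blockDiagonal'_conjTranspose,
    Matrix.conjTranspose_conjTranspose] at h
  simpa [multOp, Matrix.conjTranspose_kronecker] using h

theorem multEmbed_mul_ne {l l' : Fin (n / 2 + 1)} (h : l ≠ l')
    (i : Fin (n - 2 * (l : ℕ) + 1)) (i' : Fin (n - 2 * (l' : ℕ) + 1)) :
    (multEmbed Mult l i)ᴴ * multEmbed Mult l' i' = 0 := by
  ext m m'
  rw [multEmbed, multEmbed, mul_placement_apply, Matrix.conjTranspose_apply, placement, Matrix.of_apply, if_neg]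
  · simp
  · intro h'
    exact h (congr_arg Sigma.fst h').symm

/-- The state of `Q_λ`, `λ = (n - l, l)`, in the weight space of weight `w`. -/
def weightIndex (l w : Fin (n / 2 + 1)) : Fin (n - 2 * (l : ℕ) + 1) :=
  ⟨w - l, by omega⟩

namespace IsSpinBasis

variable {S : Matrix (SchurLabel n Mult) (Fin n → Fin 2) ℂ}

/-- Conjugation by `S` carries the orbital description of the commutant over to the Schur basis;
what matters is that `w + 1` matrices suffice. -/
theorem mem_span_of_commute (hS : IsSpinBasis S) {w : ℕ} {Y : Matrix (SchurLabel n Mult) (SchurLabel n Mult) ℂ}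
    (hY : ∀ s, Y * (S * permQubits n s * Sᴴ) = S * permQubits n s * Sᴴ * Y)
    (hw : ∀ r r', Y r r' ≠ 0 → (r.1 : ℕ) + (r.2.2 : ℕ) = w ∧ (r'.1 : ℕ) + (r'.2.2 : ℕ) = w) :
    Y ∈ Submodule.span ℂ (Set.range fun o : Fin (w + 1) => S * orbital n w o * Sᴴ) := by
  let f : Matrix (Fin n → Fin 2) (Fin n → Fin 2) ℂ →ₗ[ℂ]
      Matrix (SchurLabel n Mult) (SchurLabel n Mult) ℂ :=
    { toFun := fun A => S * A * Sᴴ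
      map_add' := fun A B => by rw [Matrix.mul_add, Matrix.add_mul]
      map_smul' := fun c A => by simp }
  have hYf : f (Sᴴ * Y * S) = Y := by
    change S * (Sᴴ * Y * S) * Sᴴ = Y
    calc S * (Sᴴ * Y * S) * Sᴴ = (S * Sᴴ) * Y * (S * Sᴴ) := by simp only [Matrix.mul_assoc]
      _ = Y := by rw [hS.mul_conjTranspose, Matrix.one_mul, Matrix.mul_one]
  have hmem : Sᴴ * Y * S ∈ Submodule.span ℂ (Set.range fun o : Fin (w + 1) => orbital n w o) := by
    refine mem_span_orbital (fun s => ?_) fun x y hxy => ?_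
    · have h1 := congr_arg (fun Z => Sᴴ * Z * S) (hY s)
      calc Sᴴ * Y * S * permQubits n s
          = Sᴴ * Y * S * permQubits n s * (Sᴴ * S) := by rw [hS.conjTranspose_mul, Matrix.mul_one]
        _ = Sᴴ * (Y * (S * permQubits n s * Sᴴ)) * S := by simp only [Matrix.mul_assoc]
        _ = (Sᴴ * S) * permQubits n s * (Sᴴ * Y * S) := by rw [hY]; simp only [Matrix.mul_assoc]
        _ = _ := by rw [hS.conjTranspose_mul, Matrix.one_mul]
    · rw [Matrix.mul_apply] at hxy
      obtain ⟨r', -, hr'⟩ := Finset.exists_ne_zero_of_sum_ne_zero hxy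
      have h' := left_ne_zero_of_mul hr'
      rw [Matrix.mul_apply] at h'
      obtain ⟨r, -, hr⟩ := Finset.exists_ne_zero_of_sum_ne_zero h'
      have h1 := hw _ _ (right_ne_zero_of_mul hr)
      have h2 := hS.weight_eq _ _ (right_ne_zero_of_mul hr')
      have h3 := hS.weight_eq r x (by
        have := left_ne_zero_of_mul hr
        rw [Matrix.conjTranspose_apply] at this
        exact fun h0 => this (by rw [h0, star_zero]))
      exact ⟨h3.trans h1.1, h2.trans h1.2⟩
  have h2 := Submodule.mem_map_of_mem (f := f) hmem
  rw [hYf, Submodule.map_span, ← Set.range_comp] at h2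
  exact h2

/-- The matrix of an intertwiner between multiplicity spaces, placed in a weight space. -/
theorem place_intertwiner_mem_span (hS : IsSpinBasis S) {l l' w : Fin (n / 2 + 1)} (hl : l ≤ w) (hl' : l' ≤ w)
    {Φ : Matrix (Mult l) (Mult l') ℂ} (hΦ : ∀ s, multMatrix S l s * Φ = Φ * multMatrix S l' s) :
    multEmbed Mult l (weightIndex l w) * Φ * (multEmbed Mult l' (weightIndex l' w))ᴴ ∈
      Submodule.span ℂ (Set.range fun o : Fin ((w : ℕ) + 1) => S * orbital n w o * Sᴴ) := by
  refine hS.mem_span_of_commute (fun s => ?_) fun r r' h => ?_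
  · rw [hS.conj_permQubits, Matrix.mul_assoc, multEmbed_mul_multOp, ← Matrix.mul_assoc,
      Matrix.mul_assoc _ Φ, ← hΦ, ← Matrix.mul_assoc, ← Matrix.mul_assoc,
      ← Matrix.mul_assoc, multOp_mul_multEmbed]
  · rw [Matrix.mul_apply] at h
    obtain ⟨m', -, h'⟩ := Finset.exists_ne_zero_of_sum_ne_zero h
    have h1 := left_ne_zero_of_mul h'
    rw [Matrix.mul_apply] at h1
    obtain ⟨m, -, h2⟩ := Finset.exists_ne_zero_of_sum_ne_zero h1
    have h3 := left_ne_zero_of_mul h2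
    have h4 := right_ne_zero_of_mul h'
    have e1 : r = ⟨l, m, weightIndex l w⟩ := by
      by_contra hne
      exact h3 (by simp [multEmbed_apply, hne])
    have e2 : r' = ⟨l', m', weightIndex l' w⟩ := by
      by_contra hne
      exact h4 (by simp [multEmbed_apply, hne])
    rw [e1, e2]
    have : (l : ℕ) ≤ w := hl
    have : (l' : ℕ) ≤ w := hl'
    simp only [weightIndex]
    omega

variable [∀ l, Nonempty (Mult l)]

/-- The dimension count behind Schur's lemma. The weight space `w` contains one copy of each `P_a`
with `a ≤ w`. The `w + 1` projections onto these copies are independent in a span of dimension at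
most `w + 1`, so they exhaust it. An intertwiner, placed in this weight space, is a combination of
them. -/
theorem exists_intertwiner_eq_sum (hS : IsSpinBasis S) {l l' w : Fin (n / 2 + 1)} (hl : l ≤ w) (hl' : l' ≤ w)
    {Φ : Matrix (Mult l) (Mult l') ℂ} (hΦ : ∀ s, multMatrix S l s * Φ = Φ * multMatrix S l' s) :
    ∃ c : Finset.Iic w → ℂ, Φ = ∑ a : Finset.Iic w, c a •
      (((multEmbed Mult l (weightIndex l w))ᴴ * multEmbed Mult a (weightIndex a w)) *
        ((multEmbed Mult a (weightIndex a w))ᴴ *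
          multEmbed Mult l' (weightIndex l' w))) := by
  set Y : Finset.Iic w → Matrix (SchurLabel n Mult) (SchurLabel n Mult) ℂ := fun a =>
    multEmbed Mult a (weightIndex a w) *
      (multEmbed Mult a (weightIndex a w))ᴴ with hYdef
  set N : Fin ((w : ℕ) + 1) → Matrix (SchurLabel n Mult) (SchurLabel n Mult) ℂ :=
    fun o => S * orbital n w o * Sᴴ
  have hYN : Submodule.span ℂ (Set.range Y) ≤ Submodule.span ℂ (Set.range N) := by
    rw [Submodule.span_le]
    rintro _ ⟨a, rfl⟩
    have ha : (a : Fin _) ≤ w := Finset.mem_Iic.1 a.2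
    have := hS.place_intertwiner_mem_span ha ha (Φ := 1) fun s => by
      rw [Matrix.mul_one, Matrix.one_mul]
    rwa [Matrix.mul_one] at this
  have hind : LinearIndependent ℂ Y := by
    rw [Fintype.linearIndependent_iff]
    intro g hg a
    -- Independence needs each projection to be nonzero, hence each multiplicity space to be
    -- nonempty.
    obtain ⟨m⟩ := (inferInstance : Nonempty (Mult (a : Fin _)))
    have h1 := congr_fun (congr_fun hg ⟨a, m, weightIndex a w⟩)
      ⟨a, m, weightIndex a w⟩
    rw [Matrix.sum_apply, Finset.sum_eq_single a] at h1
    · simpa [hYdef, Matrix.mul_apply, multEmbed_apply] using h1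
    · intro b _ hb
      rw [Matrix.smul_apply, hYdef]
      simp only
      rw [Matrix.mul_apply, Finset.sum_eq_zero, smul_zero]
      intro m' _
      rw [multEmbed_apply, if_neg, zero_mul]
      intro h
      exact hb (Subtype.ext (congr_arg Sigma.fst h).symm)
    · simp
  have heq : Submodule.span ℂ (Set.range Y) = Submodule.span ℂ (Set.range N) := by
    refine Submodule.eq_of_le_of_finrank_le hYN ?_
    rw [finrank_span_eq_card hind]
    refine (finrank_range_le_card N).trans ?_
    rw [Fintype.card_coe, Fin.card_Iic, Fintype.card_fin]
  have hmem := hS.place_intertwiner_mem_span hl hl' hΦ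
  change _ ∈ Submodule.span ℂ (Set.range N) at hmem
  rw [← heq, Submodule.mem_span_range_iff_exists_fun] at hmem
  obtain ⟨c, hc⟩ := hmem
  refine ⟨c, ?_⟩
  have h1 := multEmbed_isometry (Mult := Mult) l (weightIndex l w)
  have h2 := multEmbed_isometry (Mult := Mult) l' (weightIndex l' w)
  calc Φ = ((multEmbed Mult l (weightIndex l w))ᴴ * multEmbed Mult l (weightIndex l w)) *
        Φ * ((multEmbed Mult l' (weightIndex l' w))ᴴ *
          multEmbed Mult l' (weightIndex l' w)) := by
        rw [h1, h2, Matrix.one_mul, Matrix.mul_one]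
    _ = (multEmbed Mult l (weightIndex l w))ᴴ * (∑ a, c a • Y a) *
          multEmbed Mult l' (weightIndex l' w) := by
        rw [hc]
        simp only [Matrix.mul_assoc]
    _ = _ := by
        rw [Matrix.mul_sum, Matrix.sum_mul]
        refine Finset.sum_congr rfl fun a _ => ?_
        simp only [hYdef, Matrix.mul_smul, Matrix.smul_mul, Matrix.mul_assoc]

/-- Schur's lemma for the multiplicity spaces: distinct ones have no intertwiners. -/
theorem intertwiner_eq_zero (hS : IsSpinBasis S) {l l' : Fin (n / 2 + 1)} (hll : l ≠ l') {Φ : Matrix (Mult l) (Mult l') ℂ}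
    (hΦ : ∀ s, multMatrix S l s * Φ = Φ * multMatrix S l' s) : Φ = 0 := by
  -- The weight `max l l'` is the first at which both irreps occur. No projection connects distinct
  -- copies, so every term vanishes.
  obtain ⟨c, hc⟩ := hS.exists_intertwiner_eq_sum (le_max_left l l') (le_max_right l l') hΦ
  rw [hc]
  refine Finset.sum_eq_zero fun a _ => ?_
  by_cases ha : l = a
  · rw [multEmbed_mul_ne (show (a : Fin _) ≠ l' from fun h => hll (ha.trans h)), Matrix.mul_zero,
      smul_zero]
  · rw [multEmbed_mul_ne ha, Matrix.zero_mul, smul_zero]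

/-- Schur's lemma for the multiplicity spaces: self-intertwiners are scalars. -/
theorem intertwiner_eq_smul (hS : IsSpinBasis S) {l : Fin (n / 2 + 1)} {Φ : Matrix (Mult l) (Mult l) ℂ}
    (hΦ : ∀ s, multMatrix S l s * Φ = Φ * multMatrix S l s) : ∃ c : ℂ, Φ = c • 1 := by
  obtain ⟨c, hc⟩ := hS.exists_intertwiner_eq_sum (le_refl l) (le_refl l) hΦ
  refine ⟨c ⟨l, by simp⟩, ?_⟩
  rw [hc, Finset.sum_eq_single ⟨l, by simp⟩]
  · rw [multEmbed_isometry, Matrix.mul_one]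
  · intro a _ ha
    rw [multEmbed_mul_ne (fun h => ha (Subtype.ext h.symm)), Matrix.zero_mul, smul_zero]
  · simp

end IsSpinBasis

end SchurWeyl

/-! ### The action of `U(2)` and irreducibility of the `Q_λ` -/

section SchurWeyl

/-- The rotation by the angle `t` about the `y` axis. -/
noncomputable def rotation (t : ℝ) : Matrix.unitaryGroup (Fin 2) ℂ :=
  ⟨!![(Real.cos t : ℂ), -(Real.sin t : ℂ); (Real.sin t : ℂ), (Real.cos t : ℂ)], by
    have h : (Real.cos t : ℂ) * (Real.cos t : ℂ) + (Real.sin t : ℂ) * (Real.sin t : ℂ) = 1 := by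
      norm_cast
      linear_combination Real.cos_sq_add_sin_sq t
    rw [Matrix.mem_unitaryGroup_iff, Matrix.star_eq_conjTranspose]
    ext i j
    fin_cases i <;> fin_cases j <;>
      simp only [Matrix.mul_apply, Fin.sum_univ_two, Matrix.conjTranspose_apply] <;>
      simp [-Complex.ofReal_cos, -Complex.ofReal_sin, Complex.conj_ofReal] <;>
      first | linear_combination h | ring⟩

/-- The diagonal unitary with entries `1` and `w`. -/
noncomputable def phaseGate (w : ℂ) (hw : ‖w‖ = 1) : Matrix.unitaryGroup (Fin 2) ℂ :=
  ⟨Matrix.diagonal ![1, w], by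
    rw [Matrix.mem_unitaryGroup_iff, Matrix.star_eq_conjTranspose, Matrix.diagonal_conjTranspose,
      Matrix.diagonal_mul_diagonal, ← Matrix.diagonal_one]
    congr 1
    ext i
    fin_cases i
    · simp
    · simp [Complex.mul_conj, Complex.normSq_eq_norm_sq, hw]⟩

/-- By the product rule the derivative at `0` is a sum over positions of the one-qubit generator,
`J^- - J^+`. This is the only link between the group `U(2)` and the ladder operators. -/
theorem hasDerivAt_tensorPower_rotation {n : ℕ} (x y : Fin n → Fin 2) :
    HasDerivAt (fun t : ℝ => tensorPower n (rotation t) x y)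
      ((lowTotal n - (lowTotal n)ᴴ) x y) 0 := by
  have hentry : ∀ a b : Fin 2, HasDerivAt
      (fun t : ℝ => (rotation t : Matrix (Fin 2) (Fin 2) ℂ) a b)
      ((if b = 0 ∧ a = 1 then 1 else 0) - (if a = 0 ∧ b = 1 then 1 else 0) : ℂ) 0 := by
    have hc := (Real.hasDerivAt_cos 0).ofReal_comp
    have hs := (Real.hasDerivAt_sin 0).ofReal_comp
    intro a b
    fin_cases a <;> fin_cases b
    · simpa [rotation] using! hc
    · simpa [rotation] using! hs.neg
    · simpa [rotation] using! hs
    · simpa [rotation] using! hc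
  have h := HasDerivAt.fun_finsetProd (u := Finset.univ) fun t (_ : t ∈ Finset.univ) =>
    hentry (x t) (y t)
  refine h.congr_deriv ?_
  have h0 : ∀ a b : Fin 2, (rotation 0 : Matrix (Fin 2) (Fin 2) ℂ) a b = if a = b then 1 else 0 := by
    intro a b
    fin_cases a <;> fin_cases b <;> simp [rotation]
  have hsingle : ∀ (x y : Fin n → Fin 2) (t : Fin n),
      (∏ j ∈ Finset.univ.erase t, if x j = y j then (1 : ℂ) else 0) *
        (if y t = 0 ∧ x t = 1 then 1 else 0) =
      if y t = 0 ∧ x = Function.update y t 1 then 1 else 0 := by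
    intro x y t
    by_cases hx : x = Function.update y t 1
    · have : ∏ j ∈ Finset.univ.erase t, (if x j = y j then (1 : ℂ) else 0) = 1 :=
        Finset.prod_eq_one fun j hj => by
          rw [hx, Function.update_of_ne (Finset.ne_of_mem_erase hj), if_pos rfl]
      rw [this, one_mul]
      refine if_congr ?_ rfl rfl
      simp [hx]
    · rw [if_neg (show ¬(y t = 0 ∧ x = Function.update y t 1) from fun h => hx h.2)]
      by_cases ht : y t = 0 ∧ x t = 1
      · obtain ⟨j, hj⟩ := Function.ne_iff.1 hx
        have hjt : j ≠ t := by
          rintro rfl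
          exact hj (by simp [ht.2])
        rw [Function.update_of_ne hjt] at hj
        rw [Finset.prod_eq_zero (Finset.mem_erase.2 ⟨hjt, Finset.mem_univ j⟩) (if_neg hj), zero_mul]
      · rw [if_neg ht, mul_zero]
  simp only [h0, smul_eq_mul, mul_sub, Finset.sum_sub_distrib, hsingle]
  simp only [Matrix.sub_apply, Matrix.conjTranspose_apply, lowTotal, Matrix.of_apply, star_sum,
    apply_ite (star : ℂ → ℂ), star_one, star_zero]
  congr 1
  refine Finset.sum_congr rfl fun t _ => ?_
  rw [← hsingle y x t]
  congr 1
  refine Finset.prod_congr rfl fun j _ => if_congr eq_comm rfl rfl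

variable {n : ℕ} {Mult : Fin (n / 2 + 1) → Type} [∀ l, Fintype (Mult l)]
  [∀ l, DecidableEq (Mult l)] [∀ l, Nonempty (Mult l)]

/-- Operators acting on the irreps of `U(2)` only. -/
noncomputable def irrepOp (Mult : Fin (n / 2 + 1) → Type) [∀ l, DecidableEq (Mult l)]
    (q : ∀ l : Fin (n / 2 + 1), Matrix (Fin (n - 2 * (l : ℕ) + 1)) (Fin (n - 2 * (l : ℕ) + 1)) ℂ) :
    Matrix (SchurLabel n Mult) (SchurLabel n Mult) ℂ :=
  Matrix.blockDiagonal' fun l => (1 : Matrix (Mult l) (Mult l) ℂ) ⊗ₖ q l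

/-- The block of `S A S†` on the copy of `Q_λ` with a fixed multiplicity label. -/
noncomputable def irrepMatrix (S : Matrix (SchurLabel n Mult) (Fin n → Fin 2) ℂ)
    (A : Matrix (Fin n → Fin 2) (Fin n → Fin 2) ℂ) (l : Fin (n / 2 + 1)) :
    Matrix (Fin (n - 2 * (l : ℕ) + 1)) (Fin (n - 2 * (l : ℕ) + 1)) ℂ :=
  Matrix.of fun i i' =>
    (S * A * Sᴴ) ⟨l, Classical.arbitrary _, i⟩ ⟨l, Classical.arbitrary _, i'⟩

namespace IsSpinBasis

variable {S : Matrix (SchurLabel n Mult) (Fin n → Fin 2) ℂ}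

/-- The commutant of the permutations acts on the irreps of `U(2)` only. -/
theorem conj_of_commute (hS : IsSpinBasis S) {A : Matrix (Fin n → Fin 2) (Fin n → Fin 2) ℂ}
    (hA : ∀ s, A * permQubits n s = permQubits n s * A) :
    S * A * Sᴴ = irrepOp Mult fun l => irrepMatrix S A l := by
  set X := S * A * Sᴴ with hX
  have hcomm : ∀ s, X * multOp (fun l => multMatrix S l s) =
      multOp (fun l => multMatrix S l s) * X := by
    intro s
    rw [← hS.conj_permQubits, hX, ← hS.conj_mul, ← hS.conj_mul, hA]
  -- Every block of `X` between two copies of multiplicity spaces is an intertwiner, so it is zero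
  -- or, for equal `l`, a scalar. These scalars are the entries of the action on `Q_λ`.
  have hinter : ∀ (l l' : Fin (n / 2 + 1)) (i : Fin (n - 2 * (l : ℕ) + 1))
      (i' : Fin (n - 2 * (l' : ℕ) + 1)) (s : Equiv.Perm (Fin n)),
      multMatrix S l s * ((multEmbed Mult l i)ᴴ * X * multEmbed Mult l' i') =
        ((multEmbed Mult l i)ᴴ * X * multEmbed Mult l' i') * multMatrix S l' s := by
    intro l l' i i' s
    calc _ = (multMatrix S l s * (multEmbed Mult l i)ᴴ) * X * multEmbed Mult l' i' := by
          simp only [Matrix.mul_assoc]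
      _ = (multEmbed Mult l i)ᴴ * (multOp (fun l => multMatrix S l s) * X) *
            multEmbed Mult l' i' := by
          rw [← multEmbed_mul_multOp fun l => multMatrix S l s]
          simp only [Matrix.mul_assoc]
      _ = (multEmbed Mult l i)ᴴ * X * (multOp (fun l => multMatrix S l s) *
            multEmbed Mult l' i') := by
          rw [← hcomm]
          simp only [Matrix.mul_assoc]
      _ = _ := by
          rw [multOp_mul_multEmbed]
          simp only [Matrix.mul_assoc]
  have hent : ∀ (l l' : Fin (n / 2 + 1)) (i : Fin (n - 2 * (l : ℕ) + 1))
      (i' : Fin (n - 2 * (l' : ℕ) + 1)) (m : Mult l) (m' : Mult l'),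
      ((multEmbed Mult l i)ᴴ * X * multEmbed Mult l' i') m m' = X ⟨l, m, i⟩ ⟨l', m', i'⟩ := by
    intro l l' i i' m m'
    rw [multEmbed, multEmbed, mul_placement_apply, placement_conjTranspose_mul_apply]
  ext ⟨l, m, i⟩ ⟨l', m', i'⟩
  rw [irrepOp, ← hent]
  by_cases hl : l = l'
  · subst hl
    obtain ⟨c, hc⟩ := hS.intertwiner_eq_smul (hinter l l i i')
    rw [Matrix.blockDiagonal'_apply_eq, Matrix.kroneckerMap_apply, irrepMatrix, Matrix.of_apply,
      ← hX, ← hent, hc]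
    simp [Matrix.one_apply]
  · rw [Matrix.blockDiagonal'_apply_ne _ _ _ hl, hS.intertwiner_eq_zero hl (hinter l l' i i')]
    rfl

theorem irrepMatrix_one (hS : IsSpinBasis S) (l : Fin (n / 2 + 1)) : irrepMatrix S 1 l = 1 := by
  ext i i'
  rw [irrepMatrix, Matrix.of_apply, Matrix.mul_one, hS.mul_conjTranspose]
  simp [Matrix.one_apply]

theorem irrepMatrix_mul (hS : IsSpinBasis S) {A B : Matrix (Fin n → Fin 2) (Fin n → Fin 2) ℂ}
    (hA : ∀ s, A * permQubits n s = permQubits n s * A)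
    (hB : ∀ s, B * permQubits n s = permQubits n s * B) (l : Fin (n / 2 + 1)) :
    irrepMatrix S (A * B) l = irrepMatrix S A l * irrepMatrix S B l := by
  ext i i'
  rw [irrepMatrix, Matrix.of_apply, hS.conj_mul, hS.conj_of_commute hA, hS.conj_of_commute hB,
    irrepOp, irrepOp, ← Matrix.blockDiagonal'_mul, Matrix.blockDiagonal'_apply_eq,
    ← Matrix.mul_kronecker_mul]
  simp

theorem irrepMatrix_conjTranspose (A : Matrix (Fin n → Fin 2) (Fin n → Fin 2) ℂ)
    (l : Fin (n / 2 + 1)) : (irrepMatrix S A l)ᴴ = irrepMatrix S Aᴴ l := by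
  ext i i'
  have : S * Aᴴ * Sᴴ = (S * A * Sᴴ)ᴴ := by
    simp only [Matrix.conjTranspose_mul, Matrix.conjTranspose_conjTranspose, Matrix.mul_assoc]
  rw [irrepMatrix, irrepMatrix, this]
  rfl

/-- A diagonal `U` acts on a bit string through its weight alone, and row `(l, m, i)` of `S` is
supported on weight `l + i`. -/
theorem irrepMatrix_diagonal (hS : IsSpinBasis S) {U : Matrix.unitaryGroup (Fin 2) ℂ} {z w : ℂ}
    (hU : (U : Matrix (Fin 2) (Fin 2) ℂ) = Matrix.diagonal ![z, w]) (l : Fin (n / 2 + 1)) :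
    irrepMatrix S (tensorPower n U) l = Matrix.diagonal fun i : Fin (n - 2 * (l : ℕ) + 1) =>
      z ^ (n - (l : ℕ) - (i : ℕ)) * w ^ ((l : ℕ) + (i : ℕ)) := by
  have hT : tensorPower n U = Matrix.diagonal fun x => z ^ (n - weight x) * w ^ weight x := by
    ext x y
    rw [tensorPower, Matrix.of_apply, hU]
    by_cases h : x = y
    · subst h
      rw [Matrix.diagonal_apply_eq]
      have h1 : ∀ t, Matrix.diagonal ![z, w] (x t) (x t) = z ^ (1 - (x t : ℕ)) * w ^ (x t : ℕ) := by
        intro t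
        generalize x t = a
        fin_cases a <;> simp
      simp only [h1, Finset.prod_mul_distrib, Finset.prod_pow_eq_pow_sum]
      congr 2
      rw [weight, eq_tsub_iff_add_eq_of_le, ← Finset.sum_add_distrib]
      · have h2 : ∀ t, 1 - (x t : ℕ) + (x t : ℕ) = 1 := fun t => by have := (x t).2; omega
        simp [h2]
      · calc ∑ t, (x t : ℕ) ≤ ∑ _t : Fin n, 1 := Finset.sum_le_sum fun t _ => by
              have := (x t).2; omega
          _ = n := by simp
    · obtain ⟨t, ht⟩ := Function.ne_iff.1 h
      rw [Matrix.diagonal_apply_ne _ h]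
      exact Finset.prod_eq_zero (Finset.mem_univ t) (Matrix.diagonal_apply_ne _ ht)
  have hST : S * tensorPower n U = (Matrix.diagonal fun r : SchurLabel n Mult =>
      z ^ (n - (r.1 : ℕ) - (r.2.2 : ℕ)) * w ^ ((r.1 : ℕ) + (r.2.2 : ℕ))) * S := by
    ext r x
    rw [hT, Matrix.mul_diagonal, Matrix.diagonal_mul, mul_comm]
    by_cases h : S r x = 0
    · rw [h, mul_zero, mul_zero]
    · rw [hS.weight_eq r x h, Nat.sub_sub]
  ext i i'
  rw [irrepMatrix, Matrix.of_apply, hST, Matrix.mul_assoc, hS.mul_conjTranspose, Matrix.mul_one,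
    Matrix.diagonal_apply, Matrix.diagonal_apply]
  refine if_congr ?_ rfl rfl
  simp

/-- If the entry vanished for all angles, so would its derivative at `0`, which is a nonzero
lowering coefficient. -/
theorem exists_rotation_ne_zero (hS : IsSpinBasis S) (l : Fin (n / 2 + 1)) (i : ℕ)
    (hi : i + 1 < n - 2 * (l : ℕ) + 1) :
    ∃ t : ℝ, irrepMatrix S (tensorPower n (rotation t)) l ⟨i + 1, hi⟩ ⟨i, by omega⟩ ≠ 0 := by
  by_contra! h
  set r : SchurLabel n Mult := ⟨l, Classical.arbitrary _, ⟨i + 1, hi⟩⟩ with hr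
  set r' : SchurLabel n Mult := ⟨l, Classical.arbitrary _, ⟨i, by omega⟩⟩ with hr'
  have hd : HasDerivAt (fun t : ℝ => (S * tensorPower n (rotation t) * Sᴴ) r r')
      ((S * (lowTotal n - (lowTotal n)ᴴ) * Sᴴ) r r') 0 := by
    simp only [Matrix.mul_apply]
    exact HasDerivAt.fun_sum fun y _ => (HasDerivAt.fun_sum fun x _ =>
      (hasDerivAt_tensorPower_rotation x y).const_mul (S r x)).mul_const _
  have h0 : (fun t : ℝ => (S * tensorPower n (rotation t) * Sᴴ) r r') = fun _ => 0 := funext h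
  rw [h0] at hd
  have h1 := hd.unique (hasDerivAt_const (0 : ℝ) (0 : ℂ))
  have h2 : S * (lowTotal n - (lowTotal n)ᴴ) * Sᴴ = lowBlock n Mult - (lowBlock n Mult)ᴴ := by
    rw [← hS.conj_lowTotal]
    simp only [Matrix.conjTranspose_mul, Matrix.conjTranspose_conjTranspose, Matrix.mul_assoc,
      Matrix.sub_mul, Matrix.mul_sub]
  rw [h2, Matrix.sub_apply, Matrix.conjTranspose_apply] at h1
  have e1 : lowBlock n Mult r r' = lowerCoeff (n - 2 * (l : ℕ) + 1) i := by
    simp [lowBlock, hr, hr', Matrix.blockDiagonal'_apply_eq, spinLower_apply]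
  have e2 : lowBlock n Mult r' r = 0 := by
    simp only [lowBlock, hr, hr', Matrix.blockDiagonal'_apply_eq, Matrix.kroneckerMap_apply,
      spinLower_apply]
    rw [if_neg (by omega), mul_zero]
  rw [e1, e2, star_zero, sub_zero] at h1
  exact lowerCoeff_ne_zero hi h1

theorem irrep_commutant (hS : IsSpinBasis S) (l : Fin (n / 2 + 1))
    {Y : Matrix (Fin (n - 2 * (l : ℕ) + 1)) (Fin (n - 2 * (l : ℕ) + 1)) ℂ}
    (hY : ∀ U, irrepMatrix S (tensorPower n U) l * Y = Y * irrepMatrix S (tensorPower n U) l) :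
    ∃ c : ℂ, Y = c • 1 := by
  have hdiag : ∀ i i', i ≠ i' → Y i i' = 0 := by
    intro i i' hne
    -- The exponents `l + i` lie between `0` and `n`, so for a primitive root of order `n + 1` the
    -- phase gate has distinct eigenvalues and its commutant is diagonal.
    have hprim := Complex.isPrimitiveRoot_exp (n + 1) (by omega)
    have hw : ‖Complex.exp (2 * Real.pi * Complex.I / (n + 1 : ℕ))‖ = 1 :=
      hprim.norm'_eq_one (by omega)
    have h := congr_fun (congr_fun (hY (phaseGate _ hw)) i) i'
    rw [hS.irrepMatrix_diagonal (U := phaseGate _ hw) rfl, Matrix.diagonal_mul, Matrix.mul_diagonal,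
      mul_comm] at h
    by_contra h0
    have h1 := mul_left_cancel₀ h0 h
    simp only [one_pow, one_mul] at h1
    have := hprim.pow_inj (by omega) (by omega) h1
    exact hne (Fin.ext (by omega))
  -- A rotation with nonzero entry between neighbouring weights forces the two diagonal entries to
  -- agree.
  have hstep : ∀ (i : ℕ) (h : i < n - 2 * (l : ℕ) + 1), Y ⟨i, h⟩ ⟨i, h⟩ = Y 0 0 := by
    intro i
    induction i with
    | zero => intro h; rfl
    | succ i ih =>
      intro h
      rw [← ih (by omega)]
      obtain ⟨t, ht⟩ := hS.exists_rotation_ne_zero l i h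
      have h1 := congr_fun (congr_fun (hY (rotation t)) ⟨i + 1, h⟩) ⟨i, by omega⟩
      rw [Matrix.mul_apply, Matrix.mul_apply, Finset.sum_eq_single ⟨i, by omega⟩,
        Finset.sum_eq_single ⟨i + 1, h⟩, mul_comm] at h1
      · exact (mul_right_cancel₀ ht h1).symm
      · intro j _ hj
        rw [hdiag _ _ hj.symm, zero_mul]
      · simp
      · intro j _ hj
        rw [hdiag _ _ hj, mul_zero]
      · simp
  refine ⟨Y 0 0, ?_⟩
  ext i i'
  by_cases h : i = i'
  · subst h
    rw [Matrix.smul_apply, Matrix.one_apply_eq, smul_eq_mul, mul_one]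
    exact hstep i i.2
  · rw [hdiag _ _ h, Matrix.smul_apply, Matrix.one_apply_ne h, smul_zero]

/-- A basis adapted to the collective spin operators performs Schur–Weyl duality. -/
theorem isSchurTransform (hS : IsSpinBasis S) : IsSchurTransform n Mult S := by
  refine ⟨hS.mul_conjTranspose, hS.conjTranspose_mul, ?_⟩
  have hq1 : ∀ l, irrepMatrix S (tensorPower n 1) l = 1 := fun l => by
    rw [tensorPower_one, hS.irrepMatrix_one]
  have hqm : ∀ l U V, irrepMatrix S (tensorPower n (U * V)) l =
      irrepMatrix S (tensorPower n U) l * irrepMatrix S (tensorPower n V) l := fun l U V => by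
    rw [tensorPower_mul, hS.irrepMatrix_mul (tensorPower_permQubits U) (tensorPower_permQubits V)]
  let q : ∀ l : Fin (n / 2 + 1),
      Representation ℂ (Matrix.unitaryGroup (Fin 2) ℂ) (Fin (n - 2 * (l : ℕ) + 1) → ℂ) :=
    fun l => matrixRep (fun U => irrepMatrix S (tensorPower n U) l) (hq1 l) (hqm l)
  let p : ∀ l : Fin (n / 2 + 1), Representation ℂ (Equiv.Perm (Fin n)) (Mult l → ℂ) :=
    fun l => matrixRep (multMatrix S l) (hS.multMatrix_one l) (hS.multMatrix_mul l)
  have hq : ∀ l U, LinearMap.toMatrix' (q l U) = irrepMatrix S (tensorPower n U) l :=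
    fun l U => toMatrix'_matrixRep _ _ _ U
  have hp : ∀ l s, LinearMap.toMatrix' (p l s) = multMatrix S l s :=
    fun l s => toMatrix'_matrixRep _ _ _ s
  refine ⟨q, p, fun l => ?_, fun l l' hl => ⟨fun e => ?_⟩, fun l => ?_, fun l l' hl => ⟨fun e => ?_⟩,
    fun l U z w hU => ?_, fun U => ?_, fun s => ?_⟩
  · refine isIrreducible_matrixRep _ _ _ (fun U => ?_) fun Y hY => hS.irrep_commutant l hY
    rw [irrepMatrix_conjTranspose, tensorPower_conjTranspose]
  -- The `Q_λ` are told apart by their dimensions `n - 2 l + 1`.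
  · have h := e.toLinearEquiv.finrank_eq
    simp only [Module.finrank_fin_fun] at h
    exact hl (Fin.ext (by omega))
  · exact isIrreducible_matrixRep _ _ _ (multMatrix_conjTranspose l)
      fun Y hY => hS.intertwiner_eq_smul hY
  · have hint : ∀ s, multMatrix S l' s * LinearMap.toMatrix' e.toLinearEquiv.toLinearMap =
        LinearMap.toMatrix' e.toLinearEquiv.toLinearMap * multMatrix S l s := by
      intro s
      rw [← hp, ← hp, ← LinearMap.toMatrix'_comp, ← LinearMap.toMatrix'_comp]
      congr 1
      refine LinearMap.ext fun v => ?_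
      exact (Representation.IntertwiningMap.isIntertwining _ _ e.toIntertwiningMap s v).symm
    have h0 := hS.intertwiner_eq_zero hl.symm hint
    rw [LinearEquiv.map_eq_zero_iff] at h0
    have hinj := e.toLinearEquiv.injective
    obtain ⟨v, hv⟩ := exists_ne (0 : Mult l → ℂ)
    refine hv (hinj ?_)
    have := congr_arg (fun f : (Mult l → ℂ) →ₗ[ℂ] (Mult l' → ℂ) => f v) h0
    simpa using this
  · rw [hq, hS.irrepMatrix_diagonal hU]
  · simp only [hq]
    have h := hS.conj_of_commute (tensorPower_permQubits U)
    rw [irrepOp] at h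
    rw [← h, Matrix.mul_assoc, hS.conjTranspose_mul, Matrix.mul_one]
  · simp only [hp]
    have h := hS.conj_permQubits s
    rw [multOp] at h
    rw [← h, Matrix.mul_assoc, hS.conjTranspose_mul, Matrix.mul_one]

end IsSpinBasis

end SchurWeyl

/-! ### Amplitudes of the iterated Clebsch–Gordan transform -/

section Amplitudes

/-- Whether step `k` added its box to the second row (`1`) or not (`0`), for the state with label `l`
in column `s` after the step. -/
def stepBit (k : ℕ) (s : ℕ → Fin 2) (l : ℕ) : ℕ :=
  if k = 1 then (if l = 0 then 0 else 1) else (s (k - 2) : ℕ)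

theorem stepBit_lt (k : ℕ) (s : ℕ → Fin 2) (l : ℕ) : stepBit k s l < 2 := by
  unfold stepBit
  split_ifs <;> omega

/-- Column `s` holds a copy of the irrep `(m + 1 - l, l)` on `m + 1` qubits. -/
def ValidColumn (s : ℕ → Fin 2) : ℕ → ℕ → Prop
  | 0, l => l = 0
  | m + 1, l => stepBit (m + 1) s l ≤ l ∧ ValidColumn s m (l - stepBit (m + 1) s l) ∧
      (stepBit (m + 1) s l = 1 → 2 * (l - stepBit (m + 1) s l) < m + 1)

/-- The entries of a Clebsch–Gordan transform, extended by zero; `β` selects the multiplet. -/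
noncomputable def cgEntry (C : CGFamily) (a β i : ℕ) (c : Fin (a + 1) × Fin 2) : ℂ :=
  if β = 0 then (if h : i < a + 2 then C a (Sum.inl ⟨i, h⟩) c else 0)
  else if h : i < a then C a (Sum.inr ⟨i, h⟩) c else 0

/-- The coupling of amplitudes `f` of spin `a / 2` with a qubit in the state `b`. -/
noncomputable def couple (C : CGFamily) (a β i : ℕ) (b : Fin 2) (f : ℕ → ℂ) : ℂ :=
  ∑ c : Fin (a + 1), cgEntry C a β i (c, b) * f c

/-- The amplitude, after `m` steps applied to the computational basis state `x`, of the state `i` of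
the irrep `(m + 1 - l, l)` in column `s`. -/
noncomputable def amp (C : CGFamily) (x s : ℕ → Fin 2) : ℕ → ℕ → ℕ → ℂ
  | 0, l, i => if l = 0 ∧ i = (x 0 : ℕ) then 1 else 0
  | m + 1, l, i => if stepBit (m + 1) s l ≤ l then
      couple C (m + 1 - 2 * (l - stepBit (m + 1) s l)) (stepBit (m + 1) s l) i (x (m + 1))
        (amp C x s m (l - stepBit (m + 1) s l)) else 0

theorem stepBit_congr {s s' : ℕ → Fin 2} {m l : ℕ} (h : ∀ w, w + 1 < m + 1 → s w = s' w) :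
    stepBit (m + 1) s l = stepBit (m + 1) s' l := by
  unfold stepBit
  split_ifs with h1 h2
  · rfl
  · rfl
  · rw [h _ (by omega)]

theorem validColumn_congr {s s' : ℕ → Fin 2} {m l : ℕ} (h : ∀ w, w + 1 < m → s w = s' w) :
    ValidColumn s m l ↔ ValidColumn s' m l := by
  induction m generalizing l with
  | zero => rfl
  | succ m ih =>
    rw [ValidColumn, ValidColumn, stepBit_congr h, ih fun w hw => h w (by omega)]

theorem amp_congr (C : CGFamily) {x x' s s' : ℕ → Fin 2} {m : ℕ} (hx : ∀ t, t ≤ m → x t = x' t)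
    (hs : ∀ w, w + 1 < m → s w = s' w) : amp C x s m = amp C x' s' m := by
  induction m with
  | zero =>
    funext l i
    rw [amp, amp, hx 0 le_rfl]
  | succ m ih =>
    funext l i
    rw [amp, amp, stepBit_congr hs, hx (m + 1) le_rfl,
      ih (fun t ht => hx t (by omega)) fun w hw => hs w (by omega)]

theorem ValidColumn.le {s : ℕ → Fin 2} {m l : ℕ} (h : ValidColumn s m l) : 2 * l ≤ m + 1 := by
  induction m generalizing l with
  | zero =>
    rw [ValidColumn] at h
    omega
  | succ m ih =>
    rw [ValidColumn] at h
    have h1 := ih h.2.1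
    have h2 := stepBit_lt (m + 1) s l
    have h3 := h.2.2
    omega

theorem couple_ne_zero {C : CGFamily} {a β i : ℕ} {b : Fin 2} {f : ℕ → ℂ} (hβ : β < 2)
    (h : couple C a β i b f ≠ 0) : i + 2 * β < a + 2 ∧
      ∃ c : Fin (a + 1), cgEntry C a β i (c, b) ≠ 0 ∧ f c ≠ 0 := by
  obtain ⟨c, -, hc⟩ := Finset.exists_ne_zero_of_sum_ne_zero h
  have h1 := left_ne_zero_of_mul hc
  refine ⟨?_, c, h1, right_ne_zero_of_mul hc⟩
  unfold cgEntry at h1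
  split_ifs at h1 <;> first | omega | exact absurd rfl h1

/-- Where an amplitude is nonzero the labels are in range, in particular `2 * l ≤ m + 1`. This makes
the truncated subtractions exact and later shows that nothing falls outside the encoded positions.
-/
theorem amp_support {C : CGFamily} {x s : ℕ → Fin 2} {m l i : ℕ} (h : amp C x s m l i ≠ 0) :
    ValidColumn s m l ∧ i ≤ m + 1 - 2 * l := by
  induction m generalizing l i with
  | zero =>
    rw [amp] at h
    have h1 : l = 0 ∧ i = (x 0 : ℕ) := by
      by_contra h'
      exact h (if_neg h')
    refine ⟨h1.1, ?_⟩
    have := (x 0).2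
    omega
  | succ m ih =>
    rw [amp] at h
    have hb : stepBit (m + 1) s l ≤ l := by
      by_contra h'
      exact h (if_neg h')
    rw [if_pos hb] at h
    obtain ⟨h1, c, -, hc⟩ := couple_ne_zero (stepBit_lt _ _ _) h
    have h2 := (ih hc).1
    have h3 := h2.le
    refine ⟨⟨hb, h2, fun h4 => ?_⟩, ?_⟩ <;> omega

theorem cgEntry_label {C : CGFamily} (hC : ∀ a, IsClebschGordan a (C a)) {a β i : ℕ} (hβ : β < 2)
    {c : Fin (a + 1) × Fin 2} (h : cgEntry C a β i c ≠ 0) : i + β = (c.1 : ℕ) + (c.2 : ℕ) := by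
  unfold cgEntry at h
  split_ifs at h with h1 h2 h2
  · have := (hC a).label_eq h
    simp only [outLabel] at this
    omega
  · exact absurd rfl h
  · have := (hC a).label_eq h
    simp only [outLabel] at this
    omega
  · exact absurd rfl h

theorem amp_weight {C : CGFamily} (hC : ∀ a, IsClebschGordan a (C a)) {x s : ℕ → Fin 2} {m l i : ℕ}
    (h : amp C x s m l i ≠ 0) : ∑ t ∈ Finset.range (m + 1), (x t : ℕ) = l + i := by
  induction m generalizing l i with
  | zero =>
    rw [amp] at h
    have h1 : l = 0 ∧ i = (x 0 : ℕ) := by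
      by_contra h'
      exact h (if_neg h')
    simp [h1.1, h1.2]
  | succ m ih =>
    rw [amp] at h
    have hb : stepBit (m + 1) s l ≤ l := by
      by_contra h'
      exact h (if_neg h')
    rw [if_pos hb] at h
    obtain ⟨-, c, h2, hc⟩ := couple_ne_zero (stepBit_lt _ _ _) h
    have h3 := cgEntry_label hC (stepBit_lt _ _ _) h2
    simp only at h3
    rw [Finset.sum_range_succ, ih hc]
    omega

theorem lowerCoeff_self (d : ℕ) : lowerCoeff (d + 1) d = 0 := by
  simp [lowerCoeff]

/-- The lowering relation survives the extension by zero: just past the end of a multiplet the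
right-hand coefficient is `lowerCoeff (d + 1) d`, which vanishes. -/
theorem cgEntry_lowering {C : CGFamily} (hC : ∀ a, IsClebschGordan a (C a)) {a β : ℕ} (i : ℕ)
    (hβ : β < 2) (c : Fin (a + 1)) (b : Fin 2) :
    (if h : (c : ℕ) + 1 < a + 1 then cgEntry C a β i (⟨c + 1, h⟩, b) * lowerCoeff (a + 1) c else 0) +
        (if b = 0 then cgEntry C a β i (c, 1) else 0) =
      if 1 ≤ i then lowerCoeff (a + 2 - 2 * β) (i - 1) * cgEntry C a β (i - 1) (c, b) else 0 := by
  have hl := (hC a).lowering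
  obtain rfl | rfl : β = 0 ∨ β = 1 := by omega
  · by_cases hi : i < a + 2
    · have h1 := congr_fun (congr_fun hl (Sum.inl ⟨i, hi⟩)) (c, b)
      rw [mul_compLower_apply] at h1
      have h2 : (Matrix.fromBlocks (spinLower (a + 2)) 0 0 (spinLower a) * C a)
          (Sum.inl ⟨i, hi⟩) (c, b) =
            (spinLower (a + 2) * (C a).submatrix Sum.inl id) ⟨i, hi⟩ (c, b) := by
        simp [Matrix.mul_apply]
      rw [h2, spinLower_mul_apply] at h1
      simp only [cgEntry, if_true, hi, dif_pos]
      refine h1.trans ?_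
      by_cases h : 1 ≤ i
      · rw [dif_pos h, if_pos h, dif_pos (by omega)]
        rfl
      · rw [dif_neg h, if_neg h]
    · have h3 : ∀ c, cgEntry C a 0 i c = 0 := fun c => by simp [cgEntry, hi]
      simp only [h3]
      by_cases h : i - 1 < a + 2
      · have : i - 1 = a + 1 := by omega
        simp [this, lowerCoeff_self]
      · simp [cgEntry, h]
  · by_cases hi : i < a
    · have h1 := congr_fun (congr_fun hl (Sum.inr ⟨i, hi⟩)) (c, b)
      rw [mul_compLower_apply] at h1
      have h2 : (Matrix.fromBlocks (spinLower (a + 2)) 0 0 (spinLower a) * C a)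
          (Sum.inr ⟨i, hi⟩) (c, b) =
            (spinLower a * (C a).submatrix Sum.inr id) ⟨i, hi⟩ (c, b) := by
        simp [Matrix.mul_apply]
      rw [h2, spinLower_mul_apply] at h1
      simp only [cgEntry, one_ne_zero, if_false, hi, dif_pos]
      refine h1.trans ?_
      by_cases h : 1 ≤ i
      · rw [dif_pos h, if_pos h, dif_pos (by omega)]
        rfl
      · rw [dif_neg h, if_neg h]
    · have h3 : ∀ c, cgEntry C a 1 i c = 0 := fun c => by simp [cgEntry, hi]
      simp only [h3]
      by_cases h : i - 1 < a
      · by_cases h1 : 1 ≤ i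
        · obtain ⟨a, rfl⟩ : ∃ a', a = a' + 1 := ⟨a - 1, by omega⟩
          have : i - 1 = a := by omega
          simp [this, lowerCoeff_self]
        · simp [h1]
      · simp [cgEntry, h]

theorem sum_fin_shift {a : ℕ} (F : Fin (a + 1) → ℂ) (g : ℕ → ℂ) :
    ∑ c : Fin (a + 1), F c * (if 1 ≤ (c : ℕ) then g (c - 1) else 0) =
      ∑ c : Fin (a + 1), if h : (c : ℕ) + 1 < a + 1 then F ⟨c + 1, h⟩ * g c else 0 := by
  rw [Fin.sum_univ_succ, Fin.sum_univ_castSucc]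
  simp only [Fin.val_zero, Fin.val_succ, Fin.val_castSucc, Fin.val_last]
  simp
  rfl

/-- Summation by parts moves the lowering operator of the first spin from the amplitudes `f` to the
Clebsch–Gordan entries, where the composite relation applies. -/
theorem couple_lowering {C : CGFamily} (hC : ∀ a, IsClebschGordan a (C a)) {a β : ℕ} (i : ℕ)
    (hβ : β < 2) (b : Fin 2) (f : ℕ → ℂ) :
    couple C a β i b (fun c => if 1 ≤ c then lowerCoeff (a + 1) (c - 1) * f (c - 1) else 0) +
        (if b = 0 then couple C a β i 1 f else 0) =
      if 1 ≤ i then lowerCoeff (a + 2 - 2 * β) (i - 1) * couple C a β (i - 1) b f else 0 := by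
  have h1 : couple C a β i b
      (fun c => if 1 ≤ c then lowerCoeff (a + 1) (c - 1) * f (c - 1) else 0) =
      ∑ c : Fin (a + 1), (if h : (c : ℕ) + 1 < a + 1 then
        cgEntry C a β i (⟨c + 1, h⟩, b) * lowerCoeff (a + 1) c else 0) * f c := by
    rw [couple, sum_fin_shift (fun c => cgEntry C a β i (c, b))
      (fun c => lowerCoeff (a + 1) c * f c)]
    refine Finset.sum_congr rfl fun c _ => ?_
    split_ifs <;> ring
  have h2 : (if b = 0 then couple C a β i 1 f else 0) =
      ∑ c : Fin (a + 1), (if b = 0 then cgEntry C a β i (c, 1) else 0) * f c := by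
    split_ifs
    · rfl
    · simp
  rw [h1, h2, ← Finset.sum_add_distrib]
  simp only [← add_mul, cgEntry_lowering hC i hβ]
  split_ifs
  · rw [couple, Finset.mul_sum]
    exact Finset.sum_congr rfl fun c _ => mul_assoc _ _ _
  · simp

theorem couple_zero (C : CGFamily) (a β i : ℕ) (b : Fin 2) {f : ℕ → ℂ} (hf : ∀ c, f c = 0) :
    couple C a β i b f = 0 := by simp [couple, hf]

theorem couple_sum {ι : Type*} (C : CGFamily) (a β i : ℕ) (b : Fin 2) (s : Finset ι)
    (f : ι → ℕ → ℂ) : ∑ t ∈ s, couple C a β i b (f t) =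
      couple C a β i b fun c => ∑ t ∈ s, f t c := by
  simp only [couple, Finset.mul_sum]
  exact Finset.sum_comm

/-- The collective lowering operator acts on the amplitudes in the standard way. -/
theorem amp_lowering {C : CGFamily} (hC : ∀ a, IsClebschGordan a (C a)) (x s : ℕ → Fin 2)
    (m l i : ℕ) :
    ∑ t ∈ Finset.range (m + 1), (if x t = 0 then amp C (Function.update x t 1) s m l i else 0) =
      if 1 ≤ i then lowerCoeff (m + 1 - 2 * l + 1) (i - 1) * amp C x s m l (i - 1) else 0 := by
  induction m generalizing l i with
  | zero =>
    simp only [zero_add, Finset.range_one, Finset.sum_singleton, amp, Function.update_self]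
    by_cases hl : l = 0
    · subst hl
      generalize x 0 = b
      rcases i with _ | _ | _ | i
      · simp
      · fin_cases b <;> norm_num [lowerCoeff]
      · fin_cases b <;> norm_num [lowerCoeff]
      · have := b.2
        simp
        omega
    · simp [hl]
  | succ m ih =>
    by_cases hb : stepBit (m + 1) s l ≤ l
    swap
    · simp [amp, hb]
    have hβ := stepBit_lt (m + 1) s l
    simp only [amp, if_pos hb]
    generalize hβ' : stepBit (m + 1) s l = β at *
    obtain ⟨l', rfl⟩ : ∃ l', l = l' + β := ⟨l - β, by omega⟩
    rw [Nat.add_sub_cancel]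
    -- If this fails, all amplitudes of the previous step vanish; otherwise `m + 1 - 2 * l'` is the
    -- true value of twice the spin.
    by_cases hl : 2 * l' ≤ m + 1
    swap
    · have h0 : ∀ x c, amp C x s m l' c = 0 := fun x c => by
        by_contra h
        exact hl (amp_support h).1.le
      simp [couple_zero, h0]
    have h1 : ∀ t ∈ Finset.range (m + 1),
        (if x t = 0 then couple C (m + 1 - 2 * l') β i (Function.update x t 1 (m + 1))
          (amp C (Function.update x t 1) s m l') else 0) =
        couple C (m + 1 - 2 * l') β i (x (m + 1))
          (fun c => if x t = 0 then amp C (Function.update x t 1) s m l' c else 0) := by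
      intro t ht
      rw [Function.update_of_ne (by have := Finset.mem_range.1 ht; omega)]
      split_ifs
      · rfl
      · rw [couple_zero _ _ _ _ _ fun _ => rfl]
    -- Flipping the newest qubit does not affect earlier amplitudes, so the last summand is the
    -- qubit part of the composite lowering operator.
    have h2 : amp C (Function.update x (m + 1) 1) s m = amp C x s m :=
      amp_congr C (fun t ht => Function.update_of_ne (by omega) _ _) fun _ _ => rfl
    rw [Finset.sum_range_succ, Finset.sum_congr rfl h1, couple_sum, Function.update_self, h2]
    simp only [ih]
    rw [couple_lowering hC i hβ]
    by_cases hi : 1 ≤ i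
    swap
    · rw [if_neg hi, if_neg hi]
    rw [if_pos hi, if_pos hi]
    by_cases hz : couple C (m + 1 - 2 * l') β (i - 1) (x (m + 1)) (amp C x s m l') = 0
    · rw [hz, mul_zero, mul_zero]
    · have := (couple_ne_zero hβ hz).1
      congr 2
      omega

/-! ### Counting columns -/

/-- The last box goes into the first row if `(m - l, l)` is still a partition, otherwise into the
second. The resulting columns make every multiplicity space nonempty, as the dimension count
requires. -/
theorem exists_validColumn (m l : ℕ) (h : 2 * l ≤ m + 1) : ∃ s, ValidColumn s m l := by
  induction m generalizing l with
  | zero => exact ⟨0, by rw [ValidColumn]; omega⟩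
  | succ m ih =>
    have hval : ∀ (s : ℕ → Fin 2) (b : Fin 2) (l : ℕ),
        ValidColumn (Function.update s (m - 1) b) m l ↔ ValidColumn s m l := fun s b l =>
      validColumn_congr fun w hw => Function.update_of_ne (by omega) _ _
    have hbit : ∀ (s : ℕ → Fin 2) (b : Fin 2), (m = 0 → (b : ℕ) = if l = 0 then 0 else 1) →
        stepBit (m + 1) (Function.update s (m - 1) b) l = b := by
      intro s b hb
      unfold stepBit
      by_cases hm : m = 0
      · simp [hm, hb hm]
      · rw [if_neg (by omega), show m + 1 - 2 = m - 1 by omega, Function.update_self]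
    by_cases hl : 2 * l ≤ m + 1
    · obtain ⟨s, hs⟩ := ih l hl
      refine ⟨Function.update s (m - 1) 0, ?_⟩
      rw [ValidColumn, hbit _ _ (fun hm => by simp; omega)]
      simpa [hval] using hs
    · obtain ⟨s, hs⟩ := ih (l - 1) (by omega)
      refine ⟨Function.update s (m - 1) 1, ?_⟩
      rw [ValidColumn, hbit _ _ (fun hm => by simp; omega)]
      simp only [Fin.val_one, hval]
      exact ⟨by omega, hs, fun _ => by omega⟩

open Classical in
/-- The number of states in column `s` after `m` steps. -/
noncomputable def columnDim (N m : ℕ) (s : ℕ → Fin 2) : ℕ :=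
  ∑ l ∈ Finset.range (N + 1), if ValidColumn s m l then m + 1 - 2 * l + 1 else 0

/-- Step `1` creates no **seq** qubit, so the triplet and the singlet share a column: `3 + 1`. -/
theorem columnDim_one {N : ℕ} (hN : 1 ≤ N) (s : ℕ → Fin 2) : columnDim N 1 s = 4 := by
  have h : ∀ l, ValidColumn s 1 l ↔ l ≤ 1 := by
    intro l
    simp only [ValidColumn, stepBit, if_true]
    split_ifs <;> omega
  obtain ⟨N, rfl⟩ : ∃ N', N = N' + 1 := ⟨N - 1, by omega⟩
  unfold columnDim
  rw [Finset.sum_range_succ', Finset.sum_range_succ', Finset.sum_eq_zero]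
  · simp [h]
  · intro l _
    simp [h]

/-- An irrep of dimension `a + 1` splits into dimensions `a + 2` and `a`, one in each of the two
columns that share the earlier bits. -/
theorem columnDim_succ {N m : ℕ} (hm : 1 ≤ m) (hN : m + 1 ≤ N) {s s' : ℕ → Fin 2}
    (h : ∀ w, w + 1 < m → s w = s' w) (hs : s (m - 1) = 0) (hs' : s' (m - 1) = 1) :
    columnDim N (m + 1) s + columnDim N (m + 1) s' = 2 * columnDim N m s := by
  classical
  have h0 : ∀ l, ValidColumn s (m + 1) l ↔ ValidColumn s m l := by
    intro l
    have : stepBit (m + 1) s l = 0 := by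
      rw [stepBit, if_neg (by omega), show m + 1 - 2 = m - 1 by omega, hs]
      rfl
    rw [ValidColumn, this]
    simp
  have h1 : ∀ l, ValidColumn s' (m + 1) l ↔ 1 ≤ l ∧ ValidColumn s m (l - 1) ∧ 2 * (l - 1) < m + 1 := by
    intro l
    have : stepBit (m + 1) s' l = 1 := by
      rw [stepBit, if_neg (by omega), show m + 1 - 2 = m - 1 by omega, hs']
      rfl
    rw [ValidColumn, this, validColumn_congr h]
    simp
  have e0 : columnDim N (m + 1) s =
      ∑ l ∈ Finset.range N, if ValidColumn s m l then m + 2 - 2 * l + 1 else 0 := by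
    unfold columnDim
    rw [Finset.sum_range_succ, if_neg]
    · simp only [h0, add_zero]
    · intro hv
      have := ((h0 N).1 hv).le
      omega
  have e1 : columnDim N (m + 1) s' =
      ∑ l ∈ Finset.range N, if ValidColumn s m l then m + 1 - 2 * l else 0 := by
    unfold columnDim
    rw [Finset.sum_range_succ', if_neg (by simp [h1]), add_zero]
    refine Finset.sum_congr rfl fun l _ => ?_
    simp only [h1, Nat.add_sub_cancel]
    by_cases hv : ValidColumn s m l
    · have := hv.le
      simp only [hv, if_true, true_and]
      split_ifs <;> omega
    · simp [hv]
  have e2 : columnDim N m s =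
      ∑ l ∈ Finset.range N, if ValidColumn s m l then m + 1 - 2 * l + 1 else 0 := by
    unfold columnDim
    rw [Finset.sum_range_succ, if_neg, add_zero]
    intro hv
    have := hv.le
    omega
  rw [e0, e1, e2, ← Finset.sum_add_distrib, Finset.mul_sum]
  refine Finset.sum_congr rfl fun l _ => ?_
  split_ifs with hv
  · have := hv.le
    omega
  · rfl

/-- Extension of a bit string by zeros. -/
def extend {n : ℕ} (x : Fin n → Fin 2) (t : ℕ) : Fin 2 := if h : t < n then x ⟨t, h⟩ else 0

theorem extend_apply {n : ℕ} (x : Fin n → Fin 2) (t : Fin n) : extend x t = x t := by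
  simp [extend]

theorem extend_of_lt {n : ℕ} (x : Fin n → Fin 2) {t : ℕ} (h : t < n) : extend x t = x ⟨t, h⟩ := by
  simp [extend, h]

theorem extend_update {n : ℕ} (x : Fin n → Fin 2) (t : Fin n) (b : Fin 2) :
    extend (Function.update x t b) = Function.update (extend x) t b := by
  funext u
  by_cases hu : u = t
  · subst hu
    rw [extend_apply, Function.update_self, Function.update_self]
  · rw [Function.update_of_ne hu]
    unfold extend
    split_ifs with h
    · rw [Function.update_of_ne fun h' => hu (congr_arg Fin.val h')]
    · rfl

/-- The sum runs over all bits, also those not yet created, so it starts at `4 * 2 ^ (n - 2)`.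
Pairing columns by the new bit shows that each step preserves it. -/
theorem sum_columnDim {n m : ℕ} (hm : 1 ≤ m) (hmn : m + 1 ≤ n) :
    ∑ s : Seq n, columnDim n m (extend s) = 2 ^ n := by
  induction m, hm using Nat.le_induction with
  | base =>
    simp only [columnDim_one (show 1 ≤ n by omega), Finset.sum_const, Finset.card_univ,
      Fintype.card_fun, Fintype.card_fin, smul_eq_mul]
    obtain ⟨k, rfl⟩ : ∃ k, n = k + 2 := ⟨n - 2, by omega⟩
    rw [Nat.add_sub_cancel, pow_add]
    rfl
  | succ m hm ih =>
    have ih := ih (by omega)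
    let w : Fin (n - 2) := ⟨m - 1, by omega⟩
    let flip : Seq n → Seq n := fun s => Function.update s w (1 - s w)
    have hinv : Function.Involutive flip := by
      intro s
      simp only [flip, Function.update_self, Function.update_idem, sub_sub_cancel,
        Function.update_eq_self]
    have hf : ∀ s, columnDim n (m + 1) (extend s) + columnDim n (m + 1) (extend (flip s)) =
        2 * columnDim n m (extend s) := by
      intro s
      have hag : ∀ u, u + 1 < m → extend s u = extend (flip s) u := by
        intro u hu
        rw [extend_update, Function.update_of_ne]
        change u ≠ m - 1
        omega
      have hw : extend s (m - 1) = s w := extend_apply s w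
      have hw' : extend (flip s) (m - 1) = 1 - s w :=
        (extend_apply (flip s) w).trans (Function.update_self _ _ _)
      have hc : columnDim n m (extend (flip s)) = columnDim n m (extend s) := by
        refine Finset.sum_congr rfl fun l _ => ?_
        have hv := validColumn_congr (l := l) hag
        by_cases h : ValidColumn (extend s) m l
        · rw [if_pos h, if_pos (hv.1 h)]
        · rw [if_neg h, if_neg fun h' => h (hv.2 h')]
      rcases (show s w = 0 ∨ s w = 1 by omega) with h | h
      · exact columnDim_succ hm (by omega) hag (by rw [hw, h]) (by rw [hw', h]; rfl)
      · rw [add_comm, ← hc]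
        exact columnDim_succ hm (by omega) (fun u hu => (hag u hu).symm) (by rw [hw', h]; rfl)
          (by rw [hw, h])
    have h1 := Finset.sum_congr (rfl : (Finset.univ : Finset (Seq n)) = _) fun s _ => hf s
    have h2 : ∑ s, columnDim n (m + 1) (extend (flip s)) =
        ∑ s : Seq n, columnDim n (m + 1) (extend s) :=
      Equiv.sum_comp (hinv.toPerm flip) fun s : Seq n => columnDim n (m + 1) (extend s)
    rw [Finset.sum_add_distrib, ← Finset.mul_sum, ih, h2] at h1
    omega

end Amplitudes

/-! ### Evaluation of the recursion -/

section Recursion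

variable {n : ℕ} {C : CGFamily}

/-- The action of one step on a vector supported on the used basis states. -/
theorem sum_step {k : ℕ} (h1 : 1 ≤ k) (hk : k + 1 ≤ n) {π : Equiv.Perm (Work n k)}
    (hπ : IsReordering n k π) {v : Reg n → ℂ} (r : Reg n)
    (hv : ∀ ω : Work n k, v (combine r ω) ≠ 0 → ∃ e, ω = slotPos n k e) :
    ∑ y, (lift n k (permGate π) * lift n k (superCG n k C)) r y * v y =
      ∑ e, if toWork n k r = slotTarget n k e then
        ∑ e', superBlocks C k e e' * v (combine r (slotPos n k e')) else 0 := by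
  have hinj := slotPos_injective h1 hk
  rw [← lift_mul, sum_lift]
  have hcol : ∀ ω e', (permGate π * superCG n k C) ω (slotPos n k e') =
      ∑ e, if ω = slotTarget n k e then superBlocks C k e e' else 0 := by
    intro ω e'
    rw [← mul_placement_apply (permGate π * superCG n k C) (slotPos n k), superCG_eq,
      Matrix.mul_assoc, embedOp_mul_embed (placement_isometry hinj), ← Matrix.mul_assoc,
      Matrix.mul_apply]
    refine Finset.sum_congr rfl fun e _ => ?_
    rw [mul_placement_apply, permGate, Matrix.of_apply, isReordering_iff.1 hπ]
    split_ifs <;> simp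
  have hsum : ∑ ω, (permGate π * superCG n k C) (toWork n k r) ω * v (combine r ω) =
      ∑ e', (permGate π * superCG n k C) (toWork n k r) (slotPos n k e') *
        v (combine r (slotPos n k e')) := by
    rw [← Finset.sum_image (s := Finset.univ) (g := slotPos n k)
      (f := fun ω => (permGate π * superCG n k C) (toWork n k r) ω * v (combine r ω))
      hinj.injOn]
    symm
    refine Finset.sum_subset (Finset.subset_univ _) fun ω _ hω => ?_
    by_contra h
    obtain ⟨e, rfl⟩ := hv ω (right_ne_zero_of_mul h)
    exact hω (Finset.mem_image_of_mem _ (Finset.mem_univ e))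
  rw [hsum]
  simp only [hcol, Finset.sum_mul]
  rw [Finset.sum_comm]
  refine Finset.sum_congr rfl fun e _ => ?_
  split_ifs <;> simp

theorem stepBit_eq_of_toWork {m : ℕ} {r : Reg n} {b : Fin 2} {l : ℕ} (hm : m + 2 ≤ n)
    (hb : (toWork n (m + 1) r).1 = fun _ => b) (h0 : m = 0 → (b : ℕ) = if l = 0 then 0 else 1) :
    stepBit (m + 1) (extend r.1) l = b := by
  unfold stepBit
  by_cases h : m = 0
  · simp [h, h0 h]
  · rw [if_neg (by omega)]
    have := congr_fun hb ⟨⟨m - 1, by omega⟩, by simp only; omega⟩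
    rw [extend_of_lt _ (by omega : m + 1 - 2 < n - 2)]
    exact congr_arg Fin.val this

theorem amp_succ {x s : ℕ → Fin 2} {m l β i : ℕ} (hβ : stepBit (m + 1) s (l + β) = β) :
    amp C x s (m + 1) (l + β) i =
      couple C (m + 1 - 2 * l) β i (x (m + 1)) (amp C x s m l) := by
  rw [amp, hβ, if_pos (by omega), Nat.add_sub_cancel]

/-- One step carries the amplitudes of `m + 1` qubits to those of `m + 2` qubits. -/
theorem step_amp {m : ℕ} (hm : m + 2 ≤ n) {π : Equiv.Perm (Work n (m + 1))}
    (hπ : IsReordering n (m + 1) π) (x : Fin n → Fin 2) {v : Reg n → ℂ} {P : Reg n → Prop}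
    [DecidablePred P] (r : Reg n)
    (hv : ∀ ω : Work n (m + 1), v (combine r ω) ≠ 0 → ∃ e, ω = slotPos n (m + 1) e)
    (hslot : ∀ e : SlotState (m + 1), v (combine r (slotPos n (m + 1) e)) =
      if P r ∧ e.2.2 = extend x (m + 1) then
        amp C (extend x) (extend r.1) m e.1 e.2.1 else 0) :
    ∑ y, (lift n (m + 1) (permGate π) * lift n (m + 1) (superCG n (m + 1) C)) r y * v y =
      if P r then amp C (extend x) (extend r.1) (m + 1) r.2.1 r.2.2 else 0 := by
  rw [sum_step (by omega) hm hπ r hv]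
  -- This decodes a target position: the branch `β` is recovered as the step bit, from the new wire
  -- or, in the first step, from **par**.
  have hout : ∀ (l : Fin ((m + 1) / 2 + 1)) (o : Fin (m + 1 - 2 * (l : ℕ) + 2) ⊕ Fin (m + 1 - 2 * (l : ℕ))),
      toWork n (m + 1) r = outPos n (m + 1) l o →
      ∃ β i : ℕ, β < 2 ∧ (r.2.1 : ℕ) = l + β ∧ (r.2.2 : ℕ) = i ∧
        stepBit (m + 1) (extend r.1) (l + β) = β ∧
        ∀ c, cgEntry C (m + 1 - 2 * (l : ℕ)) β i c = C (m + 1 - 2 * (l : ℕ)) o c := by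
    intro l o ho
    have hl := l.2
    rcases o with i | i
    · have hi := i.2
      simp only [outPos] at ho
      have hp : r.2.1 = Fin.ofNat _ (l : ℕ) := congr_arg (fun ω : Work n (m + 1) => ω.2.1) ho
      have hs : r.2.2 = Fin.ofNat _ (i : ℕ) := congr_arg (fun ω : Work n (m + 1) => ω.2.2) ho
      refine ⟨0, i, by omega, ?_, ?_, ?_, fun c => by simp [cgEntry, hi]⟩
      · rw [hp, val_ofNat_of_lt (par_lt (by omega))]
        rfl
      · rw [hs, val_ofNat_of_lt (stat_lt (by omega))]
      · refine stepBit_eq_of_toWork (b := 0) hm (congr_arg Prod.fst ho) fun h => ?_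
        rw [if_pos (by omega)]
        rfl
    · have hi := i.2
      simp only [outPos] at ho
      have hp : r.2.1 = Fin.ofNat _ ((l : ℕ) + 1) := congr_arg (fun ω : Work n (m + 1) => ω.2.1) ho
      have hs : r.2.2 = Fin.ofNat _ (i : ℕ) := congr_arg (fun ω : Work n (m + 1) => ω.2.2) ho
      refine ⟨1, i, by omega, ?_, ?_, ?_, fun c => by simp [cgEntry, hi]⟩
      · rw [hp, val_ofNat_of_lt (par_lt (by omega))]
      · rw [hs, val_ofNat_of_lt (stat_lt (by omega))]
      · refine stepBit_eq_of_toWork (b := 1) hm (congr_arg Prod.fst ho) fun h => ?_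
        rw [if_neg (by omega)]
        rfl
  by_cases hex : ∃ e, toWork n (m + 1) r = slotTarget n (m + 1) e
  · obtain ⟨⟨l, c⟩, he⟩ := hex
    have hterm : ∀ e, e ≠ ⟨l, c⟩ → ¬ toWork n (m + 1) r = slotTarget n (m + 1) e :=
      fun e hne h => hne (slotTarget_injective (by omega) hm (h.symm.trans he))
    rw [Finset.sum_eq_single ⟨l, c⟩ (fun e _ hne => if_neg (hterm e hne)) (by simp), if_pos he]
    obtain ⟨o, rfl⟩ := (outIndex (m + 1 - 2 * (l : ℕ))).surjective c
    rw [slotTarget] at he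
    simp only [Equiv.symm_apply_apply] at he
    obtain ⟨β, i, hβ, hp, hs, hbit, hC⟩ := hout l o he
    rw [hp, hs, amp_succ hbit, couple, Fintype.sum_sigma, Finset.sum_eq_single l]
    · rw [Fintype.sum_prod_type]
      have hb : ∀ c : Fin (m + 1 - 2 * (l : ℕ) + 1),
          ∑ b, superBlocks C (m + 1) ⟨l, outIndex _ o⟩ ⟨l, c, b⟩ *
            v (combine r (slotPos n (m + 1) ⟨l, c, b⟩)) =
          if P r then cgEntry C (m + 1 - 2 * (l : ℕ)) β i (c, extend x (m + 1)) *
            amp C (extend x) (extend r.1) m l c else 0 := by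
        intro c
        rw [Finset.sum_eq_single (extend x (m + 1))]
        · rw [hslot, superBlocks, Matrix.blockDiagonal'_apply_eq, hC]
          simp
        · intro b _ hb
          rw [hslot, if_neg fun h => hb h.2, mul_zero]
        · simp
      rw [Finset.sum_congr rfl fun c _ => hb c]
      split_ifs <;> simp
    · intro l' _ hl'
      refine Finset.sum_eq_zero fun c' _ => ?_
      rw [superBlocks, Matrix.blockDiagonal'_apply_ne _ _ _ hl'.symm, zero_mul]
    · simp
  -- Off the target positions the circuit gives zero. A nonzero amplitude there would have labels in
  -- range and hence sit at a target after all.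
  · rw [Finset.sum_eq_zero fun e _ => if_neg fun h => hex ⟨e, h⟩]
    symm
    by_contra hne
    have hP : P r := by
      by_contra h
      exact hne (if_neg h)
    rw [if_pos hP, amp] at hne
    have hb : stepBit (m + 1) (extend r.1) r.2.1 ≤ r.2.1 := by
      by_contra h
      exact hne (if_neg h)
    rw [if_pos hb] at hne
    have hβ := stepBit_lt (m + 1) (extend r.1) r.2.1
    obtain ⟨hi, c, -, hc⟩ := couple_ne_zero hβ hne
    have hl := (amp_support hc).1.le
    have hwire : ∀ b : Fin 2, stepBit (m + 1) (extend r.1) r.2.1 = b →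
        (toWork n (m + 1) r).1 = fun _ => b := by
      intro b hb
      funext w
      have hw : (w.1 : ℕ) + 2 = m + 1 := w.2
      rw [stepBit, if_neg (by omega)] at hb
      refine Fin.ext (Eq.trans ?_ hb)
      rw [extend_of_lt _ (by omega : m + 1 - 2 < n - 2)]
      exact congr_arg (fun u => (r.1 u : ℕ)) (Fin.ext (show (w.1 : ℕ) = m + 1 - 2 by omega))
    generalize hβ' : stepBit (m + 1) (extend r.1) r.2.1 = β at *
    obtain rfl | rfl : β = 0 ∨ β = 1 := by omega
    · refine hex ⟨⟨⟨r.2.1, by omega⟩, outIndex _ (Sum.inl ⟨r.2.2, by simp only; omega⟩)⟩, ?_⟩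
      rw [slotTarget]
      simp only [Equiv.symm_apply_apply, outPos]
      refine Prod.ext (hwire 0 rfl) (Prod.ext ?_ ?_)
      · simp [toWork]
      · simp [toWork]
    · refine hex ⟨⟨⟨(r.2.1 : ℕ) - 1, by omega⟩,
        outIndex _ (Sum.inr ⟨r.2.2, by simp only; omega⟩)⟩, ?_⟩
      rw [slotTarget]
      simp only [Equiv.symm_apply_apply, outPos]
      refine Prod.ext (hwire 1 rfl) (Prod.ext ?_ ?_)
      · simp [toWork, Nat.sub_add_cancel hb]
      · simp [toWork]

open Classical in
/-- The state of the register after `m` steps. -/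
theorem recursion_initial (hn : 2 ≤ n) {π : ∀ k, Equiv.Perm (Work n k)}
    (hπ : ∀ k ∈ Finset.Icc 1 (n - 1), IsReordering n k (π k)) (x : Fin n → Fin 2) (m : ℕ)
    (hm : m + 2 ≤ n) (r : Reg n) :
    recursion n C π (m + 1) r (initial n hn x) =
      if ∀ w : Fin (n - 2), m ≤ w → r.1 w = extend x (w + 2) then
        amp C (extend x) (extend r.1) (m + 1) r.2.1 r.2.2 else 0 := by
  induction m generalizing r with
  | zero =>
    have hx1 := (extend x 1).2
    have hx0 := (extend x 0).2
    have hinit : initial n hn x = ((fun w => extend x ((w : ℕ) + 2) : Seq n),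
        Fin.ofNat _ (extend x 1 : ℕ), Fin.ofNat _ (extend x 0 : ℕ)) := by
      rw [extend_of_lt x (by omega : 1 < n), extend_of_lt x (by omega : 0 < n)]
      refine Prod.ext (funext fun w => ?_) rfl
      exact (extend_of_lt x (by omega : (w : ℕ) + 2 < n)).symm
    have h0 : ∀ y, recursion n C π 0 y (initial n hn x) =
        if y = initial n hn x then 1 else 0 := fun y => Matrix.one_apply
    rw [recursion, Matrix.mul_apply]
    simp only [h0]
    refine (step_amp (C := C) hm (hπ 1 (by simp; omega)) x (P := fun r => ∀ w : Fin (n - 2),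
      0 ≤ (w : ℕ) → r.1 w = extend x (w + 2)) r (fun ω hω => ?_) fun e => ?_)
    · have hω' : combine r ω = initial n hn x := by
        by_contra h
        exact hω (if_neg h)
      have h2 := congr_arg Prod.snd hω'
      rw [hinit] at h2
      change ω.2 = _ at h2
      refine ⟨⟨0, ⟨extend x 0, by simpa using hx0⟩, extend x 1⟩, Prod.ext (funext fun w => ?_) ?_⟩
      · have := w.2
        omega
      · rw [h2]
        simp [slotPos]
    · obtain ⟨l, i, b⟩ := e
      have hl : (l : ℕ) = 0 := by
        have := l.2
        omega
      have hi := i.2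
      have hb := b.2
      simp only [amp, hinit]
      rw [← ite_and]
      refine if_congr ?_ rfl rfl
      constructor
      · intro h
        have ha := congr_arg Prod.fst h
        have hp := congr_arg (fun y : Reg n => y.2.1) h
        have hs := congr_arg (fun y : Reg n => y.2.2) h
        simp only [combine, slotPos, if_true] at ha hp hs
        have hp' := ofNat_inj (par_lt (by omega)) (par_lt (by omega)) hp
        have hs' := ofNat_inj (stat_lt (by omega)) (stat_lt (by omega)) hs
        refine ⟨⟨fun w _ => ?_, Fin.ext (show (b : ℕ) = (extend x 1 : ℕ) by omega)⟩, hl, hs'⟩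
        have := congr_fun ha w
        rwa [dif_neg (by omega)] at this
      · rintro ⟨⟨ha, hb⟩, -, hi⟩
        change b = extend x 1 at hb
        change (i : ℕ) = extend x 0 at hi
        refine Prod.ext (funext fun w => ?_) (Prod.ext ?_ ?_)
        · simp only [combine]
          rw [dif_neg (by omega)]
          exact ha w (Nat.zero_le _)
        · simp only [combine, slotPos, if_true, hl, zero_add, hb]
        · simp only [combine, slotPos, hi]
  | succ m ih =>
    rw [recursion, Matrix.mul_apply]
    simp only [fun y => ih (by omega) y]
    have hw : m < n - 2 := by omega
    let w₀ : NewWire n (m + 1 + 1) := ⟨⟨m, hw⟩, rfl⟩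
    have hw₀ : ∀ w : NewWire n (m + 1 + 1), w = w₀ := fun w =>
      Subtype.ext (Fin.ext (by have := w.2; simp only [w₀]; omega))
    refine step_amp (C := C) hm (hπ (m + 1 + 1) (by simp; omega)) x (P := fun r =>
      ∀ w : Fin (n - 2), m + 1 ≤ (w : ℕ) → r.1 w = extend x (w + 2)) r (fun ω hω => ?_) fun e => ?_
    · have h1 : amp C (extend x) (extend (combine r ω).1) (m + 1) ω.2.1 ω.2.2 ≠ 0 := by
        intro h
        refine hω ?_
        change (if _ then amp C (extend x) (extend (combine r ω).1) (m + 1) ω.2.1 ω.2.2 else 0) = _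
        rw [h, ite_self]
      obtain ⟨h2, h3⟩ := amp_support h1
      have h4 := h2.le
      refine ⟨⟨⟨ω.2.1, by omega⟩, ⟨ω.2.2, by simp only; omega⟩, ω.1 w₀⟩,
        Prod.ext (funext fun w => ?_) ?_⟩
      · rw [hw₀ w]
        rfl
      · simp [slotPos]
    · obtain ⟨l, i, b⟩ := e
      have hl := l.2
      have hi := i.2
      have hseq : amp C (extend x) (extend (combine r (slotPos n (m + 1 + 1) ⟨l, i, b⟩)).1) (m + 1) =
          amp C (extend x) (extend r.1) (m + 1) := by
        refine amp_congr C (fun _ _ => rfl) fun w hw' => ?_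
        rw [extend_of_lt _ (by omega), extend_of_lt _ (by omega)]
        simp only [combine]
        rw [dif_neg (by omega)]
      have hp : ((combine r (slotPos n (m + 1 + 1) ⟨l, i, b⟩)).2.1 : ℕ) = l := by
        simp only [combine, slotPos]
        rw [if_neg (by omega), add_zero, val_ofNat_of_lt (par_lt (by omega))]
      have hs : ((combine r (slotPos n (m + 1 + 1) ⟨l, i, b⟩)).2.2 : ℕ) = i :=
        val_ofNat_of_lt (stat_lt (by omega))
      rw [hseq, hp, hs]
      refine if_congr ?_ rfl rfl
      constructor
      · intro h
        refine ⟨fun w hwm => ?_, ?_⟩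
        · have := h w (by omega)
          simp only [combine] at this
          rwa [dif_neg (by omega)] at this
        · have := h ⟨m, hw⟩ le_rfl
          simp only [combine] at this
          rwa [dif_pos trivial] at this
      · rintro ⟨h1, h2⟩ w hwm
        simp only [combine]
        by_cases hwm' : (w : ℕ) = m
        · rw [dif_pos (by omega)]
          exact h2.trans (congr_arg (extend x) (show m + 1 + 1 = (w : ℕ) + 2 by omega))
        · rw [dif_neg (by omega)]
          exact h1 w (by omega)

/-! ### The Schur matrix and its unitarity -/

open Classical in
/-- The columns that hold a copy of the irrep `(n - l, l)`. -/
noncomputable def columns (n : ℕ) (l : Fin (n / 2 + 1)) : Finset (Seq n) :=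
  Finset.univ.filter fun s => ValidColumn (extend s) (n - 1) l

/-- The Schur basis in the computational basis. -/
noncomputable def schurMatrix (n : ℕ) (C : CGFamily) :
    Matrix (SchurLabel n fun l => {s // s ∈ columns n l}) (Fin n → Fin 2) ℂ :=
  Matrix.of fun e x => amp C (extend x) (extend e.2.1.1) (n - 1) e.1 e.2.2

theorem mem_columns {l : Fin (n / 2 + 1)} {s : Seq n} :
    s ∈ columns n l ↔ ValidColumn (extend s) (n - 1) l := by simp [columns]

theorem nonempty_columns (hn : 2 ≤ n) (l : Fin (n / 2 + 1)) :
    Nonempty {s // s ∈ columns n l} := by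
  obtain ⟨s, hs⟩ := exists_validColumn (n - 1) l (by omega)
  refine ⟨⟨fun w => s w, mem_columns.2 ?_⟩⟩
  rwa [validColumn_congr fun w hw => extend_of_lt _ (by omega)]

/-- The position of a Schur basis state in the register. -/
def encodePos (n : ℕ) (M : Fin (n / 2 + 1) → Finset (Seq n))
    (e : SchurLabel n fun l => {s // s ∈ M l}) : Reg n :=
  (e.2.1.1, Fin.ofNat _ (e.1 : ℕ), Fin.ofNat _ (e.2.2 : ℕ))

theorem encode_eq (M : Fin (n / 2 + 1) → Finset (Seq n)) :
    encode n M = placement (encodePos n M) := rfl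

theorem encodePos_injective (M : Fin (n / 2 + 1) → Finset (Seq n)) :
    Function.Injective (encodePos n M) := by
  rintro ⟨l, ⟨s, hs⟩, i⟩ ⟨l', ⟨s', hs'⟩, i'⟩ h
  have hl := l.2
  have hl' := l'.2
  have hi := i.2
  have hi' := i'.2
  simp only [encodePos, Prod.mk.injEq] at h
  obtain ⟨rfl, hp, hst⟩ := h
  obtain rfl : l = l' := Fin.ext (ofNat_inj (par_lt (by omega)) (par_lt (by omega)) hp)
  obtain rfl : i = i' := Fin.ext (ofNat_inj (stat_lt (by omega)) (stat_lt (by omega)) hst)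
  rfl

theorem initial_injective (hn : 2 ≤ n) : Function.Injective (initial n hn) := by
  intro x y h
  simp only [initial, Prod.mk.injEq] at h
  obtain ⟨h1, h2, h3⟩ := h
  funext t
  rcases t with ⟨t, ht⟩
  match t, ht with
  | 0, ht =>
    have := ofNat_inj (stat_lt (by have := (x ⟨0, ht⟩).2; omega))
      (stat_lt (by have := (y ⟨0, ht⟩).2; omega)) h3
    exact Fin.ext this
  | 1, ht =>
    have := ofNat_inj (par_lt (by have := (x ⟨1, ht⟩).2; omega))
      (par_lt (by have := (y ⟨1, ht⟩).2; omega)) h2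
    exact Fin.ext this
  | t + 2, ht => exact congr_fun h1 ⟨t, by omega⟩

/-- After the last step no input wires remain, so the register holds the bare amplitudes, and by
`amp_support` these vanish off the encoded positions. -/
theorem recursion_eq_encode (hn : 2 ≤ n) {π : ∀ k, Equiv.Perm (Work n k)}
    (hπ : ∀ k ∈ Finset.Icc 1 (n - 1), IsReordering n k (π k)) :
    (recursion n C π (n - 1)).submatrix id (initial n hn) =
      encode n (columns n) * schurMatrix n C := by
  ext r x
  obtain ⟨m, rfl⟩ : ∃ m, n = m + 2 := ⟨n - 2, by omega⟩
  rw [Matrix.submatrix_apply, id, show m + 2 - 1 = m + 1 by omega,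
    recursion_initial hn hπ x m le_rfl, if_pos (by intro w hw; have := w.2; omega), encode_eq,
    Matrix.mul_apply]
  by_cases h : ∃ e, r = encodePos (m + 2) (columns (m + 2)) e
  · obtain ⟨e, rfl⟩ := h
    have hl := e.1.2
    have hi := e.2.2.2
    rw [Finset.sum_eq_single e]
    · simp only [placement, Matrix.of_apply, if_true, one_mul, schurMatrix, encodePos]
      rw [val_ofNat_of_lt (par_lt (by omega)), val_ofNat_of_lt (stat_lt (by omega))]
      rfl
    · intro e' _ he
      rw [placement, Matrix.of_apply, if_neg fun h => he (encodePos_injective _ h).symm, zero_mul]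
    · simp
  · rw [Finset.sum_eq_zero]
    · by_contra hne
      obtain ⟨h1, h2⟩ := amp_support hne
      have h3 := h1.le
      refine h ⟨⟨⟨r.2.1, by omega⟩, ⟨r.1, mem_columns.2 h1⟩, ⟨r.2.2, by simp only; omega⟩⟩, ?_⟩
      simp [encodePos]
    · intro e _
      rw [placement, Matrix.of_apply, if_neg fun h' => h ⟨e, h'⟩, zero_mul]

theorem card_schurLabel (hn : 2 ≤ n) :
    Fintype.card (SchurLabel n fun l => {s // s ∈ columns n l}) = 2 ^ n := by
  classical
  rw [← sum_columnDim (n := n) (m := n - 1) (by omega) (by omega)]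
  simp only [SchurLabel, Fintype.card_sigma, Fintype.card_prod, Fintype.card_coe, Fintype.card_fin,
    columnDim]
  rw [Finset.sum_comm]
  have h1 : ∀ l ∈ Finset.range (n + 1), l ∉ Finset.range (n / 2 + 1) →
      (∑ s : Seq n, if ValidColumn (extend s) (n - 1) l then n - 1 + 1 - 2 * l + 1 else 0) = 0 := by
    intro l _ hl
    refine Finset.sum_eq_zero fun s _ => if_neg fun hv => hl ?_
    have := hv.le
    rw [Finset.mem_range]
    omega
  rw [← Finset.sum_subset (Finset.range_mono (by omega)) h1, ← Fin.sum_univ_eq_sum_range (fun l =>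
    ∑ s : Seq n, if ValidColumn (extend s) (n - 1) l then n - 1 + 1 - 2 * l + 1 else 0)]
  refine Finset.sum_congr rfl fun l _ => ?_
  rw [← Finset.sum_filter, Finset.sum_const, smul_eq_mul, Nat.sub_add_cancel (by omega)]
  congr 1

/-- The encoding is an isometry and the steps are unitary, so the matrix is an isometry; by
`card_schurLabel` it is square. The remaining properties are those of the amplitudes. -/
theorem isSpinBasis_schurMatrix (hC : ∀ a, IsClebschGordan a (C a)) (hn : 2 ≤ n)
    {π : ∀ k, Equiv.Perm (Work n k)}
    (hπ : ∀ k ∈ Finset.Icc 1 (n - 1), IsReordering n k (π k)) :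
    IsSpinBasis (schurMatrix n C) := by
  have hiso : (schurMatrix n C)ᴴ * schurMatrix n C = 1 := by
    have h1 : (encode n (columns n))ᴴ * encode n (columns n) = 1 := by
      rw [encode_eq]
      exact placement_isometry (encodePos_injective _)
    calc (schurMatrix n C)ᴴ * schurMatrix n C
        = (encode n (columns n) * schurMatrix n C)ᴴ * (encode n (columns n) * schurMatrix n C) := by
          rw [Matrix.conjTranspose_mul, Matrix.mul_assoc, ← Matrix.mul_assoc _ (encode n _), h1,
            Matrix.one_mul]
      _ = ((recursion n C π (n - 1))ᴴ * recursion n C π (n - 1)).submatrix (initial n hn)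
            (initial n hn) := by
          rw [← recursion_eq_encode hn hπ, Matrix.conjTranspose_submatrix,
            ← Matrix.submatrix_mul _ _ _ id _ Function.bijective_id]
      _ = 1 := by
          rw [recursion_unitary hC π (by omega)]
          ext x y
          simp [Matrix.one_apply, (initial_injective hn).eq_iff]
  refine ⟨?_, hiso, fun r x h => ?_, ?_⟩
  · rw [Matrix.mul_eq_one_comm_of_card_eq]
    · exact hiso
    · rw [card_schurLabel hn]
      simp
  · have h1 := amp_weight hC h
    rw [← h1, Nat.sub_add_cancel (by omega), weight, ← Fin.sum_univ_eq_sum_range]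
    simp only [extend_apply]
  · ext ⟨l, s, i⟩ y
    rw [lowBlock_mul_apply, Matrix.mul_apply]
    have h1 : ∀ x, schurMatrix n C ⟨l, s, i⟩ x * lowTotal n x y =
        ∑ t, if y t = 0 ∧ x = Function.update y t 1 then schurMatrix n C ⟨l, s, i⟩ x else 0 := by
      intro x
      simp only [lowTotal, Matrix.of_apply, Finset.mul_sum, mul_ite, mul_one, mul_zero]
    simp only [h1]
    rw [Finset.sum_comm]
    have h2 : ∀ t : Fin n, (∑ x, if y t = 0 ∧ x = Function.update y t 1 then
        schurMatrix n C ⟨l, s, i⟩ x else 0) =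
        if extend y t = 0 then
          amp C (Function.update (extend y) t 1) (extend s.1) (n - 1) l i else 0 := by
      intro t
      rw [extend_apply, ← extend_update]
      by_cases ht : y t = 0
      · simp [ht, schurMatrix]
      · simp [ht]
    simp only [h2]
    have h3 := amp_lowering hC (extend y) (extend s.1) (n - 1) l i
    rw [Nat.sub_add_cancel (by omega : 1 ≤ n), ← Fin.sum_univ_eq_sum_range (fun t =>
      if extend y t = 0 then amp C (Function.update (extend y) t 1) (extend s.1) (n - 1) l i
        else 0)] at h3
    rw [h3]
    split_ifs <;> rfl

theorem performsSchurTransform (hC : ∀ a, IsClebschGordan a (C a)) (hn : 2 ≤ n)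
    {π : ∀ k, Equiv.Perm (Work n k)}
    (hπ : ∀ k ∈ Finset.Icc 1 (n - 1), IsReordering n k (π k)) :
    PerformsSchurTransform n hn (recursion n C π (n - 1)) := by
  have := nonempty_columns hn
  exact ⟨columns n, schurMatrix n C, (isSpinBasis_schurMatrix hC hn hπ).isSchurTransform,
    recursion_eq_encode hn hπ⟩

end Recursion

end QSchur

theorem mainTheorem2 (n : ℕ) (hn : 2 ≤ n) :
    (∃ C : CGFamily, ∀ a, IsClebschGordan a (C a)) ∧
    (∀ C : CGFamily, (∀ a, IsClebschGordan a (C a)) →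
      (∀ a r, (Finset.univ.filter fun c => C a r c ≠ 0).card ≤ 2) ∧
      ∃ (π : ∀ k, Equiv.Perm (Work n k))
        (cg re : ∀ k, List (Matrix (Work n k) (Work n k) ℂ)),
        (∀ k ∈ Finset.Icc 1 (n - 1),
          IsReordering n k (π k) ∧
          (∀ V ∈ cg k, IsTwoLevel V) ∧ circuit (cg k) = superCG n k C ∧
            (cg k).length ≤ 4 * irrepDimSum k ∧
          (∀ V ∈ re k, IsTwoLevel V) ∧ circuit (re k) = permGate (π k) ∧
            (re k).length ≤ 2 * irrepDimSum k) ∧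
        PerformsSchurTransform n hn (recursion n C π (n - 1)) ∧
        ∃ gates : List (Matrix (Reg n) (Reg n) ℂ),
          (∀ G ∈ gates, ∃ k ∈ Finset.Icc 1 (n - 1), ∃ V : Matrix (Work n k) (Work n k) ℂ,
            IsTwoLevel V ∧ G = lift n k V) ∧
          circuit gates = recursion n C π (n - 1) ∧
          gates.length ≤ gateBound n) ∧
    (gateBound n : ℝ) ≤ (n : ℝ) ^ 3 / 2 + 9 * (n : ℝ) ^ 2 / 4 + 13 * (n : ℝ) / 4 - 6 ∧
    (n : ℝ) ^ 3 / 2 + 9 * (n : ℝ) ^ 2 / 4 + 13 * (n : ℝ) / 4 - 6 < 2 * (n : ℝ) ^ 3 := by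
  refine ⟨⟨stdCG, isClebschGordan_stdCG⟩, fun C hC => ⟨fun a r => (hC a).card_row_le r, ?_⟩,
    gateBound_le n hn, polynomial_bound n hn⟩
  have hstep : ∀ k, ∃ (π : Equiv.Perm (Work n k)) (cg re : List (Matrix (Work n k) (Work n k) ℂ)),
      k ∈ Finset.Icc 1 (n - 1) →
        IsReordering n k π ∧
        (∀ V ∈ cg, IsTwoLevel V) ∧ circuit cg = superCG n k C ∧
          cg.length ≤ 4 * irrepDimSum k ∧
        (∀ V ∈ re, IsTwoLevel V) ∧ circuit re = permGate π ∧
          re.length ≤ 2 * irrepDimSum k := by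
    intro k
    by_cases hk : k ∈ Finset.Icc 1 (n - 1)
    · obtain ⟨h1, h2⟩ := Finset.mem_Icc.1 hk
      obtain ⟨cg, hcg⟩ := exists_superCG_circuit hC h1 (show k + 1 ≤ n by omega)
      obtain ⟨π, re, hπ, hre⟩ := exists_reordering_circuit h1 (show k + 1 ≤ n by omega)
      exact ⟨π, cg, re, fun _ => ⟨hπ, hcg.1, hcg.2.1, hcg.2.2, hre⟩⟩
    -- Steps outside the range get dummy data, so that the choice is defined for every `k`.
    · exact ⟨1, [], [], fun h => absurd h hk⟩
  choose π cg re h using hstep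
  exact ⟨π, cg, re, h, performsSchurTransform hC hn fun k hk => (h k hk).1,
    exists_recursion_circuit (fun k hk => (h k hk).2)⟩
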